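/- **Setting.** Let $E=B(0,r_E)\subset\mathbb R^n$, let $g$ be a real analytic Riemannian metric on $E$ with $g_{ab}(0)=\delta_{ab}$, $U:E\to\mathbb R$ a real analytic potential with $U(0)=0$, $d_0U=0$ and non-zero germ at $0$, and $\mu=\sum_i A_i\,dx^i$ a real analytic one-form on $E$. Let $U_l$ be the first non-zero jet of $U$ at $0$, a homogeneous polynomial of degree $l\ge 2$, and $f=U_l|_{S^{n-1}}$. Unless the germ of $\mu$ at $0$ is zero, let $d$ be the degree of its first non-zero jet and assume $\Delta=d-l/2\ge 1$ (if the germ is zero, the magnetic terms below vanish). Consider the Lagrangian $g_x(v,v)/2+\mu_x(v)-U(x)$, its Euler–Lagrange vector field $X$ and the energy $H(x,v)=g_x(v,v)/2+U(x)$. Let $\pi(r,q,y)=(rq,\,r^{l/2}y)$ on $M=[0,r_E)\times S^{n-1}\times\mathbb R^n$, with boundary $\partial M=\{r=0\}$ and interior $\{r>0\}$, and let $\hat M=(-r_E,r_E)\times S^{n-1}\times\mathbb R^n$ be the extended McGehee manifold. Write $\nu=\langle q,y\rangle$. The McGehee vector field $\tilde X$ on $\hat M$ is the $C^1$ field $$r'=\nu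 r,\qquad q'=y-\nu q,\qquad y'=-\nabla U_l(q)-\tfrac l2\nu y+r\,F_X(r,q,y)+\rho(r)\,\mathbf F_X(r,q,y),$$ which equals $r^{1-l/2}(\pi^{-1})_*X$ for $r>0$. Here $\rho(r)=r^{\Delta}$ if $l$ is even, $\rho(r)=|r|^{\Delta}$ if $l$ is odd, and $$F_X^k=-g^{ka}(rq)\,V_a(r,q)-h^{ka}(r,q)\,\partial_aU_l(q)-\Gamma^k_{ij}(rq)\,y^iy^j,\qquad \mathbf F_X^k=g^{ka}(rq)\,\mathcal F_{ab}(r,q)\,y^b,$$ where $\Gamma^k_{ij}$ are the Christoffel symbols of $g$ and $V,h,\mathcal F$ are the real analytic functions with $\nabla U(rq)=r^{l-1}\nabla U_l(q)+r^lV(r,q)$, $g^{ka}(rq)=\delta^{ka}+r\,h^{ka}(r,q)$ and $(\partial_aA_b-\partial_bA_a)(rq)=r^{d-1}\mathcal F_{ab}(r,q)$. Let $\tilde H=r^{-l}H\circ\pi$ for $r>0$, extended to $\partial M$ by $\tilde H(0,q,y)=\|y\|^2/2+U_l(q)$; put $\partial M_{\le 0}=\partial M\cap\{\tilde H\le 0\}$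 and $\partial M_0=\partial M\cap\{\tilde H=0\}$. Stable and unstable manifolds $W^s,W^u$ are those of the flow of $\tilde X$ on $\hat M$. The sphere carries the metric induced from $\mathbb R^n$. **Proposition.** Suppose that $f$ is a Morse function and zero is a regular value of $f$. Then: 1. $\partial M_{\le 0}$ is an embedded (real analytic) submanifold with boundary, of dimension $2n-1$, and its boundary is $\partial M_0$. 2. $\mathrm{Fix}(\partial M_{\le 0})=\mathrm{Fix}(\partial M_0)$, and this set is a finite set of hyperbolic fixed points of $\tilde X$ in $\hat M$. Each of them has the form $\zeta=(0,q,\nu q)$ with $q$ a critical point of $f$ and $\nu\ne 0$. The eigenvalues of the linearization $d_\zeta\tilde X$ on $T_\zeta\hat M$, counted with algebraic multiplicity, are $\nu$, $-l\nu$ and, for each eigenvalue $\hat\lambda_i$ $(1\le i\le n-1)$ of the Hessian of $f$ at $q$, the two numbers $$-\tfrac12\nu\left(\tfrac l2+1\right)\pm\tfrac12\left(\nu^2\left(\tfrac l2+1\right)^2-4\hat\lambda_i\right)^{1/2}.$$ None of them has zero real part. 3. If $\zeta=(0,q,\nu q)$ is one of these fixed points and $\nu<0$ (respectively $\nu>0$),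 then there is an orbit in the interior of $M$ converging to $\zeta$ as time goes to $+\infty$ (respectively $-\infty$), and $\tilde H$ is zero along this orbit. 4. If in addition $q$ is a local minimum of $f$ and $\nu<0$ (respectively $\nu>0$), then the unstable (respectively stable) manifold of $\zeta$ is an open subset of $\partial M$, so that its intersection with $\partial M_{\le 0}$ is open in $\partial M_{\le 0}$; the stable (respectively unstable) manifold of $\zeta$ is an immersed one-dimensional $C^1$ submanifold of $\hat M$, the image of an injective $C^1$ immersion of $\mathbb R$; and the two manifolds intersect transversally at $\zeta$, that is, their tangent spaces at $\zeta$ span $T_\zeta\hat M$. -/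

import Mathlib

open Set Filter Topology
open scoped ContDiff Matrix Gradient Nat

noncomputable section

namespace McGehee

/-- The coordinate space `ℝⁿ` with its Euclidean inner product. -/
abbrev Vec (n : ℕ) := EuclideanSpace ℝ (Fin n)

/-- The ambient space of the triples `(r, q, y)`. -/
abbrev Amb (n : ℕ) := ℝ × Vec n × Vec n

/-! ### First non-zero jets -/

/-- The degree of the first non-zero jet of `F` at the origin (`0` if all jets vanish). -/
def jetDegree {n : ℕ} {W : Type*} [NormedAddCommGroup W] [NormedSpace ℝ W]
    (F : Vec n → W) : ℕ :=
  sInf {k : ℕ | iteratedFDeriv ℝ k F 0 ≠ 0}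

/-- The first non-zero jet of `F` at the origin, as a homogeneous polynomial function. -/
def leadingJet {n : ℕ} (F : Vec n → ℝ) (x : Vec n) : ℝ :=
  ((jetDegree F)! : ℝ)⁻¹ * iteratedFDeriv ℝ (jetDegree F) F 0 (fun _ => x)

/-! ### Functions on the unit sphere

A function on the unit sphere is given as the restriction of a smooth function `F` on `ℝⁿ`. -/

/-- On the unit sphere, the orthogonal projection of `∇F(x)` to the tangent space at `x`, that is
the gradient of the restriction of `F` to the sphere with the induced metric. -/
def sphereGrad {n : ℕ} (F : Vec n → ℝ) (x : Vec n) : Vec n :=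
  ∇ F x - inner ℝ (∇ F x) x • x

/-- The tangent space `q^⊥` of the unit sphere at `q`. -/
abbrev sphereTangent {n : ℕ} (q : Vec n) : Submodule ℝ (Vec n) := (ℝ ∙ q)ᗮ

/-- The Hessian operator at `q` of the restriction of `F` to the unit sphere: the covariant
derivative (the tangential part of the usual derivative) of its gradient. -/
def sphereHess {n : ℕ} (F : Vec n → ℝ) (q : Vec n) : sphereTangent q →ₗ[ℝ] sphereTangent q :=
  ((sphereTangent q).orthogonalProjectionOnto.toLinearMap ∘ₗ
    (fderiv ℝ (sphereGrad F) q).toLinearMap) ∘ₗ (sphereTangent q).subtype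

/-- `q` is a critical point of the restriction of `F` to the unit sphere. -/
def IsSphereCritical {n : ℕ} (F : Vec n → ℝ) (q : Vec n) : Prop :=
  ‖q‖ = 1 ∧ sphereGrad F q = 0

/-- The restriction of `F` to the unit sphere is a Morse function. -/
def IsSphereMorse {n : ℕ} (F : Vec n → ℝ) : Prop :=
  ∀ q, IsSphereCritical F q → LinearMap.ker (sphereHess F q) = ⊥

/-- `c` is a regular value of the restriction of `F` to the unit sphere. -/
def IsSphereRegularValue {n : ℕ} (F : Vec n → ℝ) (c : ℝ) : Prop :=
  ∀ q, IsSphereCritical F q → F q ≠ c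

/-! ### Submanifolds with boundary -/

/-- `S` is an embedded real analytic `d`-dimensional submanifold with boundary of `V`, and its
boundary is `B`: near each point of `S` there is a real analytic chart of `V` that straightens `S`
to a `d`-dimensional linear subspace (away from `B`), or to a half-space of it whose bounding
hyperplane corresponds to `B` (at the points of `B`). -/
def IsSubmanifoldWithBoundary {V : Type*} [NormedAddCommGroup V] [NormedSpace ℝ V]
    (d : ℕ) (S B : Set V) : Prop :=
  B ⊆ S ∧ ∀ x ∈ S, ∃ (k : ℕ) (Φ : OpenPartialHomeomorph V ((Fin d → ℝ) × (Fin k → ℝ))),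
    x ∈ Φ.source ∧ ContDiffOn ℝ ω Φ Φ.source ∧ ContDiffOn ℝ ω Φ.symm Φ.target ∧
    ((x ∉ B ∧ Φ.source ∩ B = ∅ ∧
        Φ.source ∩ S = {z ∈ Φ.source | (Φ z).2 = 0}) ∨
      (x ∈ B ∧ ∃ i : Fin d,
        Φ.source ∩ S = {z ∈ Φ.source | (Φ z).2 = 0 ∧ 0 ≤ (Φ z).1 i} ∧
        Φ.source ∩ B = {z ∈ Φ.source | (Φ z).2 = 0 ∧ (Φ z).1 i = 0}))

/-- `c` is an injective `C¹` immersion of the line with image `W`, which is thereby an immersed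
one-dimensional submanifold. -/
def IsImmersedLine {V : Type*} [NormedAddCommGroup V] [NormedSpace ℝ V]
    (c : ℝ → V) (W : Set V) : Prop :=
  ContDiff ℝ 1 c ∧ Function.Injective c ∧ (∀ t, deriv c t ≠ 0) ∧ range c = W

/-- `W` is contained in `S` and open in it. -/
def IsOpenSubsetOf {V : Type*} [TopologicalSpace V] (W S : Set V) : Prop :=
  W ⊆ S ∧ ∃ O : Set V, IsOpen O ∧ W = O ∩ S

/-! ### The Lagrangian system -/

/-- A real analytic electromagnetic Lagrangian `L(x,v) = g_x(v,v)/2 + μ_x(v) - U(x)` on the ball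
of radius `rE` about the origin of `ℝⁿ`, where `μ = ∑ Aᵢ dxⁱ`. The metric is Euclidean at the
origin, which is a critical point of `U` with `U(0) = 0`, and the germ of `U` there is non-zero. -/
structure LagrangianSystem (n : ℕ) where
  rE : ℝ
  rE_pos : 0 < rE
  g : Vec n → Matrix (Fin n) (Fin n) ℝ
  g_analytic : ∀ i j, AnalyticOnNhd ℝ (fun x => g x i j) (Metric.ball 0 rE)
  g_posDef : ∀ x ∈ Metric.ball (0 : Vec n) rE, (g x).PosDef
  g_zero : g 0 = 1
  U : Vec n → ℝ
  U_analytic : AnalyticOnNhd ℝ U (Metric.ball 0 rE)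
  U_zero : U 0 = 0
  U_critical : fderiv ℝ U 0 = 0
  U_germ_ne_zero : ¬ (U =ᶠ[𝓝 0] 0)
  A : Vec n → Vec n
  A_analytic : AnalyticOnNhd ℝ A (Metric.ball 0 rE)

namespace LagrangianSystem

variable {n : ℕ} (L : LagrangianSystem n)

/-- The degree `l` of the first non-zero jet of the potential. -/
def l : ℕ := jetDegree L.U

/-- The first non-zero jet `U_l` of the potential; `f` is its restriction to the unit sphere. -/
def Ul : Vec n → ℝ := leadingJet L.U

/-- The degree `d` of the first non-zero jet of the magnetic potential. -/
def d : ℕ := jetDegree L.A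

/-- The weak magnetism hypothesis `d - l/2 ≥ 1`; it is void if the magnetic potential is zero
near the origin. -/
def WeakMagnetism : Prop :=
  ¬ (L.A =ᶠ[𝓝 0] 0) → 1 ≤ (L.d : ℝ) - (L.l : ℝ) / 2

/-- The partial derivative `∂ₐ w (x)`. -/
def partialDeriv (a : Fin n) (w : Vec n → ℝ) (x : Vec n) : ℝ :=
  fderiv ℝ w x (EuclideanSpace.single a 1)

/-- The quadratic term `Γᵏᵢⱼ(x) vⁱ vʲ` of the geodesic equation, with the Christoffel symbols
`Γᵏᵢⱼ = ½ ∑ₘ gᵏᵐ (∂ᵢ gⱼₘ + ∂ⱼ gᵢₘ - ∂ₘ gᵢⱼ)`. -/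
def christoffel (x v : Vec n) : Vec n :=
  WithLp.toLp 2 fun k => ∑ i, ∑ j, (1 / 2 : ℝ) * (∑ m, (L.g x)⁻¹ k m *
    (partialDeriv i (fun z => L.g z j m) x + partialDeriv j (fun z => L.g z i m) x
      - partialDeriv m (fun z => L.g z i j) x)) * v i * v j

/-- The magnetic field strength `F_{ab} = ∂ₐ A_b - ∂_b Aₐ`. -/
def magnetic (x : Vec n) : Matrix (Fin n) (Fin n) ℝ :=
  Matrix.of fun a b => partialDeriv a (fun z => L.A z b) x - partialDeriv b (fun z => L.A z a) x

/-- The Euler-Lagrange vector field `X` on phase space: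
`ẋᵏ = vᵏ`, `v̇ᵏ = - gᵏᵃ ∂ₐU - Γᵏᵢⱼ vⁱ vʲ + gᵏᵃ F_{ab} vᵇ`. -/
def eulerLagrange (z : Vec n × Vec n) : Vec n × Vec n :=
  (z.2, -((L.g z.1)⁻¹.toEuclideanLin (∇ L.U z.1)) - L.christoffel z.1 z.2
    + (L.g z.1)⁻¹.toEuclideanLin ((L.magnetic z.1).toEuclideanLin z.2))

/-- The energy `H(x,v) = g_x(v,v)/2 + U(x)`. -/
def energy (z : Vec n × Vec n) : ℝ :=
  inner ℝ z.2 ((L.g z.1).toEuclideanLin z.2) / 2 + L.U z.1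

/-! ### The McGehee manifold -/

/-- The map `π (r, q, y) = (r q, r^{l/2} y)`. -/
def blowdown (ζ : Amb n) : Vec n × Vec n :=
  (ζ.1 • ζ.2.1, (ζ.1 ^ ((L.l : ℝ) / 2)) • ζ.2.2)

/-- The extended McGehee manifold `(-rE, rE) × Sⁿ⁻¹ × ℝⁿ`. -/
def extendedManifold : Set (Amb n) := {ζ | |ζ.1| < L.rE ∧ ‖ζ.2.1‖ = 1}

/-- The interior `(0, rE) × Sⁿ⁻¹ × ℝⁿ` of the McGehee manifold `M = [0, rE) × Sⁿ⁻¹ × ℝⁿ`. -/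
def interiorM : Set (Amb n) := {ζ | 0 < ζ.1 ∧ ζ.1 < L.rE ∧ ‖ζ.2.1‖ = 1}

/-- The boundary `{0} × Sⁿ⁻¹ × ℝⁿ` of the McGehee manifold. -/
def bdry (_L : LagrangianSystem n) : Set (Amb n) := {ζ | ζ.1 = 0 ∧ ‖ζ.2.1‖ = 1}

/-- The tangent space of the extended McGehee manifold at `ζ`. -/
def tangentExtended (_L : LagrangianSystem n) (ζ : Amb n) : Submodule ℝ (Amb n) :=
  (⊤ : Submodule ℝ ℝ).prod ((sphereTangent ζ.2.1).prod ⊤)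

/-- The tangent space of the boundary of the McGehee manifold at `ζ`. -/
def tangentBdry (_L : LagrangianSystem n) (ζ : Amb n) : Submodule ℝ (Amb n) :=
  (⊥ : Submodule ℝ ℝ).prod ((sphereTangent ζ.2.1).prod ⊤)

/-- The rescaled energy on the McGehee manifold: `r^{-l} H ∘ π` for `r > 0`, extended by
`‖y‖²/2 + U_l(q)` to `r = 0`. -/
def rescaledEnergy (ζ : Amb n) : ℝ :=
  if ζ.1 = 0 then ‖ζ.2.2‖ ^ 2 / 2 + L.Ul ζ.2.1
  else (ζ.1 ^ L.l)⁻¹ * L.energy (L.blowdown ζ)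

/-- The critical boundary `∂M₀`. -/
def bdryZero : Set (Amb n) := {ζ ∈ L.bdry | L.rescaledEnergy ζ = 0}

/-- The critical and subcritical boundary `∂M_{≤0}`. -/
def bdryLE : Set (Amb n) := {ζ ∈ L.bdry | L.rescaledEnergy ζ ≤ 0}

/-! ### The McGehee vector field

The quotients by powers of `r` below extend analytically to `r = 0`; the values that Lean gives
them there are irrelevant, because they enter the vector field only through products with `r` or
with `magneticFactor r`, which vanish at `r = 0`. (If the magnetic potential is zero, then so is
the magnetic term.) -/

/-- `V_{>l}`, defined by `∇U(r q) = r^{l-1} ∇U_l(q) + r^l V_{>l}(r, q)`. -/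
def gradRemainder (r : ℝ) (q : Vec n) : Vec n :=
  (r ^ L.l)⁻¹ • (∇ L.U (r • q) - r ^ (L.l - 1) • ∇ L.Ul q)

/-- `h`, defined by `gᵏᵃ(r q) = δᵏᵃ + r hᵏᵃ(r, q)`. -/
def metricRemainder (r : ℝ) (q : Vec n) : Matrix (Fin n) (Fin n) ℝ :=
  r⁻¹ • ((L.g (r • q))⁻¹ - 1)

/-- `F_X`: the correction coming from the potential and the metric. -/
def correction (ζ : Amb n) : Vec n :=
  -((L.g (ζ.1 • ζ.2.1))⁻¹.toEuclideanLin (L.gradRemainder ζ.1 ζ.2.1))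
    - (L.metricRemainder ζ.1 ζ.2.1).toEuclideanLin (∇ L.Ul ζ.2.1)
    - L.christoffel (ζ.1 • ζ.2.1) ζ.2.2

/-- The magnetic correction `gᵏᵃ(r q) F_{ab,≥d}(r, q) yᵇ`, where
`F_{ab}(r q) = r^{d-1} F_{ab,≥d}(r, q)`. -/
def magneticCorrection (ζ : Amb n) : Vec n :=
  (L.g (ζ.1 • ζ.2.1))⁻¹.toEuclideanLin
    (((ζ.1 ^ (L.d - 1))⁻¹ • L.magnetic (ζ.1 • ζ.2.1)).toEuclideanLin ζ.2.2)

/-- The factor `r^Δ` with `Δ = d - l/2` if `l` is even, and `|r|^Δ` if `l` is odd. -/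
def magneticFactor (r : ℝ) : ℝ :=
  if Even L.l then r ^ (L.d - L.l / 2) else |r| ^ ((L.d : ℝ) - (L.l : ℝ) / 2)

/-- The McGehee vector field on the extended McGehee manifold:
`r' = ν r`, `q' = y - ν q`, `y' = -∇U_l(q) - (l/2) ν y + r F_X + r^Δ 𝐅_X`, with `ν = ⟨q, y⟩`. -/
def field (ζ : Amb n) : Amb n :=
  (inner ℝ ζ.2.1 ζ.2.2 * ζ.1,
    ζ.2.2 - inner ℝ ζ.2.1 ζ.2.2 • ζ.2.1,
    -(∇ L.Ul ζ.2.1) - ((L.l : ℝ) / 2 * inner ℝ ζ.2.1 ζ.2.2) • ζ.2.2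
      + ζ.1 • L.correction ζ + L.magneticFactor ζ.1 • L.magneticCorrection ζ)

/-! ### The McGehee field and the Euler-Lagrange field -/

theorem christoffel_smul (x v : Vec n) (c : ℝ) :
    L.christoffel x (c • v) = (c ^ 2) • L.christoffel x v := by
  ext k
  simp only [christoffel, PiLp.smul_apply, smul_eq_mul, Finset.mul_sum]
  refine Finset.sum_congr rfl fun i _ => Finset.sum_congr rfl fun j _ => ?_
  rw [← Finset.mul_sum]
  ring

theorem one_le_l : 1 ≤ L.l := by
  have hne : {k : ℕ | iteratedFDeriv ℝ k L.U 0 ≠ 0}.Nonempty := by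
    by_contra hemp
    rw [Set.not_nonempty_iff_eq_empty] at hemp
    obtain ⟨p, hp⟩ := L.U_analytic 0 (Metric.mem_ball_self L.rE_pos)
    obtain ⟨ρ, hρ⟩ := hp
    refine L.U_germ_ne_zero ?_
    filter_upwards [Metric.eball_mem_nhds 0 hρ.r_pos] with x hx
    have hs := hρ.hasSum_iteratedFDeriv (y := x) (by simpa using hx)
    have h0 : ∀ k, iteratedFDeriv ℝ k L.U 0 = 0 := fun k => by
      by_contra hk
      exact (hemp ▸ (show k ∈ {k : ℕ | iteratedFDeriv ℝ k L.U 0 ≠ 0} from hk) : k ∈ (∅ : Set ℕ))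
    simp only [h0, zero_apply, smul_zero, zero_add] at hs
    exact hs.unique hasSum_zero
  have hmem : iteratedFDeriv ℝ L.l L.U 0 ≠ 0 := Nat.sInf_mem hne
  by_contra hl
  have hl0 : L.l = 0 := by omega
  rw [hl0] at hmem
  refine hmem ?_
  ext m
  simp [L.U_zero]

theorem magnetic_eq_zero (hA : L.A =ᶠ[𝓝 0] 0) {x : Vec n} (hx : x ∈ Metric.ball 0 L.rE) :
    L.magnetic x = 0 := by
  have h := L.A_analytic.eqOn_zero_of_preconnected_of_eventuallyEq_zero
    (convex_ball (0 : Vec n) L.rE).isPreconnected (Metric.mem_ball_self L.rE_pos) hA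
  have h' : ∀ b, (fun z => L.A z b) =ᶠ[𝓝 x] fun _ => 0 := fun b => by
    filter_upwards [Metric.isOpen_ball.mem_nhds hx] with z hz
    simp [h hz]
  ext a b
  simp [magnetic, partialDeriv, (h' a).fderiv_eq, (h' b).fderiv_eq]

theorem field_snd_snd (hmag : L.WeakMagnetism) {ζ : Amb n} (h : ζ ∈ L.interiorM) :
    (L.field ζ).2.2 = (ζ.1 ^ (1 - (L.l : ℝ))) • (L.eulerLagrange (L.blowdown ζ)).2
      - ((L.l : ℝ) / 2 * inner ℝ ζ.2.1 ζ.2.2) • ζ.2.2 := by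
  have hl := L.one_le_l
  obtain ⟨r, q, y⟩ := ζ
  obtain ⟨hr, hrE, hq⟩ := h
  simp only at hr hrE hq
  have e1 : r ^ (1 - (L.l : ℝ)) = (r ^ (L.l - 1))⁻¹ := by
    rw [← Real.rpow_natCast, ← Real.rpow_neg hr.le]
    congr 1
    push_cast [Nat.cast_sub hl]
    ring
  have e3 : r ^ (1 - (L.l : ℝ)) * (r ^ ((L.l : ℝ) / 2)) ^ 2 = r := by
    rw [← Real.rpow_natCast, ← Real.rpow_mul hr.le, ← Real.rpow_add hr]
    conv_rhs => rw [← Real.rpow_one r]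
    congr 1
    push_cast
    ring
  have e4 : r * (r ^ L.l)⁻¹ = (r ^ (L.l - 1))⁻¹ := by
    obtain ⟨m, hm⟩ : ∃ m, L.l = m + 1 := ⟨L.l - 1, by omega⟩
    rw [hm, Nat.add_sub_cancel, pow_succ]
    field_simp
  have e5 : (r ^ (L.l - 1))⁻¹ * r ^ (L.l - 1) = 1 := inv_mul_cancel₀ (by positivity)
  have e6 : r * r⁻¹ = 1 := mul_inv_cancel₀ hr.ne'
  rw [e1] at e3 ⊢
  by_cases hA : L.A =ᶠ[𝓝 0] 0
  · have hF : L.magnetic (r • q) = 0 := L.magnetic_eq_zero hA (by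
      simp [norm_smul, hq, abs_of_pos hr, hrE])
    simp only [field, eulerLagrange, blowdown, christoffel_smul, correction, magneticCorrection,
      gradRemainder, metricRemainder, hF]
    simp only [map_smul, map_sub, map_zero, LinearMap.smul_apply, LinearMap.sub_apply, smul_sub,
      smul_neg, smul_smul, ← mul_assoc, e3, e4, e6, e5, one_smul, smul_zero, smul_add,
      LinearMap.zero_apply]
    simp
    abel
  · have hd2 : (2 : ℝ) + L.l ≤ 2 * L.d := by linarith [hmag hA]
    have hd2' : 2 + L.l ≤ 2 * L.d := by exact_mod_cast hd2
    have hd : 1 ≤ L.d := by omega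
    have e2 : L.magneticFactor r * (r ^ (L.d - 1))⁻¹
        = (r ^ (L.l - 1))⁻¹ * r ^ ((L.l : ℝ) / 2) := by
      have : L.magneticFactor r = r ^ ((L.d : ℝ) - (L.l : ℝ) / 2) := by
        unfold magneticFactor
        split_ifs with he
        · obtain ⟨m, hm⟩ := he
          rw [← Real.rpow_natCast, Nat.cast_sub (by omega), Nat.cast_div (by omega) (by norm_num)]
          norm_num
        · rw [abs_of_pos hr]
      rw [this, ← e1, ← Real.rpow_natCast, ← Real.rpow_neg hr.le, ← Real.rpow_add hr,
        ← Real.rpow_add hr]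
      congr 1
      push_cast [Nat.cast_sub hd]
      ring
    simp only [field, eulerLagrange, blowdown, christoffel_smul, correction, magneticCorrection,
      gradRemainder, metricRemainder]
    simp only [map_smul, map_sub, LinearMap.smul_apply, LinearMap.sub_apply, smul_add, smul_sub,
      smul_neg, smul_smul, ← mul_assoc, e2, e3, e4, e6, e5, one_smul]
    simp
    abel

/-- In the interior of the McGehee manifold, `field` is `r^{1-l/2} (π⁻¹)_* X`, where `X` is the
Euler-Lagrange field. -/
theorem field_pushforward (hmag : L.WeakMagnetism) {ζ : Amb n} (h : ζ ∈ L.interiorM) :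
    HasFDerivAt L.blowdown (fderiv ℝ L.blowdown ζ) ζ ∧
      fderiv ℝ L.blowdown ζ (L.field ζ) =
        (ζ.1 ^ (1 - (L.l : ℝ) / 2)) • L.eulerLagrange (L.blowdown ζ) := by
  have hr : 0 < ζ.1 := h.1
  have h1 : HasFDerivAt (fun z : Amb n => z.1) (ContinuousLinearMap.fst ℝ ℝ (Vec n × Vec n)) ζ :=
    hasFDerivAt_fst
  have h2 : HasFDerivAt (fun z : Amb n => z.2.1)
      ((ContinuousLinearMap.fst ℝ (Vec n) (Vec n)).comp
        (ContinuousLinearMap.snd ℝ ℝ (Vec n × Vec n))) ζ :=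
    hasFDerivAt_fst.comp ζ hasFDerivAt_snd
  have h3 : HasFDerivAt (fun z : Amb n => z.2.2)
      ((ContinuousLinearMap.snd ℝ (Vec n) (Vec n)).comp
        (ContinuousLinearMap.snd ℝ ℝ (Vec n × Vec n))) ζ :=
    hasFDerivAt_snd.comp ζ hasFDerivAt_snd
  have h4 := h1.rpow_const (p := (L.l : ℝ) / 2) (Or.inl hr.ne')
  have hD : HasFDerivAt L.blowdown _ ζ := (h1.smul h2).prodMk (h4.smul h3)
  refine ⟨hD.differentiableAt.hasFDerivAt, ?_⟩
  have hF := L.field_snd_snd hmag h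
  have key : ζ.1 ^ ((L.l : ℝ) / 2) * ζ.1 ^ (1 - (L.l : ℝ)) = ζ.1 ^ (1 - (L.l : ℝ) / 2) := by
    rw [← Real.rpow_add hr]
    congr 1
    ring
  have key2 : ζ.1 * ζ.1 ^ ((L.l : ℝ) / 2 - 1) = ζ.1 ^ ((L.l : ℝ) / 2) := by
    conv_lhs => enter [1]; rw [← Real.rpow_one ζ.1]
    rw [← Real.rpow_add hr]
    congr 1
    ring
  have key3 : ζ.1 ^ (1 - (L.l : ℝ) / 2) * ζ.1 ^ ((L.l : ℝ) / 2) = ζ.1 := by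
    rw [← Real.rpow_add hr]
    simp
  rw [hD.fderiv]
  refine Prod.ext ?_ ?_
  · change ζ.1 • (ζ.2.2 - inner ℝ ζ.2.1 ζ.2.2 • ζ.2.1)
        + (inner ℝ ζ.2.1 ζ.2.2 * ζ.1) • ζ.2.1
      = ζ.1 ^ (1 - (L.l : ℝ) / 2) • (ζ.1 ^ ((L.l : ℝ) / 2) • ζ.2.2)
    rw [smul_smul, key3]
    module
  · change ζ.1 ^ ((L.l : ℝ) / 2) • (L.field ζ).2.2
        + ((((L.l : ℝ) / 2) * ζ.1 ^ ((L.l : ℝ) / 2 - 1)) * (inner ℝ ζ.2.1 ζ.2.2 * ζ.1)) • ζ.2.2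
      = ζ.1 ^ (1 - (L.l : ℝ) / 2) • (L.eulerLagrange (L.blowdown ζ)).2
    rw [hF, ← key, ← key2]
    module


/-! ### The McGehee flow -/

/-- `γ` is an integral curve, in the extended McGehee manifold, on the set of times `I`. -/
def IsSolutionOn (γ : ℝ → Amb n) (I : Set ℝ) : Prop :=
  ∀ t ∈ I, γ t ∈ L.extendedManifold ∧ HasDerivWithinAt γ (L.field (γ t)) I t

/-- The orbit of `ζ`: all points on the maximal integral curve through `ζ`. -/
def orbit (ζ : Amb n) : Set (Amb n) :=
  {w | ∃ (γ : ℝ → Amb n) (t : ℝ), L.IsSolutionOn γ (uIcc 0 t) ∧ γ 0 = ζ ∧ γ t = w}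

/-- The stable manifold of `ζ` in the extended McGehee manifold. -/
def stableManifold (ζ : Amb n) : Set (Amb n) :=
  {w | ∃ γ : ℝ → Amb n, L.IsSolutionOn γ (Ici 0) ∧ γ 0 = w ∧ Tendsto γ atTop (𝓝 ζ)}

/-- The unstable manifold of `ζ` in the extended McGehee manifold. -/
def unstableManifold (ζ : Amb n) : Set (Amb n) :=
  {w | ∃ γ : ℝ → Amb n, L.IsSolutionOn γ (Iic 0) ∧ γ 0 = w ∧ Tendsto γ atBot (𝓝 ζ)}

/-- The fixed points of the McGehee flow in `S`. -/
def fixedPoints (S : Set (Amb n)) : Set (Amb n) := {ζ ∈ S | L.field ζ = 0}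

/-- `T` is the linearization at the fixed point `ζ` of the McGehee vector field, as a vector field
on the extended McGehee manifold. -/
def IsLinearization (ζ : Amb n) (T : L.tangentExtended ζ →ₗ[ℝ] L.tangentExtended ζ) : Prop :=
  ∃ D : Amb n →L[ℝ] Amb n, HasFDerivWithinAt L.field D L.extendedManifold ζ ∧
    ∀ v : L.tangentExtended ζ, D v = T v

end LagrangianSystem

/-- A real endomorphism is hyperbolic if none of its complex eigenvalues is purely imaginary. -/
def IsHyperbolic {W : Type*} [AddCommGroup W] [Module ℝ W] [Module.Finite ℝ W] [Module.Free ℝ W]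
    (T : W →ₗ[ℝ] W) : Prop :=
  ∀ z : ℂ, (T.charpoly.map (algebraMap ℝ ℂ)).IsRoot z → z.re ≠ 0

/-- `-½ ν (l/2 + 1) + ½ s (ν² (l/2 + 1)² - 4 lam)^{1/2}`, used with the signs `s = 1` and
`s = -1`. -/
def boundaryEigenvalue (l : ℕ) (ν lam : ℝ) (s : ℂ) : ℂ :=
  -(1 / 2) * (ν * ((l : ℂ) / 2 + 1)) +
    s * (1 / 2) * (((ν ^ 2 * ((l : ℝ) / 2 + 1) ^ 2 - 4 * lam : ℝ) : ℂ) ^ (1 / 2 : ℂ))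

end McGehee

end

/-!
Write `ζ = (0, q, ν q)`. On `∂M` the terms `r F_X` and `r^Δ 𝐅_X` vanish, so a zero of the McGehee
field there has `y = ν q` and `∇U_l(q) = -(l/2) ν² q`; by Euler's identity `U_l(q) = -ν²/2`, hence
the energy is zero and, `0` being a regular value of `f`, `ν ≠ 0` (`isFixed_of_field_eq_zero`). That
the field is `C¹` (`contDiffOn_field`) is Hadamard's lemma: quotients by powers of `r` are iterated
integrals along rays (`exists_radial_quotient`). `∂M_{≤0}` is cut out by `r`, `‖q‖² - 1` and the
boundary energy, which are independent by the regularity of the value `0`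
(`isSubmanifoldWithBoundary_bdryLE`).

In the coordinates of `adaptedCoord` the linearization at `ζ` is triangular: the direction of `r`
has the eigenvalue `ν`, the two radial directions have `-2ν` (normal to the sphere) and `-lν`, and the
tangential part is `ξ'' + ν (l/2 + 1) ξ' + Hess f ξ = 0`, which splits into damped oscillators in an
eigenbasis of the Hessian (`IsFixed.adaptedCoord_fderiv`, `exists_eigenCoord`). This gives the
characteristic polynomial and hyperbolicity (`IsFixed.exists_linearization`), and isolated zeros
in a compact set are finite in number (`finite_fixedPoints`). For `ν < 0` the oscillator of a
negative eigenvalue of the Hessian is a saddle and that of a positive one a source, so that over a local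
minimum `r` is the only contracted direction (`IsFixed.exists_splitting`).

The invariant manifold theory is proved in the ambient space, for the flow near a hyperbolic fixed
point: existence of solutions converging to it over every small stable coordinate, by Irwin's fixed
point argument for the time-`h` map (`exists_bounded_orbit`), and a cone condition
(`cone_of_bounded_orbits`), which gives uniqueness and tangency. The set `‖q‖ = 1` is
invariant, and repelling where `⟨q, y⟩ < 0`, so the converging solutions lie in `M̂`. Those with
`r > 0` remain in the interior, and the energy, being constant on the orbit and continuous at the
origin, is zero (`IsFixed.exists_stable_orbit`).

Over a local minimum, the stable manifold for `ν < 0` near `ζ` is a curve parametrized by `r`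
(`IsLocalStableCurve`). Globally it consists of `ζ` and of one maximal solution on each side of `∂M`
(`IsLocalStableCurve.exists_branch`). Along these solutions `r e^{-νt}` converges to a non-zero
number, so a multiple of `e^{νt}` is a parameter with respect to which the two halves fit together
to an immersion of class `C¹` (`IsFixed.exists_isImmersedLine_stableManifold`). In the boundary,
where `ζ` is a sink if `ν > 0`, the stable manifold is open by continuous dependence
(`IsFixed.isOpenSubsetOf_stableManifold`). Changing the signs of `y`, of time and of the magnetic
potential exchanges `ν` and `-ν`, stable and unstable manifolds (`unstableManifold_eq`).
-/


/-! ### Ordinary differential equations -/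

section ODE

variable {E : Type*} [NormedAddCommGroup E] [NormedSpace ℝ E]

theorem IsIntegralCurveOn.hasDerivWithinAt_Ici {v : ℝ → E → E} {γ : ℝ → E} {a b t : ℝ}
    (h : IsIntegralCurveOn γ v (Icc a b)) (ht : t ∈ Ico a b) :
    HasDerivWithinAt γ (v t (γ t)) (Ici t) t :=
  (h t (Ico_subset_Icc_self ht)).mono_of_mem_nhdsWithin (Icc_mem_nhdsGE_of_mem ht)

theorem IsIntegralCurveOn.hasDerivWithinAt_Iic {v : ℝ → E → E} {γ : ℝ → E} {a b t : ℝ}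
    (h : IsIntegralCurveOn γ v (Icc a b)) (ht : t ∈ Ioc a b) :
    HasDerivWithinAt γ (v t (γ t)) (Iic t) t :=
  (h t (Ioc_subset_Icc_self ht)).mono_of_mem_nhdsWithin (Icc_mem_nhdsLE_of_mem ht)

/-- Two integral curves that meet at time `b` can be concatenated there. -/
theorem IsIntegralCurveOn.concat {v : ℝ → E → E} {f g : ℝ → E} {I J : Set ℝ} {b : ℝ}
    (hf : IsIntegralCurveOn f v I) (hg : IsIntegralCurveOn g v J) (hI : I ⊆ Iic b)
    (hJ : J ⊆ Ici b) (hbI : b ∈ I) (hbJ : b ∈ J) (hfg : f b = g b) :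
    IsIntegralCurveOn (fun t => if t ≤ b then f t else g t) v (I ∪ J) := by
  have hfI : EqOn (fun t => if t ≤ b then f t else g t) f I := fun t ht => if_pos (hI ht)
  have hgJ : EqOn (fun t => if t ≤ b then f t else g t) g J := fun t ht => by
    rcases (show b ≤ t from hJ ht).eq_or_lt with rfl | h
    · simp [hfg]
    · simp [not_le.2 h]
  have hcI : closure I ⊆ Iic b := closure_minimal hI isClosed_Iic
  have hcJ : closure J ⊆ Ici b := closure_minimal hJ isClosed_Ici
  intro t ht
  refine HasDerivWithinAt.union ?_ ?_
  · by_cases h : t ∈ I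
    · have := (hf t h).congr hfI (hfI h)
      rwa [← hfI h] at this
    · refine HasFDerivWithinAt.of_notMem_closure fun hc => h ?_
      have h1 : t ≤ b := hcI hc
      have h2 : b ≤ t := hJ (ht.resolve_left h)
      rwa [le_antisymm h1 h2]
  · by_cases h : t ∈ J
    · have := (hg t h).congr hgJ (hgJ h)
      rwa [← hgJ h] at this
    · refine HasFDerivWithinAt.of_notMem_closure fun hc => h ?_
      have h1 : t ≤ b := hI (ht.resolve_right h)
      have h2 : b ≤ t := hcJ hc
      rwa [le_antisymm h1 h2]

theorem IsIntegralCurveOn.comp_add_const {G : E → E} {γ : ℝ → E} {I J : Set ℝ}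
    (h : IsIntegralCurveOn γ (fun _ => G) I) (c : ℝ) (hJ : ∀ t ∈ J, t + c ∈ I) :
    IsIntegralCurveOn (fun t => γ (t + c)) (fun _ => G) J := fun t ht => by
  have h1 := (h (t + c) (hJ t ht)).scomp t
    ((hasDerivWithinAt_id t J).add_const c) (fun s hs => hJ s hs)
  simpa using! h1

theorem exists_lipschitzOnWith_of_contDiffOn {F : Type*} [NormedAddCommGroup F] [NormedSpace ℝ F]
    {G : E → F} {Ω K : Set E} (hΩ : IsOpen Ω)
    (hG : ContDiffOn ℝ 1 G Ω) (hK : IsCompact K) (hKΩ : K ⊆ Ω) :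
    ∃ C, LipschitzOnWith C G K := by
  refine LocallyLipschitzOn.exists_lipschitzOnWith_of_compact hK fun x hx => ?_
  obtain ⟨C, t, ht, hC⟩ := (hG.contDiffAt (hΩ.mem_nhds (hKΩ hx))).exists_lipschitzOnWith
  exact ⟨C, t, mem_nhdsWithin_of_mem_nhds ht, hC⟩

/-- Uniqueness of the integral curves of a `C¹` vector field on an open set. -/
theorem IsIntegralCurveOn.eqOn {G : E → E} {Ω : Set E} (hΩ : IsOpen Ω)
    (hG : ContDiffOn ℝ 1 G Ω) {f g : ℝ → E} {I : Set ℝ} (hI : I.OrdConnected)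
    (hf : IsIntegralCurveOn f (fun _ => G) I) (hg : IsIntegralCurveOn g (fun _ => G) I)
    (hfΩ : ∀ t ∈ I, f t ∈ Ω) (hgΩ : ∀ t ∈ I, g t ∈ Ω) {t₀ : ℝ} (ht₀ : t₀ ∈ I)
    (h : f t₀ = g t₀) : EqOn f g I := by
  have key : ∀ a b, Icc a b ⊆ I → ∃ C : NNReal,
      LipschitzOnWith C G (f '' Icc a b ∪ g '' Icc a b) := fun a b hab => by
    refine exists_lipschitzOnWith_of_contDiffOn hΩ hG ?_ ?_
    · exact (isCompact_Icc.image_of_continuousOn (hf.continuousOn.mono hab)).union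
        (isCompact_Icc.image_of_continuousOn (hg.continuousOn.mono hab))
    · rintro _ (⟨t, ht, rfl⟩ | ⟨t, ht, rfl⟩)
      exacts [hfΩ t (hab ht), hgΩ t (hab ht)]
  intro t ht
  rcases le_total t₀ t with h0 | h0
  · have hab := hI.out ht₀ ht
    obtain ⟨C, hC⟩ := key _ _ hab
    exact ODE_solution_unique_of_mem_Icc_right (v := fun _ => G) (s := fun _ => _)
      (fun _ _ => hC) (hf.mono hab).continuousOn
      (fun s hs => (hf.mono hab).hasDerivWithinAt_Ici hs)
      (fun s hs => .inl (mem_image_of_mem _ (Ico_subset_Icc_self hs)))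
      (hg.mono hab).continuousOn (fun s hs => (hg.mono hab).hasDerivWithinAt_Ici hs)
      (fun s hs => .inr (mem_image_of_mem _ (Ico_subset_Icc_self hs))) h (right_mem_Icc.2 h0)
  · have hab := hI.out ht ht₀
    obtain ⟨C, hC⟩ := key _ _ hab
    exact ODE_solution_unique_of_mem_Icc_left (v := fun _ => G) (s := fun _ => _)
      (fun _ _ => hC) (hf.mono hab).continuousOn
      (fun s hs => (hf.mono hab).hasDerivWithinAt_Iic hs)
      (fun s hs => .inl (mem_image_of_mem _ (Ioc_subset_Icc_self hs)))
      (hg.mono hab).continuousOn (fun s hs => (hg.mono hab).hasDerivWithinAt_Iic hs)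
      (fun s hs => .inr (mem_image_of_mem _ (Ioc_subset_Icc_self hs))) h (left_mem_Icc.2 h0)

/-- A globally Lipschitz vector field is complete in forward time. -/
theorem exists_isIntegralCurveOn_Ici_of_lipschitzWith [CompleteSpace E] {G : E → E} {K : NNReal}
    (hG : LipschitzWith K G) (x : E) :
    ∃ γ : ℝ → E, γ 0 = x ∧ IsIntegralCurveOn γ (fun _ => G) (Ici 0) := by
  -- the length of the interval of existence does not depend on the initial point
  obtain ⟨h, h0, hK⟩ : ∃ h : ℝ, 0 < h ∧ K * h ≤ 1 / 2 := by
    refine ⟨1 / (2 * (K + 1)), by positivity, ?_⟩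
    rw [mul_one_div, div_le_iff₀ (by positivity)]
    nlinarith [K.coe_nonneg]
  have step : ∀ x : E, ∃ γ : ℝ → E, γ 0 = x ∧ IsIntegralCurveOn γ (fun _ => G) (Icc 0 h) := by
    intro x
    have hPL : IsPicardLindelof (fun _ : ℝ => G) (tmin := 0) (tmax := h)
        ⟨0, left_mem_Icc.2 h0.le⟩ x (2 * h.toNNReal * ‖G x‖₊) 0
        (‖G x‖₊ + K * (2 * h.toNNReal * ‖G x‖₊)) K := by
      refine .of_time_independent (fun y hy => ?_) hG.lipschitzOnWith ?_
      · have h1 := hG.norm_sub_le y x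
        have h2 : ‖y - x‖ ≤ 2 * h * ‖G x‖ := by
          simpa [h0.le, dist_eq_norm] using hy
        have h3 : ‖G y‖ ≤ ‖G x‖ + ‖G y - G x‖ := norm_le_insert' _ _
        push_cast
        rw [Real.coe_toNNReal _ h0.le]
        have := mul_le_mul_of_nonneg_left h2 K.coe_nonneg
        linarith
      · push_cast
        rw [Real.coe_toNNReal _ h0.le]
        simp only [sub_zero]
        rw [max_eq_left h0.le]
        have := mul_le_mul_of_nonneg_right hK (mul_nonneg h0.le (norm_nonneg (G x)))
        nlinarith
    obtain ⟨γ, h1, h2⟩ := hPL.exists_eq_forall_mem_Icc_hasDerivWithinAt₀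
    exact ⟨γ, h1, h2⟩
  -- solutions on `[0, n h]` by concatenation; by uniqueness they agree where both are defined
  have steps : ∀ (n : ℕ) (x : E), ∃ γ : ℝ → E, γ 0 = x ∧
      IsIntegralCurveOn γ (fun _ => G) (Icc 0 (n * h)) := by
    intro n
    induction n with
    | zero =>
      intro x
      obtain ⟨γ, h1, h2⟩ := step x
      exact ⟨γ, h1, h2.mono (Icc_subset_Icc_right (by simpa using h0.le))⟩
    | succ n ih =>
      intro x
      obtain ⟨γ, h1, h2⟩ := ih x
      obtain ⟨γ', h1', h2'⟩ := step (γ (n * h))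
      have hn : 0 ≤ n * h := by positivity
      have h3 : IsIntegralCurveOn (fun t => γ' (t + -(n * h))) (fun _ => G)
          (Icc (n * h) ((n + 1) * h)) :=
        h2'.comp_add_const _ fun t ht => ⟨by linarith [ht.1], by linarith [ht.2]⟩
      have h4 := h2.concat h3 Icc_subset_Iic_self Icc_subset_Ici_self (right_mem_Icc.2 hn)
        (left_mem_Icc.2 (by nlinarith)) (by simp [h1'])
      rw [Icc_union_Icc_eq_Icc hn (by nlinarith)] at h4
      refine ⟨_, ?_, by exact_mod_cast h4⟩
      simp [hn, h1]
  choose Γ hΓ0 hΓ using fun n => steps n x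
  have huniq : ∀ {f g : ℝ → E} {T : ℝ}, IsIntegralCurveOn f (fun _ => G) (Icc 0 T) →
      IsIntegralCurveOn g (fun _ => G) (Icc 0 T) → f 0 = g 0 → EqOn f g (Icc 0 T) :=
    fun hf hg h => ODE_solution_unique (v := fun _ => G) (fun _ => hG) hf.continuousOn
      (fun s hs => hf.hasDerivWithinAt_Ici hs) hg.continuousOn
      (fun s hs => hg.hasDerivWithinAt_Ici hs) h
  have hagree : ∀ (n m : ℕ) (t : ℝ), 0 ≤ t → t ≤ n * h → t ≤ m * h → Γ n t = Γ m t := by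
    intro n m t ht hn hm
    exact huniq ((hΓ n).mono (Icc_subset_Icc_right hn)) ((hΓ m).mono (Icc_subset_Icc_right hm))
      (by rw [hΓ0, hΓ0]) (right_mem_Icc.2 ht)
  have hN : ∀ t : ℝ, t < (⌊t / h⌋₊ + 1 : ℕ) * h := fun t => by
    rw [← div_lt_iff₀ h0]
    exact_mod_cast Nat.lt_floor_add_one (t / h)
  refine ⟨fun t => Γ (⌊t / h⌋₊ + 1) t, by simp [hΓ0], fun t ht => ?_⟩
  have ht' : (0 : ℝ) ≤ t := ht
  set N := ⌊t / h⌋₊ + 1 with hNdef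
  have hd : HasDerivWithinAt (Γ N) (G (Γ N t)) (Ici 0) t :=
    (hΓ N t ⟨ht, (hN t).le⟩).mono_of_mem_nhdsWithin (by
      rw [← Ici_inter_Iic]
      exact inter_mem self_mem_nhdsWithin (mem_nhdsWithin_of_mem_nhds (Iic_mem_nhds (hN t))))
  refine hd.congr_of_eventuallyEq ?_ rfl
  filter_upwards [self_mem_nhdsWithin, mem_nhdsWithin_of_mem_nhds (Iio_mem_nhds (hN t))]
    with s hs0 hs
  exact hagree _ _ s hs0 (hN s).le (le_of_lt hs)

/-- The integral curves of a globally Lipschitz field separate at most exponentially. -/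
theorem LipschitzWith.dist_integralCurve_le {G : E → E} {K : NNReal} (hG : LipschitzWith K G)
    {f g : ℝ → E} {T : ℝ} (hf : IsIntegralCurveOn f (fun _ => G) (Icc 0 T))
    (hg : IsIntegralCurveOn g (fun _ => G) (Icc 0 T)) {t : ℝ} (ht : t ∈ Icc 0 T) :
    dist (f t) (g t) ≤ dist (f 0) (g 0) * Real.exp (K * t) := by
  simpa using dist_le_of_trajectories_ODE (v := fun _ => G) (fun _ => hG) hf.continuousOn
      (fun s hs => hf.hasDerivWithinAt_Ici hs) hg.continuousOn
      (fun s hs => hg.hasDerivWithinAt_Ici hs) le_rfl t ht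

/-- Continuous dependence on the initial point, along a compact piece of an integral curve of
a `C¹` vector field on an open set. -/
theorem IsIntegralCurveOn.exists_nearby [FiniteDimensional ℝ E] {G : E → E} {Ω : Set E}
    (hΩ : IsOpen Ω) (hG : ContDiffOn ℝ 1 G Ω) {γ : ℝ → E} {T : ℝ}
    (hγ : IsIntegralCurveOn γ (fun _ => G) (Icc 0 T)) (hγΩ : ∀ t ∈ Icc 0 T, γ t ∈ Ω)
    {ε : ℝ} (hε : 0 < ε) :
    ∃ δ > 0, ∀ x, dist x (γ 0) < δ → ∃ γ' : ℝ → E, γ' 0 = x ∧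
      IsIntegralCurveOn γ' (fun _ => G) (Icc 0 T) ∧
      ∀ t ∈ Icc 0 T, dist (γ' t) (γ t) < ε ∧ γ' t ∈ Ω := by
  have : ProperSpace E := FiniteDimensional.proper ℝ E
  have hKc : IsCompact (γ '' Icc 0 T) := isCompact_Icc.image_of_continuousOn hγ.continuousOn
  obtain ⟨ρ, hρ, hρΩ⟩ := hKc.exists_cthickening_subset_open hΩ (by
    rintro _ ⟨t, ht, rfl⟩
    exact hγΩ t ht)
  obtain ⟨C, hC⟩ := exists_lipschitzOnWith_of_contDiffOn hΩ hG (hKc.cthickening (r := ρ)) hρΩ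
  obtain ⟨G', hG', hGG'⟩ := hC.extend_finite_dimension
  set C' := lipschitzExtensionConstant E * C
  refine ⟨min ε ρ * Real.exp (-(C' * T)), by positivity, fun x hx => ?_⟩
  obtain ⟨γ', h0, hγ'⟩ := exists_isIntegralCurveOn_Ici_of_lipschitzWith hG' x
  have hγG' : IsIntegralCurveOn γ (fun _ => G') (Icc 0 T) := fun t ht => by
    have := hγ t ht
    have h1 : G (γ t) = G' (γ t) :=
      hGG' (Metric.self_subset_cthickening _ (mem_image_of_mem _ ht))
    simpa only [h1] using this
  have hγ'T := hγ'.mono (Icc_subset_Ici_self : Icc 0 T ⊆ Ici 0)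
  have hd : ∀ t ∈ Icc 0 T, dist (γ' t) (γ t) < min ε ρ := fun t ht => by
    refine (hG'.dist_integralCurve_le hγ'T hγG' ht).trans_lt ?_
    rw [h0]
    calc dist x (γ 0) * Real.exp (C' * t) < min ε ρ * Real.exp (-(C' * T)) * Real.exp (C' * t) :=
          mul_lt_mul_of_pos_right hx (Real.exp_pos _)
      _ = min ε ρ * Real.exp (C' * t - C' * T) := by
          rw [mul_assoc, ← Real.exp_add]; ring_nf
      _ ≤ min ε ρ * 1 := by
          gcongr
          rw [Real.exp_le_one_iff, sub_nonpos]
          exact mul_le_mul_of_nonneg_left ht.2 C'.coe_nonneg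
      _ = _ := mul_one _
  have hmem : ∀ t ∈ Icc 0 T, γ' t ∈ Metric.cthickening ρ (γ '' Icc 0 T) := fun t ht =>
    Metric.mem_cthickening_of_dist_le _ _ _ _ (mem_image_of_mem _ ht)
      ((hd t ht).le.trans (min_le_right _ _))
  refine ⟨γ', h0, fun t ht => ?_, fun t ht =>
    ⟨(hd t ht).trans_le (min_le_left _ _), hρΩ (hmem t ht)⟩⟩
  have := hγ'T t ht
  simpa only [hGG' (hmem t ht)] using this

/-- Integral curves of a `C¹` field exist for a short time in both directions. -/
theorem exists_isIntegralCurveOn_Ioo [CompleteSpace E] {G : E → E} {Ω : Set E} (hΩ : IsOpen Ω)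
    (hG : ContDiffOn ℝ 1 G Ω) {x : E} (hx : x ∈ Ω) (t₀ : ℝ) :
    ∃ (γ : ℝ → E) (ε : ℝ), 0 < ε ∧ γ t₀ = x ∧
      ∀ t ∈ Ioo (t₀ - ε) (t₀ + ε), γ t ∈ Ω ∧ HasDerivAt γ (G (γ t)) t := by
  obtain ⟨γ, h0, ε, hε, h⟩ :=
    (hG.contDiffAt (hΩ.mem_nhds hx)).exists_forall_mem_closedBall_exists_eq_forall_mem_Ioo_hasDerivAt₀
      t₀
  have hcont : ContinuousAt γ t₀ := (h t₀ ⟨by linarith, by linarith⟩).continuousAt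
  obtain ⟨δ, hδ, hδΩ⟩ := Metric.eventually_nhds_iff_ball.1
    (hcont.eventually (hΩ.mem_nhds (h0.symm ▸ hx)))
  refine ⟨γ, min ε δ, lt_min hε hδ, h0, fun t ht => ⟨hδΩ t ?_, h t ?_⟩⟩
  · rw [Real.ball_eq_Ioo]
    exact ⟨by linarith [ht.1, min_le_right ε δ], by linarith [ht.2, min_le_right ε δ]⟩
  · exact ⟨by linarith [ht.1, min_le_left ε δ], by linarith [ht.2, min_le_left ε δ]⟩

/-- A solution of the scalar linear equation `p' = c p` on an interval. -/
theorem eq_mul_exp_of_hasDerivWithinAt {p c : ℝ → ℝ} {a b : ℝ} (hc : ContinuousOn c (Icc a b))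
    (hp : ∀ t ∈ Icc a b, HasDerivWithinAt p (c t * p t) (Icc a b) t) {t : ℝ} (ht : t ∈ Icc a b) :
    p t = p a * Real.exp (∫ s in a..t, c s) := by
  have hab : a ≤ b := ht.1.trans ht.2
  set c' : ℝ → ℝ := IccExtend hab ((Icc a b).domRestrict c) with hc'
  have hc'c : Continuous c' := (continuousOn_iff_continuous_domRestrict.1 hc).Icc_extend'
  have hcc' : ∀ s ∈ Icc a b, c' s = c s := fun s hs => by
    rw [hc', IccExtend_of_mem _ _ hs]; rfl
  have hC : ∀ s, HasDerivAt (fun u => ∫ x in a..u, c' x) (c' s) s := fun s =>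
    intervalIntegral.integral_hasDerivAt_right (hc'c.intervalIntegrable _ _)
      hc'c.stronglyMeasurable.stronglyMeasurableAtFilter hc'c.continuousAt
  have hint : ∫ s in a..t, c s = ∫ s in a..t, c' s := by
    refine intervalIntegral.integral_congr fun s hs => ?_
    rw [uIcc_of_le ht.1] at hs
    exact (hcc' s ⟨hs.1, hs.2.trans ht.2⟩).symm
  have hg : ∀ s ∈ Icc a b, HasDerivWithinAt
      (fun u => p u * Real.exp (-∫ x in a..u, c' x)) 0 (Icc a b) s := fun s hs => by
    have := (hp s hs).fun_mul ((hC s).fun_neg.exp.hasDerivWithinAt (s := Icc a b))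
    refine this.congr_deriv ?_
    rw [hcc' s hs]
    ring
  have hconst := constant_of_has_deriv_right_zero (fun s hs => (hg s hs).continuousWithinAt)
    (fun s hs => (hg s (Ico_subset_Icc_self hs)).mono_of_mem_nhdsWithin
      (Icc_mem_nhdsGE_of_mem hs)) t ht
  simp only [intervalIntegral.integral_same, neg_zero, Real.exp_zero, mul_one] at hconst
  rw [hint, ← hconst, mul_assoc, ← Real.exp_add]
  simp

end ODE

/-! ### Hyperbolic fixed points of maps -/

section Discrete

variable {S U : Type*} [NormedAddCommGroup S] [NormedSpace ℝ S] [NormedAddCommGroup U]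
  [NormedSpace ℝ U]

/-- Irwin's form of the stable manifold theorem. The orbits of `(s, u) ↦ (B s, C u) + N (s, u)`
with a given first component `s₀` at time zero that stay bounded are the fixed points of a
contraction on the space of bounded sequences, which runs the first component forward and the
second one backward in time. -/
theorem exists_bounded_orbit [CompleteSpace S] [CompleteSpace U] (B : S →L[ℝ] S) (C : U ≃L[ℝ] U)
    (N : S × U → S × U) {a : ℝ} (ha0 : 0 < a) (ha1 : a < 1)
    (hB : ∀ s, ‖B s‖ ≤ (1 - a) * ‖s‖) (hC : ∀ u, (1 + a) * ‖u‖ ≤ ‖C u‖)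
    (hN : ∀ x y, ‖N x - N y‖ ≤ a / 2 * ‖x - y‖) (hN0 : N 0 = 0) (s₀ : S) :
    ∃ x : ℕ → S × U, (x 0).1 = s₀ ∧ (∀ k, x (k + 1) = (B (x k).1, C (x k).2) + N (x k)) ∧
      ∀ k, ‖x k‖ ≤ ‖s₀‖ := by
  have hCi : ∀ u, ‖C.symm u‖ ≤ (1 + a)⁻¹ * ‖u‖ := fun u => by
    have := hC (C.symm u)
    rw [C.apply_symm_apply] at this
    rw [inv_mul_eq_div, le_div_iff₀ (by linarith)]
    linarith
  have hN' : ∀ x, ‖N x‖ ≤ a / 2 * ‖x‖ := fun x => by simpa [hN0] using hN x 0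
  have hcst : (1 + a)⁻¹ * (1 + a / 2) ≤ 1 - a / 4 := by
    rw [inv_mul_eq_div, div_le_iff₀ (by linarith)]
    nlinarith
  -- the components of the contraction, and the two estimates it satisfies
  set T : (ℕ → S × U) → ℕ → S × U := fun x k =>
    (k.casesOn s₀ fun j => B (x j).1 + (N (x j)).1, C.symm ((x (k + 1)).2 - (N (x k)).2)) with hT
  have hest : ∀ (x y : ℕ → S × U) (M : ℝ), (∀ k, ‖x k - y k‖ ≤ M) →
      ∀ k, ‖T x k - T y k‖ ≤ (1 - a / 4) * M := by
    intro x y M hM k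
    have hM0 : 0 ≤ M := (norm_nonneg _).trans (hM 0)
    refine max_le ?_ ?_
    · cases k with
      | zero =>
        change ‖s₀ - s₀‖ ≤ _
        rw [sub_self, norm_zero]
        exact mul_nonneg (by linarith) hM0
      | succ j =>
        calc ‖(T x (j + 1) - T y (j + 1)).1‖
            = ‖B (x j - y j).1 + (N (x j) - N (y j)).1‖ := by
              simp only [hT, Prod.fst_sub, map_sub]; congr 1; abel
          _ ≤ (1 - a) * ‖(x j - y j).1‖ + ‖N (x j) - N (y j)‖ :=
              (norm_add_le _ _).trans (add_le_add (hB _) (norm_fst_le _))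
          _ ≤ (1 - a) * M + a / 2 * M := add_le_add
              (mul_le_mul_of_nonneg_left ((norm_fst_le _).trans (hM j)) (by linarith))
              ((hN _ _).trans (mul_le_mul_of_nonneg_left (hM j) (by linarith)))
          _ ≤ (1 - a / 4) * M := by nlinarith
    · calc ‖(T x k - T y k).2‖
          = ‖C.symm ((x (k + 1) - y (k + 1)).2 - (N (x k) - N (y k)).2)‖ := by
            simp only [hT, Prod.snd_sub, map_sub]; congr 1; abel
        _ ≤ (1 + a)⁻¹ * (M + a / 2 * M) := by
            refine (hCi _).trans ?_
            gcongr
            refine (norm_sub_le _ _).trans (add_le_add ((norm_snd_le _).trans (hM _)) ?_)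
            exact (norm_snd_le _).trans
              ((hN _ _).trans (mul_le_mul_of_nonneg_left (hM k) (by linarith)))
        _ = (1 + a)⁻¹ * (1 + a / 2) * M := by ring
        _ ≤ (1 - a / 4) * M := mul_le_mul_of_nonneg_right hcst hM0
  have hT0 : ∀ k, ‖T 0 k‖ ≤ ‖s₀‖ := by
    intro k
    refine max_le ?_ ?_
    · cases k with
      | zero => simp [hT]
      | succ j => simp [hT, hN0]
    · simp [hT, hN0]
  have hbd : ∀ (x : ℕ → S × U) (M : ℝ), (∀ k, ‖x k‖ ≤ M) →
      ∀ k, ‖T x k‖ ≤ (1 - a / 4) * M + ‖s₀‖ := fun x M hM k => by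
    have h1 := hest x 0 M (by simpa using hM) k
    have h2 : ‖T x k‖ ≤ ‖T x k - T 0 k‖ + ‖T 0 k‖ := by
      simpa using norm_add_le (T x k - T 0 k) (T 0 k)
    linarith [hT0 k]
  let F : BoundedContinuousFunction ℕ (S × U) → BoundedContinuousFunction ℕ (S × U) := fun x =>
    BoundedContinuousFunction.ofNormedAddCommGroupDiscrete (T x) _ (hbd x ‖x‖ x.norm_coe_le_norm)
  have hF : ContractingWith (1 - a / 4).toNNReal F := by
    refine ⟨by rw [Real.toNNReal_lt_one]; linarith, ?_⟩
    refine LipschitzWith.of_dist_le_mul fun x y => ?_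
    rw [dist_eq_norm, dist_eq_norm, BoundedContinuousFunction.norm_le (by
      exact mul_nonneg (NNReal.coe_nonneg _) (norm_nonneg _))]
    rw [Real.coe_toNNReal _ (by linarith)]
    exact hest x y _ fun k => (x - y).norm_coe_le_norm k
  set x := hF.fixedPoint F with hx
  have hfix : ∀ k, T x k = x k := fun k => by
    have := hF.fixedPoint_isFixedPt
    exact DFunLike.congr_fun this k
  refine ⟨x, ?_, fun k => ?_, fun k => ?_⟩
  · rw [← hfix 0]
    rfl
  · refine Prod.ext ?_ ?_
    · rw [← hfix (k + 1)]; rfl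
    · have h2 : C.symm ((x (k + 1)).2 - (N (x k)).2) = (x k).2 := congrArg Prod.snd (hfix k)
      have h3 : (x (k + 1)).2 - (N (x k)).2 = C (x k).2 := by rw [← h2, C.apply_symm_apply]
      simp only [Prod.snd_add, ← h3, sub_add_cancel]
  · -- `T` contracts except for the constant entry `s₀`, which therefore bounds the fixed point
    have h1 : ‖x‖ ≤ max ‖s₀‖ ((1 - a / 4) * ‖x‖) := by
      rw [BoundedContinuousFunction.norm_le (by positivity)]
      intro k
      rw [← hfix k]
      have hk := hest x 0 ‖x‖ (by simpa using x.norm_coe_le_norm) k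
      refine max_le ?_ ?_
      · cases k with
        | zero => exact le_max_left _ _
        | succ j =>
          refine le_max_of_le_right (le_trans ?_ hk)
          refine le_trans (le_of_eq ?_) (norm_fst_le _)
          simp [hT, hN0]
      · refine le_max_of_le_right (le_trans ?_ hk)
        refine le_trans (le_of_eq ?_) (norm_snd_le _)
        simp [hT, hN0]
    have h2 : ‖x‖ ≤ ‖s₀‖ := by
      rcases le_max_iff.1 h1 with h | h
      · exact h
      · nlinarith [norm_nonneg x, norm_nonneg s₀]
    exact (x.norm_coe_le_norm k).trans h2

/-- Cone condition: if the difference of two orbits stays bounded, then it stays in the cone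
`‖u‖ ≤ κ ‖s‖`, in which it decays geometrically. -/
theorem cone_of_bounded_orbits (B : S →L[ℝ] S) (C : U →L[ℝ] U)
    (N : S × U → S × U) {a κ : ℝ} (ha0 : 0 < a) (ha1 : a < 1) (hκ0 : 0 < κ) (hκ1 : κ ≤ 1)
    (hB : ∀ s, ‖B s‖ ≤ (1 - a) * ‖s‖) (hC : ∀ u, (1 + a) * ‖u‖ ≤ ‖C u‖)
    (hN : ∀ x y, ‖N x - N y‖ ≤ κ * (a / 2) * ‖x - y‖) {x y : ℕ → S × U}
    (hx : ∀ k, x (k + 1) = (B (x k).1, C (x k).2) + N (x k))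
    (hy : ∀ k, y (k + 1) = (B (y k).1, C (y k).2) + N (y k))
    (hbd : ∃ M, ∀ k, ‖x k - y k‖ ≤ M) :
    (∀ k, ‖(x k - y k).2‖ ≤ κ * ‖(x k - y k).1‖) ∧
      ∀ k, ‖x k - y k‖ ≤ (1 - a / 2) ^ k * ‖x 0 - y 0‖ := by
  obtain ⟨M, hM⟩ := hbd
  have hs : ∀ k, ‖(x (k + 1) - y (k + 1)).1‖
      ≤ (1 - a) * ‖(x k - y k).1‖ + κ * (a / 2) * ‖x k - y k‖ := fun k => by
    calc ‖(x (k + 1) - y (k + 1)).1‖ = ‖B (x k - y k).1 + (N (x k) - N (y k)).1‖ := by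
          rw [hx, hy]; simp only [Prod.fst_sub, Prod.fst_add, map_sub]; congr 1; abel
      _ ≤ _ := (norm_add_le _ _).trans (add_le_add (hB _) ((norm_fst_le _).trans (hN _ _)))
  have hu : ∀ k, (1 + a) * ‖(x k - y k).2‖ - κ * (a / 2) * ‖x k - y k‖
      ≤ ‖(x (k + 1) - y (k + 1)).2‖ := fun k => by
    have h1 : (x (k + 1) - y (k + 1)).2 = C (x k - y k).2 + (N (x k) - N (y k)).2 := by
      rw [hx, hy]; simp only [Prod.snd_sub, Prod.snd_add, map_sub]; abel
    have h2 : ‖(N (x k) - N (y k)).2‖ ≤ κ * (a / 2) * ‖x k - y k‖ :=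
      (norm_snd_le _).trans (hN _ _)
    have h3 := norm_sub_le_norm_add (C (x k - y k).2) (N (x k) - N (y k)).2
    rw [h1]
    linarith [hC (x k - y k).2]
  -- outside of the cone, the second component would grow geometrically
  have hcone : ∀ k, ‖(x k - y k).2‖ ≤ κ * ‖(x k - y k).1‖ := by
    by_contra! hcon
    obtain ⟨k, hk⟩ := hcon
    have hgrow : ∀ j, κ * ‖(x (k + j) - y (k + j)).1‖ < ‖(x (k + j) - y (k + j)).2‖ ∧
        (1 + a / 2) ^ j * ‖(x k - y k).2‖ ≤ ‖(x (k + j) - y (k + j)).2‖ := by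
      intro j
      induction j with
      | zero => simpa using hk
      | succ j ih =>
        obtain ⟨h1, h2⟩ := ih
        have hn : κ * ‖x (k + j) - y (k + j)‖ ≤ ‖(x (k + j) - y (k + j)).2‖ := by
          rw [Prod.norm_def, mul_max_of_nonneg _ _ hκ0.le]
          exact max_le h1.le (mul_le_of_le_one_left (norm_nonneg _) hκ1)
        have hu' := hu (k + j)
        have hs' := hs (k + j)
        rw [add_assoc] at hu' hs'
        have h3 : κ * (a / 2) * ‖x (k + j) - y (k + j)‖
            ≤ a / 2 * ‖(x (k + j) - y (k + j)).2‖ := by nlinarith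
        have h4 : (1 + a / 2) * ‖(x (k + j) - y (k + j)).2‖
            ≤ ‖(x (k + (j + 1)) - y (k + (j + 1))).2‖ := by linarith
        constructor
        · have h5 : 0 < ‖(x (k + j) - y (k + j)).2‖ :=
            (mul_nonneg hκ0.le (norm_nonneg _)).trans_lt h1
          have h6 : κ * ‖(x (k + (j + 1)) - y (k + (j + 1))).1‖
              ≤ (1 - a / 2) * ‖(x (k + j) - y (k + j)).2‖ := by
            nlinarith [mul_le_mul_of_nonneg_left hs' hκ0.le,
              mul_le_mul_of_nonneg_left h1.le (sub_nonneg.2 ha1.le),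
              mul_nonneg ha0.le h5.le, mul_le_mul_of_nonneg_left h3 hκ0.le,
              mul_le_mul_of_nonneg_right hκ1 (mul_nonneg ha0.le h5.le)]
          nlinarith
        · rw [pow_succ]
          nlinarith [mul_le_mul_of_nonneg_left h2 (by linarith : (0 : ℝ) ≤ 1 + a / 2)]
    have hpos : 0 < ‖(x k - y k).2‖ := (mul_nonneg hκ0.le (norm_nonneg _)).trans_lt hk
    obtain ⟨j, hj⟩ := pow_unbounded_of_one_lt (M / ‖(x k - y k).2‖)
      (by linarith : (1 : ℝ) < 1 + a / 2)
    rw [div_lt_iff₀ hpos] at hj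
    exact absurd ((norm_snd_le _).trans (hM (k + j))) (by linarith [(hgrow j).2])
  refine ⟨hcone, fun k => ?_⟩
  have hn : ∀ k, ‖x k - y k‖ = ‖(x k - y k).1‖ := fun k => by
    rw [Prod.norm_def, max_eq_left]
    exact (hcone k).trans (mul_le_of_le_one_left (norm_nonneg _) hκ1)
  induction k with
  | zero => simp
  | succ k ih =>
    have h1 := hs k
    rw [← hn, ← hn] at h1
    have h2 : ‖x (k + 1) - y (k + 1)‖ ≤ (1 - a / 2) * ‖x k - y k‖ := by
      nlinarith [mul_le_mul_of_nonneg_right hκ1 (mul_nonneg ha0.le (norm_nonneg (x k - y k)))]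
    rw [pow_succ]
    nlinarith [mul_le_mul_of_nonneg_left ih (by linarith : (0 : ℝ) ≤ 1 - a / 2)]

end Discrete

/-! ### The local stable manifold of a hyperbolic fixed point of a flow -/

/-- `A` contracts infinitesimally at rate `α` in the given norm: its Euler steps `1 + h A` do, for
small `h > 0`. -/
def IsContracting {S : Type*} [NormedAddCommGroup S] [NormedSpace ℝ S] (α : ℝ) (A : S →L[ℝ] S) :
    Prop :=
  ∀ᶠ h in 𝓝[>] (0 : ℝ), ∀ s, ‖s + h • A s‖ ≤ (1 - α * h) * ‖s‖

/-- `A` expands infinitesimally at rate `α` in the given norm: its Euler steps `1 + h A` do, for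
small `h > 0`. -/
def IsExpanding {U : Type*} [NormedAddCommGroup U] [NormedSpace ℝ U] (α : ℝ) (A : U →L[ℝ] U) :
    Prop :=
  ∀ᶠ h in 𝓝[>] (0 : ℝ), ∀ u, (1 + α * h) * ‖u‖ ≤ ‖u + h • A u‖

section Continuous

/-- The first order expansion in time of the difference of two integral curves of a vector field
that is globally Lipschitz close to the linear field `A`. -/
theorem eventually_norm_sub_integralCurve_le {E : Type*} [NormedAddCommGroup E] [NormedSpace ℝ E]
    {G : E → E} {K : NNReal} (hG : LipschitzWith K G) (A : E →L[ℝ] E) {η : ℝ} (hη : 0 < η)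
    (hN : ∀ x y, ‖(G x - A x) - (G y - A y)‖ ≤ η * ‖x - y‖) :
    ∀ᶠ h in 𝓝[>] (0 : ℝ), Real.exp (K * h) ≤ 2 ∧ ∀ f g : ℝ → E,
      IsIntegralCurveOn f (fun _ => G) (Icc 0 h) → IsIntegralCurveOn g (fun _ => G) (Icc 0 h) →
      ‖(f h - g h) - (f 0 - g 0) - h • A (f 0 - g 0)‖ ≤ 3 * η * h * ‖f 0 - g 0‖ := by
  have h1 : ∀ᶠ h in 𝓝[>] (0 : ℝ), Real.exp (K * h) < 2 := by
    have : Tendsto (fun h : ℝ => Real.exp (K * h)) (𝓝 0) (𝓝 1) :=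
      Continuous.tendsto' (by fun_prop) _ _ (by simp)
    exact (this.mono_left nhdsWithin_le_nhds).eventually (gt_mem_nhds (by norm_num))
  have h2 : ∀ᶠ h in 𝓝[>] (0 : ℝ), ‖A‖ * (2 * K * h) < η := by
    have : Tendsto (fun h : ℝ => ‖A‖ * (2 * K * h)) (𝓝 0) (𝓝 0) :=
      Continuous.tendsto' (by fun_prop) _ _ (by simp)
    exact (this.mono_left nhdsWithin_le_nhds).eventually (gt_mem_nhds hη)
  filter_upwards [h1, h2, self_mem_nhdsWithin] with h h1 h2 hpos
  have hpos : 0 < h := hpos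
  refine ⟨h1.le, fun f g hf hg => ?_⟩
  set D := ‖f 0 - g 0‖ with hD
  have hfg : ∀ t ∈ Icc 0 h, ‖f t - g t‖ ≤ 2 * D := fun t ht => by
    have h3 := hG.dist_integralCurve_le hf hg ht
    rw [dist_eq_norm, dist_eq_norm] at h3
    have h4 : Real.exp (K * t) ≤ 2 := le_trans (Real.exp_le_exp.2
      (mul_le_mul_of_nonneg_left ht.2 K.coe_nonneg)) h1.le
    nlinarith [norm_nonneg (f 0 - g 0)]
  have hd : ∀ t ∈ Icc 0 h, HasDerivWithinAt (fun t => f t - g t) (G (f t) - G (g t)) (Icc 0 h) t :=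
    fun t ht => (hf t ht).fun_sub (hg t ht)
  have hfg0 : ∀ t ∈ Icc 0 h, ‖f t - g t - (f 0 - g 0)‖ ≤ 2 * K * h * D := fun t ht => by
    have := norm_image_sub_le_of_norm_deriv_le_segment' hd (C := K * (2 * D)) (fun s hs =>
      (hG.norm_sub_le _ _).trans (mul_le_mul_of_nonneg_left (hfg s (Ico_subset_Icc_self hs))
        K.coe_nonneg)) t ht
    refine this.trans ?_
    have : 0 ≤ K * (2 * D) := by positivity
    nlinarith [ht.2]
  have hd2 : ∀ t ∈ Icc 0 h, HasDerivWithinAt (fun t => f t - g t - t • A (f 0 - g 0))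
      (G (f t) - G (g t) - A (f 0 - g 0)) (Icc 0 h) t := fun t ht => by
    have := (hd t ht).fun_sub ((hasDerivWithinAt_id t (Icc 0 h)).smul_const (A (f 0 - g 0)))
    simpa using! this
  have := norm_image_sub_le_of_norm_deriv_le_segment' hd2 (C := 3 * η * D) (fun s hs => by
    have hs' := Ico_subset_Icc_self hs
    have e : G (f s) - G (g s) - A (f 0 - g 0) = ((G (f s) - A (f s)) - (G (g s) - A (g s)))
        + A (f s - g s - (f 0 - g 0)) := by
      simp only [map_sub]; abel
    rw [e]
    refine (norm_add_le _ _).trans ?_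
    have h5 := (hN (f s) (g s)).trans (mul_le_mul_of_nonneg_left (hfg s hs') hη.le)
    have h6 := (A.le_opNorm _).trans (mul_le_mul_of_nonneg_left (hfg0 s hs') (norm_nonneg A))
    have h7 : ‖A‖ * (2 * K * h) * D ≤ η * D := mul_le_mul_of_nonneg_right h2.le (norm_nonneg _)
    linarith) h (right_mem_Icc.2 hpos.le)
  simp only [zero_smul, sub_zero] at this
  refine le_trans (le_of_eq ?_) (this.trans (le_of_eq (by ring)))
  congr 1
  abel

variable {S U : Type*} [NormedAddCommGroup S] [NormedSpace ℝ S] [NormedAddCommGroup U]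
  [NormedSpace ℝ U] [FiniteDimensional ℝ S] [FiniteDimensional ℝ U]

/-- Near a hyperbolic fixed point a vector field agrees with a globally Lipschitz one whose
time-`h` map, for some small `h`, is Lipschitz close to a hyperbolic linear map. -/
theorem exists_timeMap {As : S →L[ℝ] S} {Au : U →L[ℝ] U} {α : ℝ} (hα : 0 < α)
    (hAs : IsContracting α As) (hAu : IsExpanding α Au) {G₀ : S × U → S × U}
    (hG₀ : HasStrictFDerivAt G₀ (As.prodMap Au) 0) (h0 : G₀ 0 = 0) {κ : ℝ} (hκ : 0 < κ) :
    ∃ (δ : ℝ) (G : S × U → S × U) (K : NNReal) (h a : ℝ) (B : S →L[ℝ] S) (C : U ≃L[ℝ] U)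
      (N : S × U → S × U), 0 < δ ∧ 0 < h ∧ 0 < a ∧ a < 1 ∧ LipschitzWith K G ∧
      EqOn G G₀ (Metric.closedBall 0 δ) ∧ Real.exp (K * h) ≤ 2 ∧
      (∀ s, ‖B s‖ ≤ (1 - a) * ‖s‖) ∧ (∀ u, (1 + a) * ‖u‖ ≤ ‖C u‖) ∧
      (∀ x y, ‖N x - N y‖ ≤ κ * (a / 2) * ‖x - y‖) ∧ N 0 = 0 ∧
      ∀ f, IsIntegralCurveOn f (fun _ => G) (Icc 0 h) →
        f h = (B (f 0).1, C (f 0).2) + N (f 0) := by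
  set A := As.prodMap Au with hA
  set L := lipschitzExtensionConstant (S × U) with hL
  have hLpos : 0 < L := lipschitzExtensionConstant_pos _
  set η : ℝ := κ * α / 6 with hη
  have hηpos : 0 < η := by positivity
  -- the non-linear part is Lipschitz small near the fixed point; it is extended globally
  obtain ⟨s, hs, happ⟩ := hG₀.approximates_deriv_on_nhds
    (c := L⁻¹ * η.toNNReal) (.inr (mul_pos (inv_pos.2 hLpos) (Real.toNNReal_pos.2 hηpos)))
  obtain ⟨δ, hδ, hδs⟩ := Metric.nhds_basis_closedBall.mem_iff.1 hs
  have hlip : LipschitzOnWith (L⁻¹ * η.toNNReal) (fun x => G₀ x - A x)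
      (Metric.closedBall 0 δ) := (happ.mono_set hδs).lipschitzOnWith
  obtain ⟨N₁, hN₁, hN₁eq⟩ := hlip.extend_finite_dimension
  rw [← hL, ← mul_assoc, mul_inv_cancel₀ hLpos.ne', one_mul] at hN₁
  set G : S × U → S × U := fun x => A x + N₁ x with hG
  have hGlip : LipschitzWith (‖A‖₊ + η.toNNReal) G := A.lipschitz.add hN₁
  have hGeq : EqOn G G₀ (Metric.closedBall 0 δ) := fun x hx => by
    simp only [hG, ← hN₁eq hx]; abel
  have hNG : ∀ x y, ‖(G x - A x) - (G y - A y)‖ ≤ η * ‖x - y‖ := fun x y => by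
    simpa [hG, hηpos.le] using hN₁.norm_sub_le x y
  have hG0 : G 0 = 0 := by rw [hGeq (Metric.mem_closedBall_self hδ.le), h0]
  have hα1 : ∀ᶠ h in 𝓝[>] (0 : ℝ), α * h < 1 := by
    have : Tendsto (fun h : ℝ => α * h) (𝓝 0) (𝓝 0) :=
      Continuous.tendsto' (by fun_prop) _ _ (by simp)
    exact (this.mono_left nhdsWithin_le_nhds).eventually (gt_mem_nhds one_pos)
  obtain ⟨h, hcon, hexp, ⟨hexp2, htime⟩, hα1, hpos⟩ := (hAs.and (hAu.and
    ((eventually_norm_sub_integralCurve_le hGlip A hηpos hNG).and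
      (hα1.and self_mem_nhdsWithin)))).exists
  have hpos : 0 < h := hpos
  -- `Fl x h` is the time-`h` map; its linear part is taken to be the Euler step `1 + h A`
  choose Fl hFl0 hFl using exists_isIntegralCurveOn_Ici_of_lipschitzWith hGlip
  have hFlh : ∀ x, IsIntegralCurveOn (Fl x) (fun _ => G) (Icc 0 h) := fun x =>
    (hFl x).mono Icc_subset_Ici_self
  have huniq : ∀ f, IsIntegralCurveOn f (fun _ => G) (Icc 0 h) → f h = Fl (f 0) h := fun f hf => by
    have := hGlip.dist_integralCurve_le hf (hFlh (f 0)) (right_mem_Icc.2 hpos.le)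
    rw [hFl0, dist_self, zero_mul] at this
    exact dist_le_zero.1 this
  have hconst : IsIntegralCurveOn (fun _ : ℝ => (0 : S × U)) (fun _ => G) (Icc 0 h) :=
    fun t _ => by simpa [hG0] using! hasDerivWithinAt_const t (Icc 0 h) (0 : S × U)
  set C₀ : U →ₗ[ℝ] U := LinearMap.id + h • Au.toLinearMap with hC₀
  have hC₀a : ∀ u, C₀ u = u + h • Au u := fun u => rfl
  have hinj : Function.Injective C₀ := by
    rw [injective_iff_map_eq_zero]
    intro u hu
    have := hexp u
    rw [← hC₀a, hu, norm_zero] at this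
    have hp : 0 < 1 + α * h := by positivity
    exact norm_le_zero_iff.1 (by nlinarith [norm_nonneg u])
  set C : U ≃L[ℝ] U := (LinearEquiv.ofInjectiveEndo C₀ hinj).toContinuousLinearEquiv with hC
  have hCa : ∀ u, C u = u + h • Au u := fun u => rfl
  set B : S →L[ℝ] S := ContinuousLinearMap.id ℝ S + h • As with hB
  have hBa : ∀ u, B u = u + h • As u := fun u => rfl
  have hBC : ∀ x : S × U, (B x.1, C x.2) = x + h • A x := fun x => by
    rw [hBa, hCa]; rfl
  refine ⟨δ, G, _, h, α * h, B, C, fun x => Fl x h - (B x.1, C x.2), hδ, hpos, by positivity, hα1,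
    hGlip, hGeq, hexp2, hcon, hexp, fun x y => ?_, ?_, fun f hf => ?_⟩
  · have := htime (Fl x) (Fl y) (hFlh x) (hFlh y)
    rw [hFl0, hFl0] at this
    simp only [hBC]
    refine le_trans (le_of_eq ?_) (this.trans (le_of_eq ?_))
    · congr 1
      simp only [map_sub, smul_sub]
      abel
    · rw [hη]; ring
  · have : (0 : S × U) = Fl 0 h := huniq _ hconst
    simp only [hBC, ← this, map_zero, smul_zero, add_zero, sub_zero]
  · rw [huniq f hf]
    exact (add_sub_cancel _ _).symm

/-- Local stable manifold theorem, existence: over each small `s₀` there starts an integral curve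
that converges to the hyperbolic fixed point. -/
theorem exists_integralCurve_tendsto {As : S →L[ℝ] S} {Au : U →L[ℝ] U} {α : ℝ} (hα : 0 < α)
    (hAs : IsContracting α As) (hAu : IsExpanding α Au) {G₀ : S × U → S × U}
    (hG₀ : HasStrictFDerivAt G₀ (As.prodMap Au) 0) (h0 : G₀ 0 = 0) :
    ∃ ε > 0, ∀ s₀ : S, ‖s₀‖ < ε → ∃ γ : ℝ → S × U, (γ 0).1 = s₀ ∧
      IsIntegralCurveOn γ (fun _ => G₀) (Ici 0) ∧ (∀ t ∈ Ici (0 : ℝ), ‖γ t‖ ≤ 2 * ‖s₀‖) ∧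
      Tendsto γ atTop (𝓝 0) := by
  obtain ⟨δ, G, K, h, a, B, C, N, hδ, hpos, ha0, ha1, hG, hGG₀, hexp, hB, hC, hN, hN0, hflow⟩ :=
    exists_timeMap hα hAs hAu hG₀ h0 one_pos
  refine ⟨δ / 2, by positivity, fun s₀ hs₀ => ?_⟩
  have : CompleteSpace S := FiniteDimensional.complete ℝ S
  have : CompleteSpace U := FiniteDimensional.complete ℝ U
  obtain ⟨x, hx0, hx, hxb⟩ := exists_bounded_orbit B C N ha0 ha1 hB hC
    (by simpa only [one_mul] using hN) hN0 s₀
  have hdec : ∀ k, ‖x k‖ ≤ (1 - a / 2) ^ k * ‖x 0‖ := fun k => by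
    have := (cone_of_bounded_orbits B C.toContinuousLinearMap N ha0 ha1 one_pos le_rfl hB hC hN
      (x := x) (y := fun _ => 0) hx
      (fun k => by simp [hN0, Prod.ext_iff]) ⟨‖s₀‖, by simpa using hxb⟩).2 k
    simpa using this
  obtain ⟨γ, hγ0, hγ⟩ := exists_isIntegralCurveOn_Ici_of_lipschitzWith hG (x 0)
  -- the bounded orbit of the time-`h` map is sampled from an integral curve, which stays comparable
  -- to it between the sampling times
  have hshift : ∀ k : ℕ, IsIntegralCurveOn (fun t => γ (t + k * h)) (fun _ => G) (Icc 0 h) :=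
    fun k => hγ.comp_add_const _ fun t ht => by
      have : (0 : ℝ) ≤ k * h := by positivity
      exact add_nonneg ht.1 this
  have hγx : ∀ k : ℕ, γ (k * h) = x k := by
    intro k
    induction k with
    | zero => simp [hγ0]
    | succ k ih =>
      have := hflow _ (hshift k)
      simp only [zero_add, ih] at this
      rw [hx, ← this]
      congr 1
      push_cast
      ring
  have hconst : IsIntegralCurveOn (fun _ : ℝ => (0 : S × U)) (fun _ => G) (Icc 0 h) :=
    fun t _ => by
      have : G 0 = 0 := by rw [hGG₀ (Metric.mem_closedBall_self hδ.le), h0]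
      simpa [this] using! hasDerivWithinAt_const t (Icc 0 h) (0 : S × U)
  have hbd : ∀ t : ℝ, 0 ≤ t → ‖γ t‖ ≤ 2 * ‖x ⌊t / h⌋₊‖ := fun t ht => by
    set k := ⌊t / h⌋₊ with hk
    have h1 : k * h ≤ t := by
      rw [← le_div_iff₀ hpos]; exact Nat.floor_le (by positivity)
    have h2 : t < (k + 1) * h := by
      rw [← div_lt_iff₀ hpos]; exact Nat.lt_floor_add_one _
    have h3 : t - k * h ∈ Icc 0 h := ⟨by linarith, by linarith⟩
    have := hG.dist_integralCurve_le (hshift k) hconst h3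
    simp only [sub_add_cancel, zero_add, dist_zero_right, hγx] at this
    have h4 : Real.exp (K * (t - k * h)) ≤ 2 := le_trans (Real.exp_le_exp.2
      (mul_le_mul_of_nonneg_left h3.2 K.coe_nonneg)) hexp
    nlinarith [norm_nonneg (x k)]
  have hball : ∀ t ∈ Ici (0 : ℝ), ‖γ t‖ ≤ 2 * ‖s₀‖ := fun t ht =>
    (hbd t ht).trans (by linarith [hxb ⌊t / h⌋₊])
  refine ⟨γ, by rw [hγ0, hx0], fun t ht => ?_, hball, ?_⟩
  · have h1 := hγ t ht
    have h2 : G (γ t) = G₀ (γ t) := hGG₀ (by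
      rw [mem_closedBall_zero_iff]
      linarith [hball t ht])
    simpa only [h2] using h1
  · refine squeeze_zero_norm' (a := fun t => 2 * ((1 - a / 2) ^ ⌊t / h⌋₊ * ‖x 0‖)) ?_ ?_
    · filter_upwards [eventually_ge_atTop 0] with t ht
      exact (hbd t ht).trans (mul_le_mul_of_nonneg_left (hdec _) zero_le_two)
    · have h1 : Tendsto (fun n : ℕ => (1 - a / 2) ^ n) atTop (𝓝 0) :=
        tendsto_pow_atTop_nhds_zero_of_lt_one (by linarith) (by linarith)
      have h2 : Tendsto (fun t : ℝ => ⌊t / h⌋₊) atTop atTop :=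
        tendsto_nat_floor_atTop.comp (tendsto_id.atTop_div_const hpos)
      simpa using ((h1.comp h2).mul_const ‖x 0‖).const_mul 2

/-- Local stable manifold theorem, cone condition: the integral curves that stay close to
the hyperbolic fixed point start on a graph over `S`, with small slope. -/
theorem exists_cone_of_integralCurve {As : S →L[ℝ] S} {Au : U →L[ℝ] U} {α : ℝ} (hα : 0 < α)
    (hAs : IsContracting α As) (hAu : IsExpanding α Au) {G₀ : S × U → S × U}
    (hG₀ : HasStrictFDerivAt G₀ (As.prodMap Au) 0) (h0 : G₀ 0 = 0) {κ : ℝ} (hκ0 : 0 < κ)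
    (hκ1 : κ ≤ 1) :
    ∃ δ > 0, ∀ γ γ' : ℝ → S × U, IsIntegralCurveOn γ (fun _ => G₀) (Ici 0) →
      IsIntegralCurveOn γ' (fun _ => G₀) (Ici 0) → (∀ t ∈ Ici (0 : ℝ), ‖γ t‖ ≤ δ) →
      (∀ t ∈ Ici (0 : ℝ), ‖γ' t‖ ≤ δ) → ‖(γ 0 - γ' 0).2‖ ≤ κ * ‖(γ 0 - γ' 0).1‖ := by
  obtain ⟨δ, G, K, h, a, B, C, N, hδ, hpos, ha0, ha1, hG, hGG₀, hexp, hB, hC, hN, hN0, hflow⟩ :=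
    exists_timeMap hα hAs hAu hG₀ h0 hκ0
  refine ⟨δ, hδ, fun γ γ' hγ hγ' hb hb' => ?_⟩
  have key : ∀ γ : ℝ → S × U, IsIntegralCurveOn γ (fun _ => G₀) (Ici 0) →
      (∀ t ∈ Ici (0 : ℝ), ‖γ t‖ ≤ δ) → ∀ k : ℕ, γ ((k + 1 : ℕ) * h)
        = (B (γ (k * h)).1, C (γ (k * h)).2) + N (γ (k * h)) := by
    intro γ hγ hb k
    have h1 : IsIntegralCurveOn γ (fun _ => G) (Ici 0) := fun t ht => by
      have h2 : G (γ t) = G₀ (γ t) := hGG₀ (by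
        rw [mem_closedBall_zero_iff]
        exact hb t ht)
      simpa only [h2] using hγ t ht
    have h3 := hflow _ (h1.comp_add_const (J := Icc 0 h) (k * h) fun t ht => by
      have : (0 : ℝ) ≤ k * h := by positivity
      exact add_nonneg ht.1 this)
    simp only [zero_add] at h3
    rw [← h3]
    congr 1
    push_cast
    ring
  have := (cone_of_bounded_orbits B C.toContinuousLinearMap N ha0 ha1 hκ0 hκ1 hB hC hN
    (x := fun k => γ (k * h)) (y := fun k => γ' (k * h)) (key γ hγ hb) (key γ' hγ' hb')
    ⟨δ + δ, fun k => (norm_sub_le _ _).trans (add_le_add (hb _ ?_) (hb' _ ?_))⟩).1 0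
  · simpa using this
  all_goals exact (by positivity : (0 : ℝ) ≤ k * h)

end Continuous

/-! ### Division by powers of the radius -/

section Radial

/-- An integral over `[0, 1]` of a continuously differentiable family is continuous. -/
theorem continuousOn_intervalIntegral {V W : Type*} [NormedAddCommGroup V] [NormedSpace ℝ V]
    [FiniteDimensional ℝ V] [NormedAddCommGroup W] [NormedSpace ℝ W] {Ω : Set V} (hΩ : IsOpen Ω)
    {H : V → ℝ → W} (hH : ContinuousOn (Function.uncurry H) (Ω ×ˢ Icc (0 : ℝ) 1)) :
    ContinuousOn (fun z => ∫ t in (0 : ℝ)..1, H z t) Ω := by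
  have : ProperSpace V := FiniteDimensional.proper ℝ V
  intro z hz
  obtain ⟨ρ, hρ, hρΩ⟩ := Metric.nhds_basis_closedBall.mem_iff.1 (hΩ.mem_nhds hz)
  obtain ⟨C, hC⟩ := ((isCompact_closedBall z ρ).prod isCompact_Icc).exists_bound_of_continuousOn
    (hH.mono (prod_mono_left hρΩ))
  have hI : Set.uIoc (0 : ℝ) 1 ⊆ Icc 0 1 := by
    rw [uIoc_of_le zero_le_one]; exact Ioc_subset_Icc_self
  refine (intervalIntegral.continuousAt_of_dominated_interval (bound := fun _ => C) ?_ ?_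
    intervalIntegrable_const ?_).continuousWithinAt
  · filter_upwards [hΩ.mem_nhds hz] with x hx
    have h1 : ContinuousOn (H x) (Icc (0 : ℝ) 1) :=
      hH.comp (f := fun t => (x, t)) (by fun_prop) fun t ht => ⟨hx, ht⟩
    exact (h1.aestronglyMeasurable measurableSet_Icc).mono_measure
      (MeasureTheory.Measure.restrict_mono hI le_rfl)
  · filter_upwards [Metric.closedBall_mem_nhds z hρ] with x hx
    exact .of_forall fun t ht => hC (x, t) ⟨hx, hI ht⟩
  · refine .of_forall fun t ht => ?_
    have h1 : ContinuousOn (fun x => H x t) Ω :=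
      hH.comp (f := fun x => (x, t)) (by fun_prop) fun x hx => ⟨hx, hI ht⟩
    exact h1.continuousAt (hΩ.mem_nhds hz)

/-- Differentiation under the integral sign over `[0, 1]`. -/
theorem contDiffOn_intervalIntegral {V W : Type*} [NormedAddCommGroup V] [NormedSpace ℝ V]
    [FiniteDimensional ℝ V] [NormedAddCommGroup W] [NormedSpace ℝ W] {Ω : Set V} (hΩ : IsOpen Ω)
    {H : V → ℝ → W} {H' : V → ℝ → V →L[ℝ] W}
    (hH : ContinuousOn (Function.uncurry H) (Ω ×ˢ Icc (0 : ℝ) 1))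
    (hH' : ContinuousOn (Function.uncurry H') (Ω ×ˢ Icc (0 : ℝ) 1))
    (hd : ∀ z ∈ Ω, ∀ t ∈ Icc (0 : ℝ) 1, HasFDerivAt (fun x => H x t) (H' z t) z) :
    ContDiffOn ℝ 1 (fun z => ∫ t in (0 : ℝ)..1, H z t) Ω := by
  have : ProperSpace V := FiniteDimensional.proper ℝ V
  have hI : Set.uIoc (0 : ℝ) 1 ⊆ Icc 0 1 := by
    rw [uIoc_of_le zero_le_one]; exact Ioc_subset_Icc_self
  have key : ∀ z ∈ Ω, HasFDerivAt (fun z => ∫ t in (0 : ℝ)..1, H z t)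
      (∫ t in (0 : ℝ)..1, H' z t) z := by
    intro z hz
    obtain ⟨ρ, hρ, hρΩ⟩ := Metric.nhds_basis_closedBall.mem_iff.1 (hΩ.mem_nhds hz)
    obtain ⟨C, hC⟩ := ((isCompact_closedBall z ρ).prod isCompact_Icc).exists_bound_of_continuousOn
      (hH'.mono (prod_mono_left hρΩ))
    have hc : ∀ x ∈ Ω, ContinuousOn (H x) (Icc (0 : ℝ) 1) := fun x hx =>
      hH.comp (f := fun t => (x, t)) (by fun_prop) fun t ht => ⟨hx, ht⟩
    have hc' : ContinuousOn (H' z) (Icc (0 : ℝ) 1) :=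
      hH'.comp (f := fun t => (z, t)) (by fun_prop) fun t ht => ⟨hz, ht⟩
    refine intervalIntegral.hasFDerivAt_integral_of_dominated_of_fderiv_le
      (bound := fun _ => C) (Metric.closedBall_mem_nhds z hρ) ?_ ?_ ?_ ?_
      intervalIntegrable_const ?_
    · filter_upwards [hΩ.mem_nhds hz] with x hx
      exact ((hc x hx).aestronglyMeasurable measurableSet_Icc).mono_measure
        (MeasureTheory.Measure.restrict_mono hI le_rfl)
    · exact (hc z hz).intervalIntegrable_of_Icc zero_le_one
    · exact (hc'.aestronglyMeasurable measurableSet_Icc).mono_measure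
        (MeasureTheory.Measure.restrict_mono hI le_rfl)
    · exact .of_forall fun t ht x hx => hC (x, t) ⟨hx, hI ht⟩
    · exact .of_forall fun t ht x hx => hd x (hρΩ hx) t (hI ht)
  rw [show (1 : ℕ∞ω) = 0 + 1 from rfl, contDiffOn_succ_iff_fderiv_of_isOpen hΩ]
  refine ⟨fun z hz => (key z hz).differentiableAt.differentiableWithinAt, by simp, ?_⟩
  rw [contDiffOn_zero]
  exact (continuousOn_intervalIntegral hΩ hH').congr fun z hz => (key z hz).fderiv

variable {E : Type} [NormedAddCommGroup E] [NormedSpace ℝ E]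

/-- The pairs `(r, q)` with `r q` in the ball of radius `R`. -/
def radialDomain (E : Type) [NormedAddCommGroup E] [NormedSpace ℝ E] (R : ℝ) : Set (ℝ × E) :=
  {z | z.1 • z.2 ∈ Metric.ball (0 : E) R}

theorem isOpen_radialDomain (R : ℝ) : IsOpen (radialDomain E R) :=
  Metric.isOpen_ball.preimage (by fun_prop)

theorem radialDomain_smul {R : ℝ} {z : ℝ × E} (hz : z ∈ radialDomain E R) {t : ℝ}
    (ht : t ∈ Icc (0 : ℝ) 1) : (t * z.1, z.2) ∈ radialDomain E R := by
  simp only [radialDomain, mem_ofPred_eq, mem_ball_zero_iff, mul_smul, norm_smul t] at hz ⊢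
  rw [Real.norm_of_nonneg ht.1]
  exact (mul_le_of_le_one_left (norm_nonneg _) ht.2).trans_lt hz

/-- If the jets of `m` at the origin vanish up to the order `k`, then `r⁻ᵏ m(r q)` extends to a
`C¹` function of `(r, q)`. The extension is an iterated integral over the rays, by Hadamard's
lemma. -/
theorem exists_radial_quotient [FiniteDimensional ℝ E] {R : ℝ} (k : ℕ) :
    ∀ {W : Type} [NormedAddCommGroup W] [NormedSpace ℝ W] [CompleteSpace W] (m : E → W),
      AnalyticOnNhd ℝ m (Metric.ball 0 R) → (∀ j < k, iteratedFDeriv ℝ j m 0 = 0) →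
      ∃ M : ℝ × E → W, ContDiffOn ℝ 1 M (radialDomain E R) ∧
        ∀ z ∈ radialDomain E R, z.1 ^ k • M z = m (z.1 • z.2) := by
  induction k with
  | zero =>
    intro W _ _ _ m hm _
    refine ⟨fun z => m (z.1 • z.2), ?_, fun z _ => by simp⟩
    exact (hm.contDiffOn (n := 1) Metric.isOpen_ball.uniqueDiffOn).comp (by fun_prop) fun z hz => hz
  | succ k ih =>
    intro W _ _ _ m hm hjet
    obtain ⟨N, hN, hNm⟩ := ih (fderiv ℝ m) hm.fderiv fun j hj => by
      rw [← norm_eq_zero, norm_iteratedFDeriv_fderiv, hjet (j + 1) (by omega), norm_zero]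
    have hm0 : m 0 = 0 := by
      have h0 := hjet 0 (by omega)
      simpa using congrArg (fun p => p (fun _ => (0 : E))) h0
    have hΩ := isOpen_radialDomain (E := E) R
    -- `m(r q) = ∫₀¹ m'(t r q) (r q) dt`, and `m'` has vanishing jets up to the order `k - 1`
    refine ⟨fun z => ∫ t in (0 : ℝ)..1, t ^ k • N (t * z.1, z.2) z.2, ?_, fun z hz => ?_⟩
    · have hNc : ContinuousOn (fun p : (ℝ × E) × ℝ => N (p.2 * p.1.1, p.1.2))
          (radialDomain E R ×ˢ Icc (0 : ℝ) 1) :=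
        hN.continuousOn.comp (by fun_prop) fun p hp => radialDomain_smul hp.1 hp.2
      have hN'c : ContinuousOn (fun p : (ℝ × E) × ℝ => fderiv ℝ N (p.2 * p.1.1, p.1.2))
          (radialDomain E R ×ˢ Icc (0 : ℝ) 1) :=
        (hN.continuousOn_fderiv_of_isOpen hΩ le_rfl).comp (by fun_prop)
          fun p hp => radialDomain_smul hp.1 hp.2
      set P : ℝ → ℝ × E →L[ℝ] ℝ × E := fun t =>
        (t • ContinuousLinearMap.fst ℝ ℝ E).prod (ContinuousLinearMap.snd ℝ ℝ E) with hP
      have hPc : Continuous P := by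
        have : P = fun t => t • (ContinuousLinearMap.fst ℝ ℝ E).prod (0 : ℝ × E →L[ℝ] E)
            + (0 : ℝ × E →L[ℝ] ℝ).prod (ContinuousLinearMap.snd ℝ ℝ E) := by
          ext t x <;> simp [hP]
        rw [this]
        fun_prop
      refine contDiffOn_intervalIntegral hΩ (H' := fun z t =>
        t ^ k • ((N (t * z.1, z.2)).comp (ContinuousLinearMap.snd ℝ ℝ E)
          + ((fderiv ℝ N (t * z.1, z.2)).comp (P t)).flip z.2)) ?_ ?_ ?_
      · exact ContinuousOn.smul (f := fun p : (ℝ × E) × ℝ => p.2 ^ k) (by fun_prop)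
          (hNc.clm_apply (g := fun p : (ℝ × E) × ℝ => p.1.2) (by fun_prop))
      · refine ContinuousOn.smul (f := fun p : (ℝ × E) × ℝ => p.2 ^ k) (by fun_prop)
          (ContinuousOn.add ?_ ?_)
        · exact hNc.clm_comp continuousOn_const
        · have h1 : ContinuousOn (fun p : (ℝ × E) × ℝ =>
              (fderiv ℝ N (p.2 * p.1.1, p.1.2)).comp (P p.2))
              (radialDomain E R ×ˢ Icc (0 : ℝ) 1) := hN'c.clm_comp
                (hPc.comp continuous_snd).continuousOn
          have h2 : ContinuousOn (fun p : (ℝ × E) × ℝ =>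
              ((fderiv ℝ N (p.2 * p.1.1, p.1.2)).comp (P p.2)).flip)
              (radialDomain E R ×ˢ Icc (0 : ℝ) 1) :=
            (ContinuousLinearMap.flipₗᵢ ℝ (ℝ × E) E W).continuous.comp_continuousOn h1
          exact h2.clm_apply (g := fun p : (ℝ × E) × ℝ => p.1.2) (by fun_prop)
      · intro z hz t ht
        have h1 : HasFDerivAt N (fderiv ℝ N (t * z.1, z.2)) (t * z.1, z.2) :=
          ((hN.contDiffAt (hΩ.mem_nhds (radialDomain_smul hz ht))).differentiableAt
            one_ne_zero).hasFDerivAt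
        have h2 : HasFDerivAt (fun x : ℝ × E => (t * x.1, x.2)) (P t) z := (P t).hasFDerivAt
        have h3 := ((h1.comp z h2).clm_apply (hasFDerivAt_snd (p := z))).const_smul (t ^ k)
        exact h3
    · -- the fundamental theorem of calculus along the ray through `r q`
      rw [← intervalIntegral.integral_smul]
      have hseg : ∀ t ∈ Icc (0 : ℝ) 1, t • (z.1 • z.2) ∈ Metric.ball (0 : E) R := fun t ht => by
        have := radialDomain_smul hz ht
        simpa [radialDomain, mul_smul] using this
      have hft := intervalIntegral.integral_eq_sub_of_hasDerivAt (a := (0 : ℝ)) (b := 1)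
        (f := fun t : ℝ => m (t • (z.1 • z.2)))
        (f' := fun t => fderiv ℝ m (t • (z.1 • z.2)) (z.1 • z.2)) (fun t ht => ?_) ?_
      · simp only [one_smul, zero_smul, hm0, sub_zero] at hft
        rw [← hft]
        refine intervalIntegral.integral_congr fun t ht => ?_
        rw [uIcc_of_le zero_le_one] at ht
        have := hNm _ (radialDomain_smul hz ht)
        simp only [mul_smul t] at this
        rw [← this]
        simp only [smul_apply, map_smul, smul_smul]
        congr 1
        ring
      · rw [uIcc_of_le zero_le_one] at ht
        have h1 := (hm _ (hseg t ht)).differentiableAt.hasFDerivAt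
        have h2 : HasDerivAt (fun t : ℝ => t • (z.1 • z.2)) (z.1 • z.2) t := by
          simpa using (hasDerivAt_id t).smul_const (z.1 • z.2)
        exact h1.comp_hasDerivAt t h2
      · refine ContinuousOn.intervalIntegrable ?_
        rw [uIcc_of_le zero_le_one]
        exact (hm.fderiv.continuousOn.comp (by fun_prop) hseg).clm_apply (by fun_prop)

end Radial

/-! ### The leading jet -/

section Jet

variable {E W : Type*} [NormedAddCommGroup E] [NormedSpace ℝ E] [NormedAddCommGroup W]
  [NormedSpace ℝ W]

/-- The power series of the homogeneous polynomial `x ↦ p(x, …, x)`: its only term is `p`. -/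
def diagonalSeries {l : ℕ} (p : E [×l]→L[ℝ] W) : FormalMultilinearSeries ℝ E W :=
  fun j => if h : j = l then h ▸ p else 0

theorem diagonalSeries_self {l : ℕ} (p : E [×l]→L[ℝ] W) : diagonalSeries p l = p := dif_pos rfl

theorem diagonalSeries_of_ne {l j : ℕ} (p : E [×l]→L[ℝ] W) (h : j ≠ l) :
    diagonalSeries p j = 0 := dif_neg h

theorem hasFPowerSeriesOnBall_diagonal {l : ℕ} (p : E [×l]→L[ℝ] W) :
    HasFPowerSeriesOnBall (fun x : E => p fun _ => x)
      (diagonalSeries p) 0 ⊤ where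
  r_le := by
    rw [FormalMultilinearSeries.radius_eq_top_of_eventually_eq_zero]
    filter_upwards [eventually_gt_atTop l] with j hj
    exact diagonalSeries_of_ne p hj.ne'
  r_pos := ENNReal.zero_lt_top
  hasSum := fun {y} _ => by
    rw [zero_add]
    convert hasSum_single l fun j hj => ?_
    · rw [diagonalSeries_self]
    · simp [diagonalSeries_of_ne p hj]

/-- The jets at the origin of the homogeneous polynomial `x ↦ p(x, …, x)` of degree `l`. -/
theorem iteratedFDeriv_diagonal [CompleteSpace W] {l : ℕ} (p : E [×l]→L[ℝ] W)
    (hp : ∀ (v : Fin l → E) (σ : Equiv.Perm (Fin l)), p (v ∘ σ) = p v) :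
    iteratedFDeriv ℝ l (fun x : E => p fun _ => x) 0 = (l ! : ℝ) • p ∧
      ∀ j ≠ l, iteratedFDeriv ℝ j (fun x : E => p fun _ => x) 0 = 0 := by
  constructor
  · ext v
    rw [(hasFPowerSeriesOnBall_diagonal p).iteratedFDeriv_eq_sum_of_completeSpace]
    have : ∀ σ : Equiv.Perm (Fin l), p (fun i => v (σ i)) = p v := fun σ => hp v σ
    simp [diagonalSeries_self, this, Fintype.card_perm, Nat.cast_smul_eq_nsmul]
  · intro j hj
    ext v
    rw [(hasFPowerSeriesOnBall_diagonal p).iteratedFDeriv_eq_sum_of_completeSpace]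
    simp [diagonalSeries_of_ne p hj]

end Jet

namespace McGehee

/-! ### Smoothness of matrix expressions -/

section Matrix

variable {X : Type*} [NormedAddCommGroup X] [NormedSpace ℝ X] {s : Set X} {k : ℕ∞ω} {n : ℕ}

theorem contDiffOn_det {m : Type*} [Fintype m] [DecidableEq m] {M : X → Matrix m m ℝ}
    (hM : ∀ i j, ContDiffOn ℝ k (fun x => M x i j) s) :
    ContDiffOn ℝ k (fun x => (M x).det) s := by
  simp only [Matrix.det_apply]
  exact ContDiffOn.sum fun σ _ => (contDiffOn_prod fun i _ => hM _ _).const_smul _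

theorem contDiffOn_matrix_inv {M : X → Matrix (Fin n) (Fin n) ℝ}
    (hM : ∀ i j, ContDiffOn ℝ k (fun x => M x i j) s) (hdet : ∀ x ∈ s, (M x).det ≠ 0)
    (i j : Fin n) : ContDiffOn ℝ k (fun x => (M x)⁻¹ i j) s := by
  have h1 : ContDiffOn ℝ k (fun x => (M x).det⁻¹ * (M x).adjugate i j) s := by
    refine ((contDiffOn_det hM).inv hdet).mul ?_
    simp only [Matrix.adjugate_apply]
    refine contDiffOn_det fun a b => ?_
    by_cases h : a = j
    · subst h
      simpa using! contDiffOn_const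
    · simpa [Matrix.updateRow_apply, h] using hM a b
  refine h1.congr fun x hx => ?_
  simp [Matrix.inv_def, Ring.inverse_eq_inv']

theorem contDiffOn_toEuclideanLin {M : X → Matrix (Fin n) (Fin n) ℝ} {v : X → Vec n}
    (hM : ∀ i j, ContDiffOn ℝ k (fun x => M x i j) s) (hv : ContDiffOn ℝ k v s) :
    ContDiffOn ℝ k (fun x => (M x).toEuclideanLin (v x)) s := by
  rw [contDiffOn_euclidean] at hv ⊢
  intro i
  simp only [Matrix.toLpLin_apply, Matrix.mulVec, dotProduct]
  exact ContDiffOn.sum fun j _ => (hM i j).mul (hv j)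

end Matrix

namespace LagrangianSystem

variable {n : ℕ} (L : LagrangianSystem n)

/-! ### The leading part of the potential -/

theorem iteratedFDeriv_U_of_lt {j : ℕ} (hj : j < L.l) : iteratedFDeriv ℝ j L.U 0 = 0 := by
  by_contra h
  exact Nat.notMem_of_lt_sInf hj h

theorem two_le_l : 2 ≤ L.l := by
  have h1 := L.one_le_l
  have hmem : iteratedFDeriv ℝ L.l L.U 0 ≠ 0 :=
    Nat.sInf_mem (Nat.nonempty_of_pos_sInf (show 0 < sInf _ from h1))
  by_contra hl
  have hl1 : L.l = 0 + 1 := by omega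
  rw [hl1, ← norm_ne_zero_iff, ← norm_iteratedFDeriv_fderiv, norm_iteratedFDeriv_zero,
    L.U_critical] at hmem
  exact hmem norm_zero

/-- The symmetric multilinear form of which `U_l` is the diagonal. -/
noncomputable def UlForm : Vec n [×L.l]→L[ℝ] ℝ := ((L.l ! : ℝ)⁻¹) • iteratedFDeriv ℝ L.l L.U 0

theorem Ul_eq : L.Ul = fun x => L.UlForm fun _ => x := by
  ext x
  simp only [UlForm]
  rfl

theorem contDiff_Ul {k : ℕ∞ω} : ContDiff ℝ k L.Ul := by
  rw [Ul_eq]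
  exact L.UlForm.contDiff.comp (contDiff_pi.2 fun _ => contDiff_id)

theorem Ul_smul (c : ℝ) (x : Vec n) : L.Ul (c • x) = c ^ L.l * L.Ul x := by
  rw [Ul_eq]
  simpa using L.UlForm.map_smul_univ (fun _ => c) fun _ => x

theorem iteratedFDeriv_U_sub_Ul {j : ℕ} (hj : j ≤ L.l) :
    iteratedFDeriv ℝ j (L.U - L.Ul) 0 = 0 := by
  have hU : ContDiffAt ℝ ω L.U 0 := (L.U_analytic 0 (Metric.mem_ball_self L.rE_pos)).contDiffAt
  have hd := iteratedFDeriv_diagonal L.UlForm fun v σ => by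
    simp only [UlForm, smul_apply, hU.iteratedFDeriv_comp_perm]
  rw [iteratedFDeriv_sub_apply (hU.of_le le_top) L.contDiff_Ul.contDiffAt, Ul_eq]
  rcases hj.eq_or_lt with rfl | hj
  · rw [hd.1, UlForm, smul_smul, mul_inv_cancel₀ (by positivity), one_smul, sub_self]
  · rw [hd.2 j hj.ne, L.iteratedFDeriv_U_of_lt hj, sub_zero]

/-- The gradient as the composition of the derivative with the Riesz isometry. -/
theorem gradient_eq_toDual_symm (F : Vec n → ℝ) :
    ∇ F = fun x => (InnerProductSpace.toDual ℝ (Vec n)).symm (fderiv ℝ F x) := rfl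

theorem contDiff_gradient_Ul {k : ℕ∞ω} : ContDiff ℝ k (∇ L.Ul) := by
  rw [gradient_eq_toDual_symm]
  exact (InnerProductSpace.toDual ℝ (Vec n)).symm.contDiff.comp
    ((L.contDiff_Ul (k := ω)).fderiv_right (m := k) (by simp))

theorem gradient_Ul_smul (c : ℝ) (x : Vec n) :
    ∇ L.Ul (c • x) = c ^ (L.l - 1) • ∇ L.Ul x := by
  obtain ⟨m, hm⟩ : ∃ m, L.l = m + 2 := ⟨L.l - 2, by have := L.two_le_l; omega⟩
  have hdiff : ∀ x, HasFDerivAt L.Ul (fderiv ℝ L.Ul x) x := fun x =>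
    ((L.contDiff_Ul (k := 1)).differentiable one_ne_zero x).hasFDerivAt
  have key : ∀ (c : ℝ) (x : Vec n), c • fderiv ℝ L.Ul (c • x) = c ^ L.l • fderiv ℝ L.Ul x := by
    intro c x
    have h1 := (hdiff (c • x)).comp x ((hasFDerivAt_id x).const_smul c)
    have h2 := (hdiff x).const_smul (c ^ L.l)
    have h3 : L.Ul ∘ (fun x => c • x) = c ^ L.l • L.Ul := by
      ext x; simp [Ul_smul]
    have h4 := (show HasFDerivAt (L.Ul ∘ (fun x => c • x)) _ x from h1).unique (h3 ▸ h2)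
    rw [← h4]
    ext v
    simp
  rw [gradient_eq_toDual_symm]
  simp only
  rw [← map_smul]
  congr 1
  rcases eq_or_ne c 0 with rfl | hc
  · -- at the origin the derivative vanishes because `l ≠ 1`
    have h1 := key 2 0
    rw [smul_zero, ← sub_eq_zero, ← sub_smul, smul_eq_zero] at h1
    have h2 : (2 : ℝ) - 2 ^ L.l ≠ 0 := by
      rw [hm, pow_succ, pow_succ]
      have : (1 : ℝ) ≤ 2 ^ m := one_le_pow₀ one_le_two
      nlinarith
    rw [zero_smul, h1.resolve_left h2, hm]
    simp
  · have h1 := key c x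
    rw [hm, show m + 2 = (m + 1) + 1 from rfl, pow_succ', mul_smul] at h1
    rw [hm]
    exact smul_right_injective _ hc h1

/-- Euler's identity. -/
theorem inner_gradient_Ul_self (x : Vec n) : inner ℝ (∇ L.Ul x) x = L.l * L.Ul x := by
  rw [inner_gradient_left]
  have h1 : HasFDerivAt L.Ul (fderiv ℝ L.Ul x) ((1 : ℝ) • x) := by
    rw [one_smul]
    exact ((L.contDiff_Ul (k := 1)).differentiable one_ne_zero x).hasFDerivAt
  have h2 : HasDerivAt (fun c : ℝ => L.Ul (c • x)) (fderiv ℝ L.Ul x x) 1 := by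
    have := h1.comp_hasDerivAt (1 : ℝ) ((hasDerivAt_id (1 : ℝ)).smul_const x)
    simpa using! this
  have h3 : HasDerivAt (fun c : ℝ => L.Ul (c • x)) (L.l * L.Ul x) 1 := by
    simp only [Ul_smul]
    simpa using (hasDerivAt_pow L.l (1 : ℝ)).mul_const (L.Ul x)
  exact h2.unique h3

/-- Euler's identity for the gradient. -/
theorem fderiv_gradient_Ul_self (x : Vec n) :
    fderiv ℝ (∇ L.Ul) x x = ((L.l : ℝ) - 1) • ∇ L.Ul x := by
  have h1 : HasFDerivAt (∇ L.Ul) (fderiv ℝ (∇ L.Ul) x) ((1 : ℝ) • x) := by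
    rw [one_smul]
    exact ((L.contDiff_gradient_Ul (k := 1)).differentiable one_ne_zero x).hasFDerivAt
  have h2 : HasDerivAt (fun c : ℝ => ∇ L.Ul (c • x)) (fderiv ℝ (∇ L.Ul) x x) 1 := by
    have := h1.comp_hasDerivAt (1 : ℝ) ((hasDerivAt_id (1 : ℝ)).smul_const x)
    simpa using! this
  have h3 : HasDerivAt (fun c : ℝ => ∇ L.Ul (c • x)) (((L.l : ℝ) - 1) • ∇ L.Ul x) 1 := by
    simp only [gradient_Ul_smul]
    have := (hasDerivAt_pow (L.l - 1) (1 : ℝ)).smul_const (∇ L.Ul x)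
    rwa [one_pow, mul_one, Nat.cast_sub L.one_le_l, Nat.cast_one] at this
  exact h2.unique h3

/-- The Hessian of `U_l` is symmetric. -/
theorem inner_fderiv_gradient_Ul_comm (x v w : Vec n) :
    inner ℝ (fderiv ℝ (∇ L.Ul) x v) w = inner ℝ (fderiv ℝ (∇ L.Ul) x w) v := by
  have hsymm : IsSymmSndFDerivAt ℝ L.Ul x :=
    (L.contDiff_Ul (k := ω)).contDiffAt.isSymmSndFDerivAt_of_omega
  have hd : ∀ v, fderiv ℝ (∇ L.Ul) x v
      = (InnerProductSpace.toDual ℝ (Vec n)).symm (fderiv ℝ (fderiv ℝ L.Ul) x v) := fun v => by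
    have h1 : HasFDerivAt (fderiv ℝ L.Ul) (fderiv ℝ (fderiv ℝ L.Ul) x) x :=
      (((L.contDiff_Ul (k := ω)).fderiv_right (m := 1) (by simp)).differentiable one_ne_zero
        x).hasFDerivAt
    have h2 := ((InnerProductSpace.toDual ℝ (Vec n)).symm.toContinuousLinearEquiv
      |>.toContinuousLinearMap.hasFDerivAt).comp x h1
    rw [show ∇ L.Ul = _ from gradient_eq_toDual_symm L.Ul]
    exact congrArg (fun T => T v) h2.fderiv
  rw [hd, hd, InnerProductSpace.toDual_symm_apply, InnerProductSpace.toDual_symm_apply]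
  exact hsymm v w

end LagrangianSystem
end McGehee

namespace McGehee
namespace LagrangianSystem

variable {n : ℕ} (L : LagrangianSystem n)

/-! ### Smoothness of the McGehee field -/

/-- The open set of all `(r, q, y)` with `r q` in the domain of the Lagrangian, on which
the McGehee field is regarded as an ambient vector field. -/
def domain : Set (Amb n) := {ζ | ζ.1 • ζ.2.1 ∈ Metric.ball (0 : Vec n) L.rE}

theorem isOpen_domain : IsOpen L.domain :=
  Metric.isOpen_ball.preimage (by fun_prop)

theorem extendedManifold_subset_domain : L.extendedManifold ⊆ L.domain := fun ζ hζ => by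
  simpa [domain, norm_smul, hζ.2] using hζ.1

theorem mem_domain_of_fst_eq_zero {ζ : Amb n} (h : ζ.1 = 0) : ζ ∈ L.domain := by
  simpa [domain, h] using L.rE_pos

theorem contDiffOn_comp_radial {W : Type*} [NormedAddCommGroup W] [NormedSpace ℝ W]
    {m : Vec n → W} (hm : ContDiffOn ℝ 1 m (Metric.ball 0 L.rE)) :
    ContDiffOn ℝ 1 (fun ζ : Amb n => m (ζ.1 • ζ.2.1)) L.domain :=
  hm.comp (by fun_prop) fun _ hζ => hζ

theorem contDiffOn_g_inv (i j : Fin n) :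
    ContDiffOn ℝ 1 (fun x => (L.g x)⁻¹ i j) (Metric.ball 0 L.rE) :=
  contDiffOn_matrix_inv (fun i j => (L.g_analytic i j).contDiffOn Metric.isOpen_ball.uniqueDiffOn)
    (fun x hx => (L.g_posDef x hx).det_pos.ne') i j

theorem analyticOnNhd_partialDeriv {w : Vec n → ℝ} {s : Set (Vec n)} (hw : AnalyticOnNhd ℝ w s)
    (a : Fin n) : AnalyticOnNhd ℝ (partialDeriv a w) s :=
  (ContinuousLinearMap.apply ℝ ℝ (EuclideanSpace.single a (1 : ℝ))).comp_analyticOnNhd hw.fderiv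

theorem contDiffOn_christoffel :
    ContDiffOn ℝ 1 (fun ζ : Amb n => L.christoffel (ζ.1 • ζ.2.1) ζ.2.2) L.domain := by
  rw [contDiffOn_euclidean]
  intro k
  simp only [christoffel]
  have hp : ∀ a i j, ContDiffOn ℝ 1
      (fun ζ : Amb n => partialDeriv a (fun z => L.g z i j) (ζ.1 • ζ.2.1)) L.domain := fun a i j =>
    L.contDiffOn_comp_radial ((analyticOnNhd_partialDeriv (L.g_analytic i j) a).contDiffOn
      Metric.isOpen_ball.uniqueDiffOn)
  have hi : ∀ i j, ContDiffOn ℝ 1 (fun ζ : Amb n => (L.g (ζ.1 • ζ.2.1))⁻¹ i j) L.domain :=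
    fun i j => L.contDiffOn_comp_radial (L.contDiffOn_g_inv i j)
  have hy : ∀ i, ContDiffOn ℝ 1 (fun ζ : Amb n => ζ.2.2 i) L.domain := fun i => by fun_prop
  refine ContDiffOn.sum fun i _ => ContDiffOn.sum fun j _ => ?_
  exact (((contDiffOn_const.mul (ContDiffOn.sum fun m _ =>
    (hi k m).mul (((hp i j m).add (hp j i m)).sub (hp m i j)))).mul (hy i)).mul (hy j))

theorem hasFDerivAt_U {x : Vec n} (hx : x ∈ Metric.ball 0 L.rE) :
    HasFDerivAt L.U (fderiv ℝ L.U x) x :=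
  (L.U_analytic x hx).differentiableAt.hasFDerivAt

/-- The radial quotient of the gradient of `U - U_l`. -/
theorem exists_gradRemainder : ∃ V : ℝ × Vec n → Vec n,
    ContDiffOn ℝ 1 V (radialDomain (Vec n) L.rE) ∧
    ∀ z ∈ radialDomain (Vec n) L.rE, z.1 • L.gradRemainder z.1 z.2 = z.1 • V z := by
  have hUl : AnalyticOnNhd ℝ L.Ul (Metric.ball 0 L.rE) := fun x _ =>
    (L.contDiff_Ul (k := ω)).contDiffAt.analyticAt
  have hf : AnalyticOnNhd ℝ (L.U - L.Ul) (Metric.ball 0 L.rE) := L.U_analytic.sub hUl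
  set e := (InnerProductSpace.toDual ℝ (Vec n)).symm with he
  obtain ⟨V, hV, hVm⟩ := exists_radial_quotient (R := L.rE) L.l (∇ (L.U - L.Ul))
    ((e.toContinuousLinearEquiv.toContinuousLinearMap.restrictScalars ℝ).comp_analyticOnNhd
      hf.fderiv) fun j hj => by
      rw [gradient_eq_toDual_symm, ← norm_eq_zero]
      have := e.norm_iteratedFDeriv_comp_left (𝕜 := ℝ) (fderiv ℝ (L.U - L.Ul)) 0 j
      refine this.trans ?_
      rw [norm_iteratedFDeriv_fderiv, L.iteratedFDeriv_U_sub_Ul hj, norm_zero]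
  refine ⟨V, hV, fun z hz => ?_⟩
  rcases eq_or_ne z.1 0 with h0 | h0
  · simp [h0]
  · congr 1
    rw [gradRemainder, inv_smul_eq_iff₀ (pow_ne_zero _ h0), hVm z hz, ← gradient_Ul_smul]
    simp only [gradient_eq_toDual_symm]
    rw [← map_sub, fderiv_sub (L.hasFDerivAt_U hz).differentiableAt
      ((L.contDiff_Ul (k := 1)).differentiable one_ne_zero _)]

/-- The product `r F_X` is `C¹` also where `r = 0`, whatever the values of the quotients in `F_X`
there: the metric enters through `r h = g⁻¹ - 1`. -/
theorem contDiffOn_smul_correction :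
    ContDiffOn ℝ 1 (fun ζ : Amb n => ζ.1 • L.correction ζ) L.domain := by
  obtain ⟨V, hV, hVeq⟩ := L.exists_gradRemainder
  have hi : ∀ i j, ContDiffOn ℝ 1 (fun ζ : Amb n => (L.g (ζ.1 • ζ.2.1))⁻¹ i j) L.domain :=
    fun i j => L.contDiffOn_comp_radial (L.contDiffOn_g_inv i j)
  have hV' : ContDiffOn ℝ 1 (fun ζ : Amb n => ζ.1 • V (ζ.1, ζ.2.1)) L.domain :=
    ContDiffOn.smul (f := fun ζ : Amb n => ζ.1) (by fun_prop)
      (hV.comp (t := radialDomain (Vec n) L.rE) (f := fun ζ : Amb n => (ζ.1, ζ.2.1))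
        (by fun_prop) fun ζ hζ => hζ)
  have hgrad : ContDiffOn ℝ 1 (fun ζ : Amb n => ∇ L.Ul ζ.2.1) L.domain :=
    (L.contDiff_gradient_Ul.comp (by fun_prop : ContDiff ℝ 1 fun ζ : Amb n => ζ.2.1)).contDiffOn
  have hone : ∀ i j, ContDiffOn ℝ 1
      (fun ζ : Amb n => ((L.g (ζ.1 • ζ.2.1))⁻¹ - 1 : Matrix _ _ ℝ) i j) L.domain := fun i j => by
    simp only [Matrix.sub_apply]
    exact (hi i j).sub contDiffOn_const
  have h1 := ((contDiffOn_toEuclideanLin hi hV').neg.sub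
    (contDiffOn_toEuclideanLin hone hgrad)).sub
    (ContDiffOn.smul (f := fun ζ : Amb n => ζ.1) (by fun_prop) L.contDiffOn_christoffel)
  refine h1.congr fun ζ hζ => ?_
  have h2 := hVeq (ζ.1, ζ.2.1) hζ
  simp only at h2
  have h3 : ζ.1 • (L.metricRemainder ζ.1 ζ.2.1).toEuclideanLin (∇ L.Ul ζ.2.1)
      = ((L.g (ζ.1 • ζ.2.1))⁻¹ - 1).toEuclideanLin (∇ L.Ul ζ.2.1) := by
    rcases eq_or_ne ζ.1 0 with h0 | h0
    · simp [h0, L.g_zero]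
    · rw [metricRemainder, map_smul, LinearMap.smul_apply, smul_smul, mul_inv_cancel₀ h0, one_smul]
  simp only [correction, smul_sub, smul_neg, h3]
  rw [← map_smul, h2]
  rfl

theorem iteratedFDeriv_A_of_lt {j : ℕ} (hj : j < L.d) : iteratedFDeriv ℝ j L.A 0 = 0 := by
  by_contra h
  exact Nat.notMem_of_lt_sInf hj h

/-- The radial quotient of the magnetic field. -/
theorem exists_magneticRemainder (a b : Fin n) : ∃ M : ℝ × Vec n → ℝ,
    ContDiffOn ℝ 1 M (radialDomain (Vec n) L.rE) ∧
    ∀ z ∈ radialDomain (Vec n) L.rE, z.1 ^ (L.d - 1) • M z = L.magnetic (z.1 • z.2) a b := by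
  have hA : ∀ b, AnalyticOnNhd ℝ (fun z => L.A z b) (Metric.ball 0 L.rE) := fun b =>
    (EuclideanSpace.proj b : Vec n →L[ℝ] ℝ).comp_analyticOnNhd L.A_analytic
  have h0 : (0 : Vec n) ∈ Metric.ball (0 : Vec n) L.rE := Metric.mem_ball_self L.rE_pos
  have hjet : ∀ a b, ∀ j < L.d - 1,
      iteratedFDeriv ℝ j (partialDeriv a fun z => L.A z b) 0 = 0 := by
    intro a b j hj
    have h1 : iteratedFDeriv ℝ (j + 1) (fun z => L.A z b) 0 = 0 := by
      have := (EuclideanSpace.proj b : Vec n →L[ℝ] ℝ).iteratedFDeriv_comp_left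
        (f := L.A) (x := 0) (n := ω) (i := j + 1) (L.A_analytic 0 h0).contDiffAt le_top
      rw [L.iteratedFDeriv_A_of_lt (by omega)] at this
      refine this.trans ?_
      ext v
      simp
    have h2 : iteratedFDeriv ℝ j (fderiv ℝ fun z => L.A z b) 0 = 0 := by
      rw [← norm_eq_zero, norm_iteratedFDeriv_fderiv, h1, norm_zero]
    have := (ContinuousLinearMap.apply ℝ ℝ (EuclideanSpace.single a (1 : ℝ) : Vec n)
      ).iteratedFDeriv_comp_left (f := fderiv ℝ fun z => L.A z b) (x := 0) (n := ω) (i := j)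
      ((hA b).fderiv 0 h0).contDiffAt le_top
    rw [h2] at this
    refine this.trans ?_
    ext v
    simp
  have han : ∀ a b, AnalyticOnNhd ℝ (partialDeriv a fun z => L.A z b) (Metric.ball 0 L.rE) :=
    fun a b => analyticOnNhd_partialDeriv (hA b) a
  refine exists_radial_quotient (L.d - 1) (fun x => L.magnetic x a b)
    ((han a b).sub (han b a)) fun j hj => ?_
  have := iteratedFDeriv_sub_apply (𝕜 := ℝ) (i := j) ((han a b) 0 h0).contDiffAt
    ((han b a) 0 h0).contDiffAt
  rw [hjet a b j hj, hjet b a j hj, sub_zero] at this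
  exact this

theorem magneticFactor_zero (hmag : L.WeakMagnetism) (hA : ¬ L.A =ᶠ[𝓝 0] 0) :
    L.magneticFactor 0 = 0 := by
  have h1 : (2 : ℝ) + L.l ≤ 2 * L.d := by linarith [hmag hA]
  have h2 : 2 + L.l ≤ 2 * L.d := by exact_mod_cast h1
  unfold magneticFactor
  split_ifs with he
  · exact zero_pow (by omega)
  · rw [abs_zero, Real.zero_rpow (by linarith)]

theorem contDiff_magneticFactor (hmag : L.WeakMagnetism) (hA : ¬ L.A =ᶠ[𝓝 0] 0) :
    ContDiff ℝ 1 L.magneticFactor := by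
  have h1 : (2 : ℝ) + L.l ≤ 2 * L.d := by linarith [hmag hA]
  have h2 : 2 + L.l ≤ 2 * L.d := by exact_mod_cast h1
  unfold magneticFactor
  by_cases he : Even L.l
  · simp only [he, if_true]
    fun_prop
  · simp only [he, if_false]
    -- for odd `l` the exponent `d - l/2 ≥ 1` is a half-integer, hence greater than `1`
    have h3 : 2 + L.l ≠ 2 * L.d := fun h => he ⟨L.d - 1, by omega⟩
    have h4 : 3 + L.l ≤ 2 * L.d := by omega
    have h5 : (3 : ℝ) + L.l ≤ 2 * L.d := by exact_mod_cast h4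
    exact contDiff_norm_rpow (E := ℝ) (by linarith)

theorem magneticCorrection_eq_zero (hA : L.A =ᶠ[𝓝 0] 0) {ζ : Amb n} (hζ : ζ ∈ L.domain) :
    L.magneticCorrection ζ = 0 := by
  simp [magneticCorrection, L.magnetic_eq_zero hA hζ]

theorem contDiffOn_smul_magneticCorrection (hmag : L.WeakMagnetism) :
    ContDiffOn ℝ 1 (fun ζ : Amb n => L.magneticFactor ζ.1 • L.magneticCorrection ζ)
      L.domain := by
  by_cases hA : L.A =ᶠ[𝓝 0] 0
  · refine (contDiffOn_const (c := 0)).congr fun ζ hζ => ?_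
    rw [L.magneticCorrection_eq_zero hA hζ, smul_zero]
  choose M hM hMeq using L.exists_magneticRemainder
  have hi : ∀ i j, ContDiffOn ℝ 1 (fun ζ : Amb n => (L.g (ζ.1 • ζ.2.1))⁻¹ i j) L.domain :=
    fun i j => L.contDiffOn_comp_radial (L.contDiffOn_g_inv i j)
  have hM' : ∀ a b, ContDiffOn ℝ 1
      (fun ζ : Amb n => (Matrix.of fun a b => M a b (ζ.1, ζ.2.1)) a b) L.domain := fun a b =>
    (hM a b).comp (t := radialDomain (Vec n) L.rE) (by fun_prop) fun ζ hζ => hζ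
  have hf : ContDiffOn ℝ 1 (fun ζ : Amb n => L.magneticFactor ζ.1) L.domain :=
    ((L.contDiff_magneticFactor hmag hA).comp contDiff_fst).contDiffOn
  have h1 := hf.smul (contDiffOn_toEuclideanLin hi (contDiffOn_toEuclideanLin hM'
    (v := fun ζ : Amb n => ζ.2.2) (by fun_prop)))
  refine h1.congr fun ζ hζ => ?_
  rcases eq_or_ne ζ.1 0 with h0 | h0
  · simp [h0, L.magneticFactor_zero hmag hA]
  · rw [magneticCorrection]
    congr 4
    ext a b
    have := hMeq a b (ζ.1, ζ.2.1) hζ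
    simp only [smul_eq_mul] at this
    simp only [Matrix.smul_apply, smul_eq_mul, Matrix.of_apply, ← this]
    rw [inv_mul_cancel_left₀ (pow_ne_zero _ h0)]

/-- The part of the McGehee field that vanishes on the boundary. -/
noncomputable def fieldRemainder (ζ : Amb n) : Vec n :=
  ζ.1 • L.correction ζ + L.magneticFactor ζ.1 • L.magneticCorrection ζ

theorem contDiffOn_fieldRemainder (hmag : L.WeakMagnetism) :
    ContDiffOn ℝ 1 L.fieldRemainder L.domain :=
  L.contDiffOn_smul_correction.add (L.contDiffOn_smul_magneticCorrection hmag)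

theorem fieldRemainder_eq_zero (hmag : L.WeakMagnetism) {ζ : Amb n} (h : ζ.1 = 0) :
    L.fieldRemainder ζ = 0 := by
  by_cases hA : L.A =ᶠ[𝓝 0] 0
  · simp [fieldRemainder, h, L.magneticCorrection_eq_zero hA (L.mem_domain_of_fst_eq_zero h)]
  · simp [fieldRemainder, h, L.magneticFactor_zero hmag hA]

/-- The McGehee field without the terms that vanish on the boundary. -/
noncomputable def boundaryField (ζ : Amb n) : Amb n :=
  (inner ℝ ζ.2.1 ζ.2.2 * ζ.1, ζ.2.2 - inner ℝ ζ.2.1 ζ.2.2 • ζ.2.1,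
    -(∇ L.Ul ζ.2.1) - ((L.l : ℝ) / 2 * inner ℝ ζ.2.1 ζ.2.2) • ζ.2.2)

theorem field_eq (ζ : Amb n) : L.field ζ = L.boundaryField ζ + (0, 0, L.fieldRemainder ζ) := by
  refine Prod.ext ?_ (Prod.ext ?_ ?_)
  · simp [field, boundaryField]
  · simp [field, boundaryField]
  · simp only [field, boundaryField, fieldRemainder, Prod.snd_add, add_assoc]

theorem contDiff_boundaryField : ContDiff ℝ 1 L.boundaryField := by
  have hi : ContDiff ℝ 1 (fun ζ : Amb n => inner ℝ ζ.2.1 ζ.2.2) :=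
    ContDiff.inner ℝ (by fun_prop) (by fun_prop)
  have hgrad : ContDiff ℝ 1 (fun ζ : Amb n => ∇ L.Ul ζ.2.1) :=
    L.contDiff_gradient_Ul.comp (by fun_prop : ContDiff ℝ 1 fun ζ : Amb n => ζ.2.1)
  refine (hi.mul contDiff_fst).prodMk (ContDiff.prodMk ?_ ?_)
  · exact ContDiff.sub (by fun_prop) (hi.smul (by fun_prop))
  · exact hgrad.neg.sub ((contDiff_const.mul hi).smul (by fun_prop))

/-- The McGehee field is continuously differentiable. -/
theorem contDiffOn_field (hmag : L.WeakMagnetism) : ContDiffOn ℝ 1 L.field L.domain := by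
  refine (L.contDiff_boundaryField.contDiffOn.add (contDiffOn_const.prodMk
    (contDiffOn_const.prodMk (L.contDiffOn_fieldRemainder hmag)))).congr fun ζ _ => L.field_eq ζ

end LagrangianSystem
end McGehee

/-! ### Hyperbolic splittings of linear maps -/

theorem eventually_pos_lt {c : ℝ} (hc : 0 < c) : ∀ᶠ h in 𝓝[>] (0 : ℝ), 0 < h ∧ h < c :=
  (eventually_mem_nhdsWithin (α := ℝ) (a := 0) (s := Ioi 0)).and
    (nhdsWithin_le_nhds (gt_mem_nhds hc))

section

variable {S U : Type*} [NormedAddCommGroup S] [NormedSpace ℝ S] [NormedAddCommGroup U]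
  [NormedSpace ℝ U]

theorem IsContracting.mono {α β : ℝ} {A : S →L[ℝ] S} (h : IsContracting α A) (hβ : β ≤ α) :
    IsContracting β A := by
  filter_upwards [h, eventually_pos_lt one_pos] with t ht ht' s
  exact (ht s).trans (by have := ht'.1; gcongr)

theorem IsExpanding.mono {α β : ℝ} {A : S →L[ℝ] S} (h : IsExpanding α A) (hβ : β ≤ α) :
    IsExpanding β A := by
  filter_upwards [h, eventually_pos_lt one_pos] with t ht ht' s
  exact le_trans (by have := ht'.1; gcongr) (ht s)

theorem IsContracting.prodMap {α : ℝ} {A : S →L[ℝ] S} {B : U →L[ℝ] U} (hA : IsContracting α A)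
    (hB : IsContracting α B) (hα : 0 < α) : IsContracting α (A.prodMap B) := by
  filter_upwards [hA, hB, eventually_pos_lt (inv_pos.2 hα)] with t h1 h2 h3 s
  have h4 : 0 ≤ 1 - α * t := by
    have := mul_lt_mul_of_pos_left h3.2 hα
    rw [mul_inv_cancel₀ hα.ne'] at this
    linarith
  refine norm_prod_le_iff.2 ⟨(h1 s.1).trans ?_, (h2 s.2).trans ?_⟩
  · exact mul_le_mul_of_nonneg_left (norm_fst_le s) h4
  · exact mul_le_mul_of_nonneg_left (norm_snd_le s) h4

theorem IsExpanding.prodMap {α : ℝ} {A : S →L[ℝ] S} {B : U →L[ℝ] U} (hA : IsExpanding α A)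
    (hB : IsExpanding α B) : IsExpanding α (A.prodMap B) := by
  filter_upwards [hA, hB] with t h1 h2 s
  rcases le_total ‖s.1‖ ‖s.2‖ with h | h
  · rw [Prod.norm_def s, max_eq_right h]
    exact (h2 s.2).trans (norm_snd_le (s + t • (A.prodMap B) s))
  · rw [Prod.norm_def s, max_eq_left h]
    exact (h1 s.1).trans (norm_fst_le (s + t • (A.prodMap B) s))

theorem isContracting_of_subsingleton [Subsingleton S] (α : ℝ) (A : S →L[ℝ] S) :
    IsContracting α A :=
  Eventually.of_forall fun h s => by simp [Subsingleton.elim s 0]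

theorem isExpanding_of_subsingleton [Subsingleton S] (α : ℝ) (A : S →L[ℝ] S) :
    IsExpanding α A :=
  Eventually.of_forall fun h s => by simp [Subsingleton.elim s 0]

theorem isContracting_smul_id {c : ℝ} (hc : c < 0) :
    IsContracting (-c) (c • ContinuousLinearMap.id ℝ ℝ) := by
  filter_upwards [eventually_pos_lt (inv_pos.2 (neg_pos.2 hc))] with h hh s
  have h4 : 0 ≤ 1 + h * c := by
    have := mul_lt_mul_of_pos_left hh.2 (neg_pos.2 hc)
    rw [mul_inv_cancel₀ (neg_pos.2 hc).ne'] at this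
    linarith
  have : s + h • (c • ContinuousLinearMap.id ℝ ℝ) s = (1 + h * c) * s := by simp; ring
  rw [this, norm_mul, Real.norm_of_nonneg h4]
  apply le_of_eq; ring

theorem isExpanding_smul_id {c : ℝ} (hc : 0 < c) :
    IsExpanding c (c • ContinuousLinearMap.id ℝ ℝ) := by
  filter_upwards [eventually_pos_lt one_pos] with h hh s
  have h4 : 0 ≤ 1 + h * c := by have := hh.1; positivity
  have : s + h • (c • ContinuousLinearMap.id ℝ ℝ) s = (1 + h * c) * s := by simp; ring
  rw [this, norm_mul, Real.norm_of_nonneg h4]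
  apply le_of_eq; ring

theorem norm_sub_sq_smul_le (A : S →L[ℝ] S) (h : ℝ) (u : S) :
    ‖(u - h • A u) + h • A (u - h • A u) - u‖ ≤ h ^ 2 * ‖A‖ ^ 2 * ‖u‖ := by
  have : (u - h • A u) + h • A (u - h • A u) - u = -(h ^ 2 • A (A u)) := by
    rw [map_sub, map_smul]; module
  rw [this, norm_neg, norm_smul, Real.norm_of_nonneg (sq_nonneg h), mul_assoc]
  gcongr
  calc ‖A (A u)‖ ≤ ‖A‖ * (‖A‖ * ‖u‖) := A.le_opNorm_of_le (A.le_opNorm u)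
    _ = _ := by ring

/-- Reversing time turns expansion into contraction. -/
theorem IsExpanding.neg {α : ℝ} (hα : 0 < α) {A : S →L[ℝ] S} (hA : IsExpanding α A) :
    IsContracting (α / 2) (-A) := by
  set C := ‖A‖ ^ 2 with hC
  have hC0 : 0 ≤ C := by positivity
  filter_upwards [hA, eventually_pos_lt (c := α / (2 * (C + α ^ 2))) (by positivity)] with h h1 h2 u
  have h3 := h1 (u - h • A u)
  have h4 := norm_sub_sq_smul_le A h u
  have h5 := norm_le_insert' ((u - h • A u) + h • A (u - h • A u)) u
  have h6 : u + h • (-A) u = u - h • A u := by simp [sub_eq_add_neg]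
  rw [h6]
  have h7 : h * (2 * (C + α ^ 2)) < α := (lt_div_iff₀ (by positivity)).1 h2.2
  have hh := h2.1
  -- `(1 + α h) (1 - α h / 2) ≥ 1 + C h ^ 2` for small `h`
  have h8 : 1 + h ^ 2 * C ≤ (1 + α * h) * (1 - α / 2 * h) := by
    nlinarith [mul_pos hh hα, mul_nonneg hh.le hC0, mul_pos hh (mul_pos hα hα)]
  have h9 : (1 + α * h) * ‖u - h • A u‖ ≤ (1 + α * h) * ((1 - α / 2 * h) * ‖u‖) := by
    rw [← mul_assoc]
    calc _ ≤ (1 + h ^ 2 * C) * ‖u‖ := by linarith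
      _ ≤ _ := by gcongr
  exact le_of_mul_le_mul_left h9 (by positivity)

/-- Reversing time turns contraction into expansion. -/
theorem IsContracting.neg {α : ℝ} (hα : 0 < α) {A : S →L[ℝ] S} (hA : IsContracting α A) :
    IsExpanding (α / 2) (-A) := by
  set C := ‖A‖ ^ 2 with hC
  have hC0 : 0 ≤ C := by positivity
  filter_upwards [hA, eventually_pos_lt (c := α / (2 * (C + α ^ 2))) (by positivity)] with h h1 h2 u
  have h3 := h1 (u - h • A u)
  have h4 := norm_sub_sq_smul_le A h u
  have h5 := norm_le_insert ((u - h • A u) + h • A (u - h • A u)) u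
  have h6 : u + h • (-A) u = u - h • A u := by simp [sub_eq_add_neg]
  rw [h6]
  have h7 : h * (2 * (C + α ^ 2)) < α := (lt_div_iff₀ (by positivity)).1 h2.2
  have hh := h2.1
  have h10 : 0 < 1 - α * h := by
    have : h * (2 * (C + α ^ 2)) * 1 ≥ h * (2 * α ^ 2) := by nlinarith [mul_nonneg hh.le hC0]
    nlinarith
  have h8 : (1 - α * h) * (1 + α / 2 * h) ≤ 1 - h ^ 2 * C := by
    nlinarith [mul_pos hh hα, mul_nonneg hh.le hC0, mul_pos hh (mul_pos hα hα)]
  have h9 : (1 - α * h) * ((1 + α / 2 * h) * ‖u‖) ≤ (1 - α * h) * ‖u - h • A u‖ := by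
    rw [← mul_assoc]
    calc _ ≤ (1 - h ^ 2 * C) * ‖u‖ := by gcongr
      _ ≤ _ := by linarith
  exact le_of_mul_le_mul_left h9 h10

theorem IsExpanding.sub_smul_injective {α ν : ℝ} (hα : 0 < α) (hν : ν < 0) {A : S →L[ℝ] S}
    (hA : IsExpanding α A) : Function.Injective (A - ν • ContinuousLinearMap.id ℝ S) := by
  rw [injective_iff_map_eq_zero]
  intro u hu
  have hu' : A u = ν • u := by simpa [sub_eq_zero] using hu
  obtain ⟨h, h1, h2⟩ := (hA.and (eventually_pos_lt (c := (-ν)⁻¹) (by simpa using hν))).exists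
  have h3 := h1 u
  have h4 : u + h • A u = (1 + h * ν) • u := by rw [hu']; module
  have h5 : 0 ≤ 1 + h * ν := by
    have := mul_lt_mul_of_pos_left h2.2 (neg_pos.2 hν)
    rw [mul_inv_cancel₀ (neg_pos.2 hν).ne'] at this
    linarith
  rw [h4, norm_smul, Real.norm_of_nonneg h5] at h3
  by_contra hne
  have h6 := le_of_mul_le_mul_right h3 (norm_pos_iff.2 hne)
  nlinarith [mul_pos hα h2.1, mul_pos h2.1 (neg_pos.2 hν)]

end

/-- A linear map is hyperbolic: it is conjugate to the product of a contracting and of an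
expanding map in suitable norms; under the condition `P` there is no contracting part. -/
def HasSplitting {V : Type*} [AddCommGroup V] [Module ℝ V] (A : V →ₗ[ℝ] V) (P : Prop) : Prop :=
  ∃ (S U : Type) (_ : NormedAddCommGroup S) (_ : NormedSpace ℝ S) (_ : FiniteDimensional ℝ S)
    (_ : NormedAddCommGroup U) (_ : NormedSpace ℝ U) (_ : FiniteDimensional ℝ U)
    (e : V ≃ₗ[ℝ] S × U) (As : S →L[ℝ] S) (Au : U →L[ℝ] U) (α : ℝ), 0 < α ∧
    IsContracting α As ∧ IsExpanding α Au ∧ (∀ v, e (A v) = (As (e v).1, Au (e v).2)) ∧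
    (P → Subsingleton S)

section

variable {V W : Type*} [AddCommGroup V] [Module ℝ V] [AddCommGroup W] [Module ℝ W] {P : Prop}

theorem HasSplitting.conj {A : V →ₗ[ℝ] V} {B : W →ₗ[ℝ] W} (hB : HasSplitting B P) (f : V ≃ₗ[ℝ] W)
    (hf : ∀ v, f (A v) = B (f v)) : HasSplitting A P := by
  obtain ⟨S, U, _, _, _, _, _, _, e, As, Au, α, hα, hAs, hAu, he, hS⟩ := hB
  exact ⟨S, U, _, _, ‹_›, _, _, ‹_›, f.trans e, As, Au, α, hα, hAs, hAu, fun v => by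
    simp [hf, he], hS⟩

theorem HasSplitting.prodMap {A : V →ₗ[ℝ] V} {B : W →ₗ[ℝ] W} (hA : HasSplitting A P)
    (hB : HasSplitting B P) : HasSplitting (A.prodMap B) P := by
  obtain ⟨S, U, _, _, _, _, _, _, e, As, Au, α, hα, hAs, hAu, he, hS⟩ := hA
  obtain ⟨S', U', _, _, _, _, _, _, e', As', Au', α', hα', hAs', hAu', he', hS'⟩ := hB
  refine ⟨S × S', U × U', inferInstance, inferInstance, inferInstance, inferInstance, inferInstance,
    inferInstance, (e.prodCongr e').trans (LinearEquiv.prodProdProdComm ℝ S U S' U'),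
    As.prodMap As', Au.prodMap Au', min α α', lt_min hα hα',
    (hAs.mono (min_le_left _ _)).prodMap (hAs'.mono (min_le_right _ _)) (lt_min hα hα'),
    (hAu.mono (min_le_left _ _)).prodMap (hAu'.mono (min_le_right _ _)), fun v => ?_, fun h => ?_⟩
  · simp [he, he']
  · have := hS h
    have := hS' h
    infer_instance

theorem hasSplitting_of_subsingleton [Subsingleton V] (A : V →ₗ[ℝ] V) : HasSplitting A P :=
  ⟨PUnit, PUnit, inferInstance, inferInstance, inferInstance, inferInstance, inferInstance,
    inferInstance, LinearEquiv.ofSubsingleton V (PUnit × PUnit), 0, 0, 1, one_pos,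
    isContracting_of_subsingleton _ _,
    isExpanding_of_subsingleton _ _, fun _ => Subsingleton.elim _ _, fun _ => inferInstance⟩

theorem hasSplitting_pi {N : ℕ} (A : Fin N → V →ₗ[ℝ] V) (hA : ∀ i, HasSplitting (A i) P) :
    HasSplitting (LinearMap.pi fun i => A i ∘ₗ LinearMap.proj i : (Fin N → V) →ₗ[ℝ] (Fin N → V))
      P := by
  induction N with
  | zero => exact hasSplitting_of_subsingleton _
  | succ N ih =>
    refine ((hA 0).prodMap (ih (fun i => A i.succ) fun i => hA i.succ)).conj
      (Fin.consLinearEquiv ℝ fun _ : Fin (N + 1) => V).symm fun v => ?_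
    rw [LinearEquiv.symm_apply_eq]
    ext i
    refine Fin.cases ?_ (fun j => ?_) i <;> simp [Fin.consLinearEquiv, Fin.tail]

theorem hasSplitting_smul {c : ℝ} (hc : c ≠ 0) (hP : P → 0 < c) :
    HasSplitting (c • LinearMap.id : ℝ →ₗ[ℝ] ℝ) P := by
  rcases hc.lt_or_gt with h | h
  · exact ⟨ℝ, PUnit, inferInstance, inferInstance, inferInstance, inferInstance, inferInstance,
      inferInstance, LinearEquiv.prodUnique.symm, c • ContinuousLinearMap.id ℝ ℝ, 0, -c, by linarith,
      isContracting_smul_id h, isExpanding_of_subsingleton _ _, fun v => by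
        simp [LinearEquiv.prodUnique], fun h' => by linarith [hP h']⟩
  · exact ⟨PUnit, ℝ, inferInstance, inferInstance, inferInstance, inferInstance, inferInstance,
      inferInstance, LinearEquiv.uniqueProd.symm, 0, c • ContinuousLinearMap.id ℝ ℝ, c, h,
      isContracting_of_subsingleton _ _, isExpanding_smul_id h, fun v => by
        simp [LinearEquiv.uniqueProd], fun _ => inferInstance⟩

/-- The linear map of `ξ'' = 2 k ξ' - lam ξ` as a first order system. -/
noncomputable def oscillator (k lam : ℝ) : ℝ × ℝ →ₗ[ℝ] ℝ × ℝ where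
  toFun v := (v.2, 2 * k * v.2 - lam * v.1)
  map_add' v w := by simp; ring
  map_smul' c v := by simp; ring

theorem hasSplitting_oscillator_of_neg {k lam : ℝ} (hlam : lam < 0) (hP : ¬ P) :
    HasSplitting (oscillator k lam) P := by
  have hk : 0 ≤ k ^ 2 - lam := by nlinarith [sq_nonneg k]
  set s := √(k ^ 2 - lam) with hs
  have hss : s * s = k ^ 2 - lam := Real.mul_self_sqrt hk
  have hs0 : 0 ≤ s := Real.sqrt_nonneg _
  have hs1 : |k| < s := by
    rw [hs, ← Real.sqrt_sq_eq_abs]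
    exact Real.sqrt_lt_sqrt (sq_nonneg k) (by linarith)
  obtain ⟨hs2, hs3⟩ := abs_lt.1 hs1
  have hs4 : 0 < s := by linarith [abs_nonneg k]
  -- the eigenvectors of the transposed map, with the eigenvalues `k - s < 0 < k + s`
  set e : (ℝ × ℝ) ≃ₗ[ℝ] ℝ × ℝ :=
    { toFun := fun v => (v.2 - (k + s) * v.1, v.2 - (k - s) * v.1)
      map_add' := fun v w => by ext <;> simp <;> ring
      map_smul' := fun c v => by ext <;> simp <;> ring
      invFun := fun w => ((w.2 - w.1) / (2 * s), w.1 + (k + s) * ((w.2 - w.1) / (2 * s)))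
      left_inv := fun v => by ext <;> simp <;> field_simp <;> ring
      right_inv := fun v => by
        ext <;> simp
        field_simp
        ring } with he
  refine ⟨ℝ, ℝ, inferInstance, inferInstance, inferInstance, inferInstance, inferInstance,
    inferInstance, e, (k - s) • ContinuousLinearMap.id ℝ ℝ, (k + s) • ContinuousLinearMap.id ℝ ℝ,
    min (-(k - s)) (k + s), lt_min (by linarith) (by linarith),
    (isContracting_smul_id (by linarith)).mono (min_le_left _ _),
    (isExpanding_smul_id (by linarith)).mono (min_le_right _ _), fun v => ?_, fun h => (hP h).elim⟩
  have h1 : lam = k ^ 2 - s * s := by linarith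
  ext
  · simp [he, oscillator, h1]; ring
  · simp [he, oscillator, h1]; ring

/-- An oscillator with negative damping expands. -/
theorem hasSplitting_oscillator_of_pos {k lam : ℝ} (hk : 0 < k) (hlam : 0 < lam) :
    HasSplitting (oscillator k lam) P := by
  -- the quadratic form `(ω - ε ξ)² + (lam - ε²) ξ²` grows along the flow; the value of `ε` makes
  -- its derivative `Q'` below at least `(ε / 2)` times the form
  set ε := k * lam / (lam + 2 * k ^ 2) with hε
  have hε0 : 0 < ε := by positivity
  have hε1 : ε * (lam + 2 * k ^ 2) = k * lam := by rw [hε]; field_simp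
  have hε2 : ε ≤ k := by
    rw [hε, div_le_iff₀ (by positivity)]
    nlinarith [mul_pos hk (pow_pos hk 2)]
  have hε3 : 2 * ε ^ 2 ≤ lam := by
    have h1 : 2 * ε * ε * (lam + 2 * k ^ 2) ^ 2 = 2 * (k * lam) ^ 2 := by rw [← hε1]; ring
    have h2 : 2 * (k * lam) ^ 2 ≤ lam * (lam + 2 * k ^ 2) ^ 2 := by
      nlinarith [mul_pos hlam (pow_pos hk 4), mul_pos (pow_pos hlam 2) (pow_pos hk 2),
        pow_pos hlam 3]
    have h3 : 0 < (lam + 2 * k ^ 2) ^ 2 := by positivity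
    nlinarith
  set c := √(lam - ε ^ 2) with hc
  have hcc : c * c = lam - ε ^ 2 := Real.mul_self_sqrt (by nlinarith)
  have hc0 : 0 < c := Real.sqrt_pos.2 (by nlinarith)
  set e : (ℝ × ℝ) ≃ₗ[ℝ] ℂ :=
    { toFun := fun v => ⟨v.2 - ε * v.1, c * v.1⟩
      map_add' := fun v w => by apply Complex.ext <;> simp <;> ring
      map_smul' := fun c v => by apply Complex.ext <;> simp <;> ring
      invFun := fun w => (w.im / c, w.re + ε * (w.im / c))
      left_inv := fun v => by ext <;> simp <;> field_simp; ring
      right_inv := fun v => by apply Complex.ext <;> simp; field_simp } with he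
  have hnorm : ∀ v : ℝ × ℝ, ‖e v‖ ^ 2 = (v.2 - ε * v.1) ^ 2 + (lam - ε ^ 2) * v.1 ^ 2 := fun v => by
    rw [← hcc, ← Complex.normSq_eq_norm_sq, Complex.normSq_apply]
    simp [he]; ring
  set A := LinearMap.toContinuousLinearMap (e.toLinearMap ∘ₗ oscillator k lam ∘ₗ e.symm.toLinearMap)
    with hA
  refine ⟨PUnit, ℂ, inferInstance, inferInstance, inferInstance, inferInstance, inferInstance,
    inferInstance, e.trans LinearEquiv.uniqueProd.symm, 0, A, ε / 6,
    by positivity, isContracting_of_subsingleton _ _, ?_, fun v => by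
      simp [LinearEquiv.uniqueProd, hA], fun _ => inferInstance⟩
  filter_upwards [eventually_pos_lt (c := 6 / ε) (by positivity)] with h hh u
  obtain ⟨v, rfl⟩ := e.surjective u
  have h1 : e v + h • A (e v) = e (v + h • oscillator k lam v) := by simp [hA]
  rw [h1]
  have h2 : 0 < h := hh.1
  have h3 : h * ε < 6 := (lt_div_iff₀ hε0).1 hh.2
  refine le_of_sq_le_sq ?_ (norm_nonneg _)
  rw [mul_pow, hnorm, hnorm]
  obtain ⟨ξ, w⟩ := v
  simp only [oscillator, LinearMap.coe_mk, AddHom.coe_mk, Prod.smul_mk, Prod.mk_add_mk, smul_eq_mul]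
  set Q := (w - ε * ξ) ^ 2 + (lam - ε ^ 2) * ξ ^ 2 with hQ
  have hQ0 : 0 ≤ Q := by have : 0 ≤ lam - ε ^ 2 := by nlinarith
                         positivity
  set Q' := (4 * k - 2 * ε) * w ^ 2 - 4 * ε * k * w * ξ + 2 * ε * lam * ξ ^ 2 with hQ'
  have hQ1 : ε / 2 * Q ≤ Q' := by
    have h4 : 0 ≤ lam * (w ^ 2 * (2 * k - 2 * ε) + ε * lam * ξ ^ 2 - 4 * ε * k * w * ξ) := by
      have : lam * (w ^ 2 * (2 * k - 2 * ε) + ε * lam * ξ ^ 2 - 4 * ε * k * w * ξ)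
          = ε * (lam * ξ - 2 * k * w) ^ 2 + 2 * w ^ 2 * (k * lam - ε * (lam + 2 * k ^ 2)) := by ring
      rw [this, hε1, sub_self, mul_zero, add_zero]
      positivity
    have h5 := nonneg_of_mul_nonneg_right h4 hlam
    have h6 : Q ≤ 2 * w ^ 2 + 2 * lam * ξ ^ 2 := by
      nlinarith [sq_nonneg (w + ε * ξ), sq_nonneg ξ]
    have h7 : ε / 2 * (2 * w ^ 2 + 2 * lam * ξ ^ 2) ≤ 2 * k * w ^ 2 + ε * lam * ξ ^ 2 := by
      nlinarith [sq_nonneg w]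
    nlinarith
  have hexp : (w + h * (2 * k * w - lam * ξ) - ε * (ξ + h * w)) ^ 2
      + (lam - ε ^ 2) * (ξ + h * w) ^ 2 = Q + h * Q'
        + h ^ 2 * ((2 * k * w - lam * ξ - ε * w) ^ 2 + (lam - ε ^ 2) * w ^ 2) := by
    rw [hQ, hQ']; ring
  rw [hexp]
  have h8 : 0 ≤ (2 * k * w - lam * ξ - ε * w) ^ 2 + (lam - ε ^ 2) * w ^ 2 := by
    have : 0 ≤ lam - ε ^ 2 := by nlinarith
    positivity
  have h9 : (1 + ε / 6 * h) ^ 2 ≤ 1 + h * (ε / 2) := by nlinarith [mul_pos h2 hε0]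
  calc (1 + ε / 6 * h) ^ 2 * Q ≤ (1 + h * (ε / 2)) * Q := by gcongr
    _ = Q + h * (ε / 2 * Q) := by ring
    _ ≤ Q + h * Q' := by gcongr
    _ ≤ _ := by have := mul_nonneg (sq_nonneg h) h8; linarith

/-- Adjoining one contracted direction `r`, coupled to the given ones: the unstable coordinates
can be decoupled from `r`, and the coupling to the stable ones is made small by rescaling `r`. -/
theorem HasSplitting.triangular {B : W →ₗ[ℝ] W} (hB : HasSplitting B P) {ν : ℝ} (hν : ν < 0)
    (c : W) (A : ℝ × W →ₗ[ℝ] ℝ × W) (hA : ∀ v, A v = (ν * v.1, B v.2 + v.1 • c)) :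
    ∃ (S U : Type) (_ : NormedAddCommGroup S) (_ : NormedSpace ℝ S) (_ : FiniteDimensional ℝ S)
      (_ : NormedAddCommGroup U) (_ : NormedSpace ℝ U) (_ : FiniteDimensional ℝ U)
      (e : (ℝ × W) ≃ₗ[ℝ] (ℝ × S) × U) (As : ℝ × S →L[ℝ] ℝ × S) (Au : U →L[ℝ] U) (α K : ℝ), 0 < α ∧
      0 < K ∧ IsContracting α As ∧ IsExpanding α Au ∧
      (∀ v, e (A v) = (As (e v).1, Au (e v).2)) ∧ (∀ v, (e v).1.1 = K * v.1) ∧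
      (P → Subsingleton S) := by
  obtain ⟨S, U, _, _, _, _, _, _, e, As, Au, α, hα, hAs, hAu, he, hS⟩ := hB
  -- `u - r b` evolves without `r` if `(Au - ν) b = - c_u`, which is solvable as `ν < 0`
  obtain ⟨b, hb⟩ := (LinearMap.injective_iff_surjective
    (f := (Au - ν • ContinuousLinearMap.id ℝ U).toLinearMap)).1 (hAu.sub_smul_injective hα hν)
    (-(e c).2)
  have hb' : Au b - ν • b = -(e c).2 := by simpa using hb
  set K := 1 + 2 * ‖(e c).1‖ / α with hK
  have hK0 : 0 < K := by positivity
  set β := min (α / 2) (-ν) with hβ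
  have hβ0 : 0 < β := lt_min (by positivity) (by linarith)
  set f : (ℝ × W) ≃ₗ[ℝ] (ℝ × S) × U :=
    { toFun := fun v => ((K * v.1, (e v.2).1), (e v.2).2 - v.1 • b)
      map_add' := fun v w => by
        ext
        · simp; ring
        · simp
        · simp; module
      map_smul' := fun c v => by
        ext
        · simp; ring
        · simp
        · simp; module
      invFun := fun w => (w.1.1 / K, e.symm (w.1.2, w.2 + (w.1.1 / K) • b))
      left_inv := fun v => by
        have : K * v.1 / K = v.1 := by field_simp
        simp [this]
      right_inv := fun v => by
        have : K * (v.1.1 / K) = v.1.1 := by field_simp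
        simp [this] } with hf
  set As' : ℝ × S →L[ℝ] ℝ × S :=
    (ν • ContinuousLinearMap.fst ℝ ℝ S).prod (As ∘L ContinuousLinearMap.snd ℝ ℝ S +
      (K⁻¹ • ContinuousLinearMap.fst ℝ ℝ S).smulRight (e c).1) with hAs'
  refine ⟨S, U, _, _, ‹_›, _, _, ‹_›, f, As', Au, β, K, hβ0, hK0, ?_,
    hAu.mono ((min_le_left _ _).trans (by linarith)), fun v => ?_, fun v => rfl, hS⟩
  · have hc : K⁻¹ * ‖(e c).1‖ ≤ α / 2 := by
      rw [inv_mul_le_iff₀ hK0, hK]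
      have : (1 + 2 * ‖(e c).1‖ / α) * (α / 2) = α / 2 + ‖(e c).1‖ := by field_simp
      rw [this]; linarith
    filter_upwards [hAs, eventually_pos_lt (inv_pos.2 hα), isContracting_smul_id hν]
      with h h1 h2 h3 s
    have h4 : 0 ≤ 1 - α * h := by
      have := mul_lt_mul_of_pos_left h2.2 hα
      rw [mul_inv_cancel₀ hα.ne'] at this
      linarith
    have hh := h2.1
    refine norm_prod_le_iff.2 ⟨?_, ?_⟩
    · calc ‖(s + h • As' s).1‖ = ‖s.1 + h • (ν • ContinuousLinearMap.id ℝ ℝ) s.1‖ := by simp [hAs']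
        _ ≤ (1 - -ν * h) * ‖s.1‖ := h3 _
        _ ≤ (1 - β * h) * ‖s.1‖ := by gcongr; exact min_le_right _ _
        _ ≤ _ := by
          refine mul_le_mul_of_nonneg_left (norm_fst_le s) ?_
          have : β * h ≤ α / 2 * h := by gcongr; exact min_le_left _ _
          nlinarith
    · calc ‖(s + h • As' s).2‖ = ‖(s.2 + h • As s.2) + (h * (K⁻¹ * s.1)) • (e c).1‖ := by
            congr 1; simp [hAs']; module
        _ ≤ (1 - α * h) * ‖s.2‖ + h * (K⁻¹ * ‖s.1‖) * ‖(e c).1‖ := by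
            refine (norm_add_le _ _).trans (add_le_add (h1 _) (le_of_eq ?_))
            rw [norm_smul, norm_mul, norm_mul, Real.norm_of_nonneg hh.le,
              Real.norm_of_nonneg (inv_nonneg.2 hK0.le)]
        _ = (1 - α * h) * ‖s.2‖ + h * ‖s.1‖ * (K⁻¹ * ‖(e c).1‖) := by ring
        _ ≤ (1 - α * h) * ‖s‖ + h * ‖s‖ * (α / 2) := by
            gcongr
            · exact norm_snd_le s
            · exact norm_fst_le s
        _ = (1 - α / 2 * h) * ‖s‖ := by ring
        _ ≤ _ := by gcongr; exact min_le_left _ _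
  · have h1 : Au b + (e c).2 = ν • b := by
      rw [sub_eq_iff_eq_add] at hb'
      rw [hb']; abel
    have h2 : K⁻¹ * (K * v.1) = v.1 := by field_simp
    ext
    · simp [hf, hA, hAs']; ring
    · simp [hf, hA, hAs', he, h2]
    · simp only [hf, hA, LinearEquiv.coe_mk, LinearMap.coe_mk, AddHom.coe_mk, map_add, map_smul,
        Prod.snd_add, Prod.smul_snd, he, map_sub, mul_smul]
      have : v.1 • (Au b + (e c).2) = v.1 • ν • b := by rw [h1]
      rw [smul_add, smul_comm] at this
      rw [← this]; abel

end

namespace McGehee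

section Sphere

variable {n : ℕ}

/-! ### The Hessian on the sphere -/

theorem coe_sphereProj {q : Vec n} (hq : ‖q‖ = 1) (u : Vec n) :
    ((sphereTangent q).orthogonalProjectionOnto u : Vec n) = u - inner ℝ q u • q := by
  change (ℝ ∙ q)ᗮ.starProjection u = _
  rw [Submodule.starProjection_orthogonal_val, Submodule.starProjection_singleton]
  simp [hq]

theorem inner_sphereTangent {q : Vec n} (v : sphereTangent q) : inner ℝ q (v : Vec n) = 0 :=
  Submodule.mem_orthogonal_singleton_iff_inner_right.1 v.2

theorem sphereProj_self {q : Vec n} : (sphereTangent q).orthogonalProjectionOnto q = 0 := by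
  rw [Submodule.orthogonalProjectionOnto_eq_zero_iff, Submodule.orthogonal_orthogonal]
  exact Submodule.mem_span_singleton_self q

theorem sphereProj_coe {q : Vec n} (v : sphereTangent q) :
    (sphereTangent q).orthogonalProjectionOnto (v : Vec n) = v := by
  simp

end Sphere

namespace LagrangianSystem

variable {n : ℕ} (L : LagrangianSystem n)

theorem hasFDerivAt_gradient_Ul (x : Vec n) :
    HasFDerivAt (∇ L.Ul) (fderiv ℝ (∇ L.Ul) x) x :=
  ((L.contDiff_gradient_Ul (k := 1)).differentiable one_ne_zero x).hasFDerivAt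

/-- The Hessian on the sphere, in terms of the ambient second derivative. -/
theorem sphereHess_Ul_apply {q : Vec n} (v : sphereTangent q) :
    sphereHess L.Ul q v = (sphereTangent q).orthogonalProjectionOnto (fderiv ℝ (∇ L.Ul) q v)
      - (L.l * L.Ul q) • v := by
  have h1 : HasDerivAt (fun t : ℝ => q + t • (v : Vec n)) (v : Vec n) 0 := by
    simpa using! ((hasDerivAt_id (0 : ℝ)).smul_const (v : Vec n)).const_add q
  have h2 : HasDerivAt (fun t : ℝ => ∇ L.Ul (q + t • (v : Vec n))) (fderiv ℝ (∇ L.Ul) q v) 0 :=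
    (L.hasFDerivAt_gradient_Ul q).comp_hasDerivAt_of_eq (0 : ℝ) h1 (by simp)
  have hd : DifferentiableAt ℝ (sphereGrad L.Ul) q := by
    have := (L.contDiff_gradient_Ul (k := 1)).differentiable one_ne_zero q
    exact this.sub ((this.inner ℝ differentiableAt_id).smul differentiableAt_id)
  have h3 : HasDerivAt (fun t : ℝ => sphereGrad L.Ul (q + t • (v : Vec n)))
      (fderiv ℝ (sphereGrad L.Ul) q v) 0 :=
    hd.hasFDerivAt.comp_hasDerivAt_of_eq (0 : ℝ) h1 (by simp)
  have h4 := h3.unique (h2.fun_sub ((h2.inner ℝ h1).smul h1))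
  simp only [zero_smul, add_zero] at h4
  simp only [sphereHess, LinearMap.comp_apply, Submodule.coe_subtype, ContinuousLinearMap.coe_coe]
  rw [h4, map_sub, map_add, map_smul, map_smul, sphereProj_self, smul_zero, add_zero,
    sphereProj_coe, inner_gradient_Ul_self]

theorem isSymmetric_sphereHess (q : Vec n) : (sphereHess L.Ul q).IsSymmetric := by
  intro v w
  have h : ∀ v w : sphereTangent q, inner ℝ (sphereHess L.Ul q v) w
      = inner ℝ (fderiv ℝ (∇ L.Ul) q v) (w : Vec n) - L.l * L.Ul q * inner ℝ (v : Vec n) w := by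
    intro v w
    rw [sphereHess_Ul_apply, inner_sub_left, Submodule.inner_orthogonalProjectionOnto_eq_of_mem_right,
      inner_smul_left]
    simp
  rw [h, real_inner_comm (sphereHess L.Ul q w) v, h, L.inner_fderiv_gradient_Ul_comm,
    real_inner_comm (w : Vec n) (v : Vec n)]

/-- At a local minimum the Hessian on the sphere is positive semidefinite. -/
theorem inner_sphereHess_nonneg {q : Vec n} (hq : ‖q‖ = 1)
    (hmin : IsLocalMinOn L.Ul (Metric.sphere 0 1) q) (v : sphereTangent q) :
    0 ≤ inner ℝ (sphereHess L.Ul q v) v := by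
  set s := ‖(v : Vec n)‖ ^ 2 with hs
  have hN : ∀ t : ℝ, ‖q + t • (v : Vec n)‖ ^ 2 = 1 + t ^ 2 * s := fun t => by
    rw [norm_add_sq_real, inner_smul_right, inner_sphereTangent, hq, norm_smul, mul_pow,
      Real.norm_eq_abs, sq_abs]
    ring
  have hNpos : ∀ t : ℝ, 0 < 1 + t ^ 2 * s := fun t => by positivity
  -- by homogeneity `U_l` can be compared along the tangent line with its value at `q`
  set w : ℝ → ℝ := fun t => L.Ul (q + t • (v : Vec n)) - (1 + t ^ 2 * s) ^ ((L.l : ℝ) / 2) * L.Ul q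
    with hw
  have h1 : ∀ t : ℝ, HasDerivAt (fun t : ℝ => q + t • (v : Vec n)) (v : Vec n) t := fun t => by
    simpa using! ((hasDerivAt_id t).smul_const (v : Vec n)).const_add q
  set w' : ℝ → ℝ := fun t => inner ℝ (∇ L.Ul (q + t • (v : Vec n))) (v : Vec n)
    - (L.l : ℝ) * s * t * (1 + t ^ 2 * s) ^ ((L.l : ℝ) / 2 - 1) * L.Ul q with hw'
  have hpoly : ∀ t : ℝ, HasDerivAt (fun t : ℝ => 1 + t ^ 2 * s) (2 * t * s) t := fun t => by
    simpa using! ((hasDerivAt_pow 2 t).mul_const s).const_add 1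
  have hd : ∀ t, HasDerivAt w (w' t) t := fun t => by
    have h2 := ((L.contDiff_Ul (k := 1)).differentiable one_ne_zero
      (q + t • (v : Vec n))).hasFDerivAt.comp_hasDerivAt t (h1 t)
    have h3 := ((hpoly t).rpow_const (p := (L.l : ℝ) / 2) (Or.inl (hNpos t).ne')).mul_const (L.Ul q)
    refine (h2.fun_sub h3).congr_deriv ?_
    simp only [hw', inner_gradient_left]
    ring
  have hd2 : HasDerivAt w' (inner ℝ (sphereHess L.Ul q v) v) 0 := by
    have h2 : HasDerivAt (fun t : ℝ => ∇ L.Ul (q + t • (v : Vec n))) (fderiv ℝ (∇ L.Ul) q v) 0 :=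
      (L.hasFDerivAt_gradient_Ul q).comp_hasDerivAt_of_eq (0 : ℝ) (h1 0) (by simp)
    have h3 := (((hasDerivAt_id (0 : ℝ)).const_mul ((L.l : ℝ) * s)).mul
      ((hpoly 0).rpow_const (p := (L.l : ℝ) / 2 - 1) (Or.inl (hNpos 0).ne'))).mul_const (L.Ul q)
    refine ((h2.inner ℝ (hasDerivAt_const (0 : ℝ) (v : Vec n))).fun_sub h3).congr_deriv ?_
    rw [sphereHess_Ul_apply, inner_sub_left, Submodule.inner_orthogonalProjectionOnto_eq_of_mem_right,
      inner_smul_left, real_inner_self_eq_norm_sq, Submodule.norm_coe v |>.symm, ← hs]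
    simp
    ring
  have h0 : w 0 = 0 := by simp [hw]
  have hmin' : ∀ᶠ t in 𝓝 (0 : ℝ), w 0 ≤ w t := by
    have hcont : Tendsto (fun t : ℝ => ‖q + t • (v : Vec n)‖⁻¹ • (q + t • (v : Vec n))) (𝓝 0)
        (𝓝[Metric.sphere 0 1] q) := by
      refine tendsto_nhdsWithin_iff.2 ⟨?_, Eventually.of_forall fun t => ?_⟩
      · have h2 : ContinuousAt (fun t : ℝ => ‖q + t • (v : Vec n)‖⁻¹ • (q + t • (v : Vec n))) 0 := by
          refine ContinuousAt.smul (ContinuousAt.inv₀ (f := fun t : ℝ => ‖q + t • (v : Vec n)‖)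
            (by fun_prop) (by simp [hq])) (by fun_prop)
        simpa [ContinuousAt, hq] using h2
      · have h2 : ‖q + t • (v : Vec n)‖ ≠ 0 := fun h => by
          have := hN t
          rw [h] at this
          have := hNpos t
          norm_num at *
          linarith
        rw [mem_sphere_zero_iff_norm, norm_smul, norm_inv, norm_norm, inv_mul_cancel₀ h2]
    filter_upwards [hcont.eventually hmin] with t ht
    set x := q + t • (v : Vec n) with hx
    have hx2 := hN t
    have hx0 : 0 < ‖x‖ := by
      rcases (norm_nonneg x).eq_or_lt with h | h
      · rw [← hx, ← h] at hx2
        have := hNpos t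
        norm_num at hx2
        linarith
      · exact h
    have h2 : L.Ul x = ‖x‖ ^ L.l * L.Ul (‖x‖⁻¹ • x) := by
      rw [L.Ul_smul, ← mul_assoc, ← mul_pow, mul_inv_cancel₀ hx0.ne', one_pow, one_mul]
    have h3 : (1 + t ^ 2 * s) ^ ((L.l : ℝ) / 2) = ‖x‖ ^ L.l := by
      rw [← hx2, ← Real.rpow_natCast, ← Real.rpow_mul hx0.le, ← Real.rpow_natCast]
      congr 1
      push_cast
      ring
    rw [h0, hw]
    simp only
    rw [← hx, h2, h3, ← mul_sub]
    exact mul_nonneg (by positivity) (sub_nonneg.2 ht)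
  -- a negative second derivative would make `0` a local maximum of `w` as well, and `w` constant
  by_contra! hneg
  have hder : deriv w = w' := funext fun t => (hd t).deriv
  have hw'0 : w' 0 = 0 := by
    rw [← hder]
    exact IsLocalMin.deriv_eq_zero hmin'
  have hmax := isLocalMax_of_deriv_deriv_neg (f := w) (x₀ := 0)
    (by rw [hder, hd2.deriv]; exact hneg)
    (by rw [hder, hw'0]) (hd 0).continuousAt
  have hconst : w =ᶠ[𝓝 0] fun _ => 0 := by
    filter_upwards [hmin', hmax] with t h1 h2
    rw [← h0]
    exact le_antisymm h2 h1
  have h5 : w' =ᶠ[𝓝 0] fun _ => 0 := by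
    rw [← hder]
    simpa using hconst.deriv
  have h6 := hd2.unique ((hasDerivAt_const (0 : ℝ) (0 : ℝ)).congr_of_eventuallyEq h5)
  linarith

end LagrangianSystem
end McGehee

namespace McGehee
namespace LagrangianSystem

variable {n : ℕ} (L : LagrangianSystem n)

/-! ### Fixed points -/

theorem field_of_fst_eq_zero (hmag : L.WeakMagnetism) {ζ : Amb n} (h : ζ.1 = 0) :
    L.field ζ = L.boundaryField ζ := by
  rw [field_eq, L.fieldRemainder_eq_zero hmag h]
  exact add_zero _

/-- On the boundary, the equilibria are the points `(0, q, ν q)` with `∇U_l(q) = -(l/2) ν² q`. -/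
theorem field_eq_zero_iff (hmag : L.WeakMagnetism) {q y : Vec n} (hq : ‖q‖ = 1) :
    L.field (0, q, y) = 0 ↔
      y = (inner ℝ q y : ℝ) • q ∧ ∇ L.Ul q = (-((L.l : ℝ) / 2 * (inner ℝ q y) ^ 2)) • q := by
  rw [L.field_of_fst_eq_zero hmag rfl]
  simp only [boundaryField, Prod.ext_iff, Prod.fst_zero, Prod.snd_zero, mul_zero, true_and,
    sub_eq_zero]
  refine and_congr_right fun h => ?_
  rw [h]
  have : inner ℝ q ((inner ℝ q y : ℝ) • q) = (inner ℝ q y : ℝ) := by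
    rw [inner_smul_right, real_inner_self_eq_norm_sq, hq]; ring
  rw [this, neg_eq_iff_eq_neg, smul_smul, neg_smul]
  ring_nf

/-- By Euler's identity the equilibria have zero energy. -/
theorem Ul_eq_of_fixed {q : Vec n} (hq : ‖q‖ = 1) {ν : ℝ}
    (h : ∇ L.Ul q = (-((L.l : ℝ) / 2 * ν ^ 2)) • q) : L.Ul q = -ν ^ 2 / 2 := by
  have h1 := L.inner_gradient_Ul_self q
  rw [h, inner_smul_left, real_inner_self_eq_norm_sq, hq] at h1
  have hl : (0 : ℝ) < L.l := by exact_mod_cast L.one_le_l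
  simp only [conj_trivial] at h1
  have : L.l * (L.Ul q + ν ^ 2 / 2) = 0 := by linarith
  rcases mul_eq_zero.1 this with h2 | h2
  · exact absurd h2 hl.ne'
  · linarith

theorem isSphereCritical_of_fixed {q : Vec n} (hq : ‖q‖ = 1) {c : ℝ} (h : ∇ L.Ul q = c • q) :
    IsSphereCritical L.Ul q := by
  refine ⟨hq, ?_⟩
  rw [sphereGrad, h, inner_smul_left, real_inner_self_eq_norm_sq, hq]
  simp

/-- The conditions under which `(0, q, ν q)` is an equilibrium of the boundary flow with `ν ≠ 0`. -/
structure IsFixed (q : Vec n) (ν : ℝ) : Prop where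
  norm_eq : ‖q‖ = 1
  gradient_eq : ∇ L.Ul q = (-((L.l : ℝ) / 2 * ν ^ 2)) • q
  ne_zero : ν ≠ 0

variable {L} {q : Vec n} {ν : ℝ}

theorem IsFixed.Ul_eq (h : L.IsFixed q ν) : L.Ul q = -ν ^ 2 / 2 :=
  L.Ul_eq_of_fixed h.norm_eq h.gradient_eq

theorem IsFixed.isSphereCritical (h : L.IsFixed q ν) : IsSphereCritical L.Ul q :=
  L.isSphereCritical_of_fixed h.norm_eq h.gradient_eq

theorem IsFixed.inner_smul (h : L.IsFixed q ν) : inner ℝ q (ν • q) = ν := by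
  rw [inner_smul_right, real_inner_self_eq_norm_sq, h.norm_eq]; ring

theorem IsFixed.field_eq_zero (hmag : L.WeakMagnetism) (h : L.IsFixed q ν) :
    L.field (0, q, ν • q) = 0 := by
  rw [L.field_eq_zero_iff hmag h.norm_eq, h.inner_smul]
  exact ⟨rfl, h.gradient_eq⟩

theorem isFixed_of_field_eq_zero (hmag : L.WeakMagnetism) (hreg : IsSphereRegularValue L.Ul 0)
    {ζ : Amb n} (hζ : ζ ∈ L.bdry) (h : L.field ζ = 0) :
    ζ = (0, ζ.2.1, (inner ℝ ζ.2.1 ζ.2.2 : ℝ) • ζ.2.1) ∧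
      L.IsFixed ζ.2.1 (inner ℝ ζ.2.1 ζ.2.2) := by
  obtain ⟨r, q, y⟩ := ζ
  obtain ⟨rfl, hq⟩ : r = 0 ∧ ‖q‖ = 1 := hζ
  obtain ⟨h1, h2⟩ := (L.field_eq_zero_iff hmag hq).1 h
  refine ⟨by simp only; rw [← h1], hq, h2, fun h0 => ?_⟩
  refine hreg q (L.isSphereCritical_of_fixed hq h2) ?_
  rw [L.Ul_eq_of_fixed hq h2]
  simp only at h0
  rw [h0]; simp

theorem rescaledEnergy_of_fst_eq_zero {ζ : Amb n} (h : ζ.1 = 0) :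
    L.rescaledEnergy ζ = ‖ζ.2.2‖ ^ 2 / 2 + L.Ul ζ.2.1 := by
  rw [rescaledEnergy, if_pos h]

theorem IsFixed.rescaledEnergy_eq (h : L.IsFixed q ν) : L.rescaledEnergy (0, q, ν • q) = 0 := by
  rw [rescaledEnergy_of_fst_eq_zero rfl, h.Ul_eq, norm_smul, h.norm_eq, mul_one, Real.norm_eq_abs,
    sq_abs]
  ring

theorem IsFixed.mem_fixedPoints (hmag : L.WeakMagnetism) (h : L.IsFixed q ν) :
    (0, q, ν • q) ∈ L.fixedPoints L.bdryZero :=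
  ⟨⟨⟨rfl, h.norm_eq⟩, h.rescaledEnergy_eq⟩, h.field_eq_zero hmag⟩

theorem isFixed_of_mem_fixedPoints (hmag : L.WeakMagnetism) (hreg : IsSphereRegularValue L.Ul 0)
    (h : (0, q, ν • q) ∈ L.fixedPoints L.bdryZero) : L.IsFixed q ν := by
  have h1 := (isFixed_of_field_eq_zero hmag hreg h.1.1 h.2).2
  have hq : ‖q‖ = 1 := h.1.1.2
  simpa [inner_smul_right, hq] using h1

theorem fixedPoints_bdryLE (hmag : L.WeakMagnetism) (hreg : IsSphereRegularValue L.Ul 0) :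
    L.fixedPoints L.bdryLE = L.fixedPoints L.bdryZero := by
  refine Subset.antisymm (fun ζ hζ => ?_) fun ζ hζ => ⟨⟨hζ.1.1, hζ.1.2.le⟩, hζ.2⟩
  obtain ⟨h1, h2⟩ := isFixed_of_field_eq_zero hmag hreg hζ.1.1 hζ.2
  rw [h1]
  exact h2.mem_fixedPoints hmag

/-! ### Linearization at the fixed points -/

/-- The derivative at a boundary point of the terms that vanish on the boundary. -/
noncomputable def couplingVector (L : LagrangianSystem n) (ζ : Amb n) : Vec n :=
  fderiv ℝ L.fieldRemainder ζ (1, 0, 0)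

theorem differentiableAt_fieldRemainder (hmag : L.WeakMagnetism) {ζ : Amb n} (hζ : ζ ∈ L.domain) :
    DifferentiableAt ℝ L.fieldRemainder ζ :=
  ((L.contDiffOn_fieldRemainder hmag).contDiffAt (L.isOpen_domain.mem_nhds hζ)).differentiableAt
    one_ne_zero

theorem fderiv_fieldRemainder (hmag : L.WeakMagnetism) {ζ : Amb n} (h : ζ.1 = 0) (v : Amb n) :
    fderiv ℝ L.fieldRemainder ζ v = v.1 • L.couplingVector ζ := by
  have hd := (L.differentiableAt_fieldRemainder hmag (L.mem_domain_of_fst_eq_zero h)).hasFDerivAt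
  have hline : HasDerivAt (fun t : ℝ => ζ + t • ((0, v.2) : Amb n)) (0, v.2) 0 := by
    simpa using! ((hasDerivAt_id (0 : ℝ)).smul_const ((0, v.2) : Amb n)).const_add ζ
  have h1 := hd.comp_hasDerivAt_of_eq (0 : ℝ) hline (by simp)
  have h2 : L.fieldRemainder ∘ (fun t : ℝ => ζ + t • ((0, v.2) : Amb n)) = fun _ => 0 :=
    funext fun t => L.fieldRemainder_eq_zero hmag (by simp [h])
  rw [h2] at h1
  have h3 : fderiv ℝ L.fieldRemainder ζ (0, v.2) = 0 := h1.unique (hasDerivAt_const _ _)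
  have h4 : v = v.1 • ((1, 0, 0) : Amb n) + (0, v.2) := by ext <;> simp
  conv_lhs => rw [h4]
  rw [map_add, map_smul, h3, add_zero, couplingVector]

theorem hasStrictFDerivAt_field (hmag : L.WeakMagnetism) {ζ : Amb n} (hζ : ζ ∈ L.domain) :
    HasStrictFDerivAt L.field (fderiv ℝ L.field ζ) ζ :=
  ((L.contDiffOn_field hmag).contDiffAt (L.isOpen_domain.mem_nhds hζ)).hasStrictFDerivAt
    one_ne_zero

theorem IsFixed.fderiv_field_apply (hmag : L.WeakMagnetism) (h : L.IsFixed q ν) (v : Amb n) :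
    fderiv ℝ L.field (0, q, ν • q) v =
      (ν * v.1, v.2.2 - (ν * inner ℝ q v.2.1 + inner ℝ q v.2.2) • q - ν • v.2.1,
        -(fderiv ℝ (∇ L.Ul) q v.2.1)
          - ((L.l : ℝ) / 2) • ((ν * inner ℝ q v.2.1 + inner ℝ q v.2.2) • ν • q + ν • v.2.2)
          + v.1 • L.couplingVector (0, q, ν • q)) := by
  have hd := (hasStrictFDerivAt_field hmag (L.mem_domain_of_fst_eq_zero
    (ζ := (0, q, ν • q)) rfl)).hasFDerivAt
  have hdR := (L.differentiableAt_fieldRemainder hmag (L.mem_domain_of_fst_eq_zero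
    (ζ := (0, q, ν • q)) rfl)).hasFDerivAt
  have hline : HasDerivAt (fun t : ℝ => ((0, q, ν • q) : Amb n) + t • v) v 0 := by
    simpa using! ((hasDerivAt_id (0 : ℝ)).smul_const v).const_add ((0, q, ν • q) : Amb n)
  have h1 := hd.comp_hasDerivAt_of_eq (0 : ℝ) hline (by simp)
  have hR := hdR.comp_hasDerivAt_of_eq (0 : ℝ) hline (by simp)
  rw [fderiv_fieldRemainder hmag rfl] at hR
  have hr : HasDerivAt (fun t : ℝ => t * v.1) v.1 0 := by
    simpa using! (hasDerivAt_id (0 : ℝ)).mul_const v.1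
  have hq : HasDerivAt (fun t : ℝ => q + t • v.2.1) v.2.1 0 := by
    simpa using! ((hasDerivAt_id (0 : ℝ)).smul_const v.2.1).const_add q
  have hy : HasDerivAt (fun t : ℝ => ν • q + t • v.2.2) v.2.2 0 := by
    simpa using! ((hasDerivAt_id (0 : ℝ)).smul_const v.2.2).const_add (ν • q)
  have hi := hq.inner ℝ hy
  have hg := (L.hasFDerivAt_gradient_Ul q).comp_hasDerivAt_of_eq (0 : ℝ) hq (by simp)
  have h2 := (hi.fun_mul hr).prodMk ((hy.fun_sub (hi.fun_smul hq)).prodMk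
    ((hg.fun_neg.fun_sub ((hi.const_mul ((L.l : ℝ) / 2)).fun_smul hy)).fun_add hR))
  refine (h1.congr_of_eventuallyEq (Eventually.of_forall fun t => ?_)).unique h2 |>.trans ?_
  · simp only [Function.comp_apply]
    rw [field_eq]
    simp [boundaryField]
  · have h5 : inner ℝ v.2.1 q = (inner ℝ q v.2.1 : ℝ) := real_inner_comm _ _
    have h6 : inner ℝ q q = (1 : ℝ) := by rw [real_inner_self_eq_norm_sq, h.norm_eq]; norm_num
    simp only [zero_smul, add_zero, inner_smul_right, h5, h6]
    refine Prod.ext ?_ (Prod.ext ?_ ?_)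
    · simp
    · simp only [mul_one]; module
    · simp only [mul_one]; module

end LagrangianSystem
end McGehee

namespace McGehee

variable {n : ℕ}

/-- Linear coordinates on the ambient space, adapted to the linearization at `(0, q, ν q)`: `r`,
the radial parts of `q` and `y`, and the tangential parts of `q` and `q'`. -/
noncomputable def adaptedCoord {q : Vec n} (hq : ‖q‖ = 1) (κ ν : ℝ) :
    Amb n ≃ₗ[ℝ] ℝ × ((ℝ × ℝ) × (sphereTangent q × sphereTangent q)) where
  toFun v := (v.1, (inner ℝ q v.2.1, inner ℝ q v.2.2 - κ * inner ℝ q v.2.1),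
    ((sphereTangent q).orthogonalProjectionOnto v.2.1,
      (sphereTangent q).orthogonalProjectionOnto v.2.2
        - ν • (sphereTangent q).orthogonalProjectionOnto v.2.1))
  map_add' v w := by
    simp only [Prod.fst_add, Prod.snd_add, inner_add_right, map_add, Prod.mk_add_mk]
    congr 4
    · ring
    · rw [smul_add]; abel
  map_smul' c v := by
    simp only [Prod.smul_fst, Prod.smul_snd, inner_smul_right, map_smul, RingHom.id_apply,
      Prod.smul_mk, smul_eq_mul, smul_sub]
    congr 4
    · ring
    · rw [smul_comm]
  invFun x := (x.1, x.2.1.1 • q + x.2.2.1,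
    (x.2.1.2 + κ * x.2.1.1) • q + x.2.2.2 + ν • (x.2.2.1 : Vec n))
  left_inv v := by
    refine Prod.ext rfl (Prod.ext ?_ ?_)
    · simp only [coe_sphereProj hq]; abel
    · simp only [Submodule.coe_sub, Submodule.coe_smul, coe_sphereProj hq]; module
  right_inv x := by
    simp [inner_add_right, inner_smul_right, inner_sphereTangent, hq, sphereProj_self]

/-- The first order system of `ξ'' = 2 k ξ' - H ξ`, the tangential part of the linearization. -/
noncomputable def tangentialBlock {T : Type*} [AddCommGroup T] [Module ℝ T] (k : ℝ)
    (H : T →ₗ[ℝ] T) : T × T →ₗ[ℝ] T × T :=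
  (LinearMap.snd ℝ T T).prod ((2 * k) • LinearMap.snd ℝ T T - H ∘ₗ LinearMap.fst ℝ T T)

theorem tangentialBlock_apply {T : Type*} [AddCommGroup T] [Module ℝ T] (k : ℝ)
    (H : T →ₗ[ℝ] T) (v : T × T) : tangentialBlock k H v = (v.2, (2 * k) • v.2 - H v.1) := rfl

namespace LagrangianSystem

variable {L : LagrangianSystem n} {q : Vec n} {ν : ℝ}

/-- The linearization in adapted coordinates: block diagonal except for the coupling to `r`. -/
theorem IsFixed.adaptedCoord_fderiv (hmag : L.WeakMagnetism) (h : L.IsFixed q ν) (v : Amb n) :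
    adaptedCoord h.norm_eq (L.l / 2 * ν) ν (fderiv ℝ L.field (0, q, ν • q) v) =
      let x := adaptedCoord h.norm_eq (L.l / 2 * ν) ν v
      (ν * x.1, (-(2 * ν) * x.2.1.1, -(L.l * ν) * x.2.1.2 +
          x.1 * inner ℝ q (L.couplingVector (0, q, ν • q))),
        tangentialBlock (-(ν * (L.l / 2 + 1)) / 2) (sphereHess L.Ul q) x.2.2 +
          x.1 • (0, (sphereTangent q).orthogonalProjectionOnto
            (L.couplingVector (0, q, ν • q)))) := by
  have hq := h.norm_eq
  set c := L.couplingVector (0, q, ν • q) with hc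
  have h6 : inner ℝ q q = (1 : ℝ) := by rw [real_inner_self_eq_norm_sq, hq]; norm_num
  set P := (sphereTangent q).orthogonalProjectionOnto with hP
  obtain ⟨r, u, w⟩ := v
  have hu : u = (inner ℝ q u : ℝ) • q + (P u : Vec n) := by rw [coe_sphereProj hq]; abel
  have hDq : fderiv ℝ (∇ L.Ul) q q = (-((L.l - 1) * (L.l / 2) * ν ^ 2)) • q := by
    rw [L.fderiv_gradient_Ul_self, h.gradient_eq, smul_smul]
    congr 1; ring
  have hDu : fderiv ℝ (∇ L.Ul) q u = (-((L.l - 1) * (L.l / 2) * ν ^ 2) * inner ℝ q u) • q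
      + fderiv ℝ (∇ L.Ul) q (P u : Vec n) := by
    conv_lhs => rw [hu]
    rw [map_add, map_smul, hDq, smul_smul]
    congr 2; ring
  have hqD : inner ℝ q (fderiv ℝ (∇ L.Ul) q (P u : Vec n)) = (0 : ℝ) := by
    rw [real_inner_comm, L.inner_fderiv_gradient_Ul_comm, hDq, inner_smul_left,
      inner_sphereTangent, mul_zero]
  have hH : P (fderiv ℝ (∇ L.Ul) q (P u : Vec n))
      = sphereHess L.Ul q (P u) - (L.l / 2 * ν ^ 2) • P u := by
    rw [L.sphereHess_Ul_apply, h.Ul_eq]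
    module
  have hPq : P q = 0 := sphereProj_self
  rw [h.fderiv_field_apply hmag]
  simp only [adaptedCoord, LinearEquiv.coe_mk, LinearMap.coe_mk, AddHom.coe_mk,
    tangentialBlock_apply]
  rw [← hP, ← hc, hDu]
  refine Prod.ext rfl (Prod.ext (Prod.ext ?_ ?_) (Prod.ext ?_ ?_))
  · simp only [inner_sub_right, inner_smul_right, h6]
    ring
  · simp only [inner_sub_right, inner_smul_right, inner_add_right, inner_neg_right, h6, hqD]
    ring
  · simp [hPq]
  · simp only [map_sub, map_add, map_neg, map_smul, hH, hPq, Prod.snd_add,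
      Prod.smul_snd, smul_zero, zero_add]
    module

/-- The coordinates with respect to an eigenbasis of the Hessian turn the tangential block into a
product of oscillators. -/
theorem exists_eigenCoord (L : LagrangianSystem n) (q : Vec n) :
    ∃ (N : ℕ) (lam : Fin N → ℝ) (f : (sphereTangent q × sphereTangent q) ≃ₗ[ℝ] (Fin N → ℝ × ℝ)),
      (∀ k v i, f (tangentialBlock k (sphereHess L.Ul q) v) i = oscillator k (lam i) (f v i)) ∧
      (∀ i, ∃ v : sphereTangent q, v ≠ 0 ∧ sphereHess L.Ul q v = lam i • v) ∧
      (sphereHess L.Ul q).charpoly = ∏ i, (Polynomial.X - Polynomial.C (lam i)) := by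
  have hs := L.isSymmetric_sphereHess q
  set b := hs.eigenvectorBasis rfl with hb
  have hrepr : ∀ v i, b.repr (sphereHess L.Ul q v) i = hs.eigenvalues rfl i * b.repr v i :=
    fun v i => hs.eigenvectorBasis_apply_self_apply rfl v i
  refine ⟨_, hs.eigenvalues rfl,
    { toFun := fun v i => (b.repr v.1 i, b.repr v.2 i)
      map_add' := fun v w => by ext i <;> simp
      map_smul' := fun c v => by ext i <;> simp
      invFun := fun x => (b.repr.symm (WithLp.toLp 2 fun i => (x i).1),
        b.repr.symm (WithLp.toLp 2 fun i => (x i).2))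
      left_inv := fun v => by
        refine Prod.ext ?_ ?_
        · simp only [LinearIsometryEquiv.symm_apply_eq]
        · simp only [LinearIsometryEquiv.symm_apply_eq]
      right_inv := fun x => by ext i <;> simp }, fun k v i => ?_, fun i => ⟨b i, ?_, ?_⟩, ?_⟩
  · simp [tangentialBlock_apply, oscillator, hrepr]
  · exact b.orthonormal.ne_zero i
  · exact hs.apply_eigenvectorBasis rfl i
  · rw [← LinearMap.charpoly_toMatrix _ b.toBasis]
    have : LinearMap.toMatrix b.toBasis b.toBasis (sphereHess L.Ul q)
        = Matrix.diagonal (hs.eigenvalues rfl) := by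
      ext i j
      rw [LinearMap.toMatrix_apply, Matrix.diagonal_apply]
      have h1 : sphereHess L.Ul q (b j) = (hs.eigenvalues rfl j : ℝ) • b j :=
        hs.apply_eigenvectorBasis rfl j
      simp [h1]
      aesop
    rw [this, Matrix.charpoly_diagonal]

theorem eigenvalue_ne_zero {q : Vec n} (hq : LinearMap.ker (sphereHess L.Ul q) = ⊥) {lam : ℝ}
    (h : ∃ v : sphereTangent q, v ≠ 0 ∧ sphereHess L.Ul q v = lam • v) : lam ≠ 0 := by
  rintro rfl
  obtain ⟨v, hv, hv'⟩ := h
  exact hv ((Submodule.eq_bot_iff _).1 hq v (by simpa using hv'))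

theorem eigenvalue_nonneg {q : Vec n} (hq : ‖q‖ = 1)
    (hmin : IsLocalMinOn L.Ul (Metric.sphere 0 1) q) {lam : ℝ}
    (h : ∃ v : sphereTangent q, v ≠ 0 ∧ sphereHess L.Ul q v = lam • v) : 0 ≤ lam := by
  obtain ⟨v, hv, hv'⟩ := h
  have h1 := L.inner_sphereHess_nonneg hq hmin v
  rw [hv', inner_smul_left, real_inner_self_eq_norm_sq] at h1
  exact nonneg_of_mul_nonneg_left h1 (by positivity)

theorem hasSplitting_tangentialBlock (hq : ‖q‖ = 1)
    (hker : LinearMap.ker (sphereHess L.Ul q) = ⊥) {k : ℝ} (hk : 0 < k) :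
    HasSplitting (tangentialBlock k (sphereHess L.Ul q))
      (IsLocalMinOn L.Ul (Metric.sphere 0 1) q) := by
  obtain ⟨N, lam, f, hf, hlam, -⟩ := exists_eigenCoord L q
  refine (hasSplitting_pi (fun i => oscillator k (lam i)) fun i => ?_).conj f fun v => ?_
  · rcases (eigenvalue_ne_zero hker (hlam i)).lt_or_gt with h | h
    · exact hasSplitting_oscillator_of_neg h fun hmin =>
        (eigenvalue_nonneg hq hmin (hlam i)).not_gt h
    · exact hasSplitting_oscillator_of_pos hk h
  · ext1 i
    rw [hf]
    simp

/-- The splitting of the linearization at a fixed point with `ν < 0`, or, with `s = -1`, of its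
time reversal at a fixed point with `ν > 0`; the first stable coordinate is a multiple of `r`, and
it is the only one at a local minimum. -/
theorem IsFixed.exists_splitting (hmag : L.WeakMagnetism) (h : L.IsFixed q ν)
    (hker : LinearMap.ker (sphereHess L.Ul q) = ⊥) {s : ℝ} (hs : s * s = 1) (hν : s * ν < 0) :
    ∃ (S U : Type) (_ : NormedAddCommGroup S) (_ : NormedSpace ℝ S) (_ : FiniteDimensional ℝ S)
      (_ : NormedAddCommGroup U) (_ : NormedSpace ℝ U) (_ : FiniteDimensional ℝ U)
      (e : Amb n ≃ₗ[ℝ] (ℝ × S) × U) (As : ℝ × S →L[ℝ] ℝ × S) (Au : U →L[ℝ] U) (α K : ℝ), 0 < α ∧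
      0 < K ∧ IsContracting α As ∧ IsExpanding α Au ∧
      (∀ v, e (s • fderiv ℝ L.field (0, q, ν • q) v) = (As (e v).1, Au (e v).2)) ∧
      (∀ v, (e v).1.1 = K * v.1) ∧
      (IsLocalMinOn L.Ul (Metric.sphere 0 1) q → Subsingleton S) := by
  have hl : (0 : ℝ) < L.l := by exact_mod_cast L.one_le_l
  set k := -(ν * ((L.l : ℝ) / 2 + 1)) / 2 with hk
  have hk0 : 0 < s * k := by
    have : 0 < -(s * ν) * ((L.l : ℝ) / 2 + 1) := mul_pos (by linarith) (by positivity)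
    have h2 : s * k = -(s * ν) * ((L.l : ℝ) / 2 + 1) / 2 := by rw [hk]; ring
    rw [h2]; linarith
  set B := ((((s * -(2 * ν)) • LinearMap.id : ℝ →ₗ[ℝ] ℝ).prodMap
    ((s * -(L.l * ν)) • LinearMap.id : ℝ →ₗ[ℝ] ℝ)).prodMap
    (s • tangentialBlock k (sphereHess L.Ul q))) with hB
  -- reversing the velocity turns the reversed block into one with the opposite friction
  have hblock : HasSplitting (s • tangentialBlock k (sphereHess L.Ul q))
      (IsLocalMinOn L.Ul (Metric.sphere 0 1) q) := by
    have hs0 : s ≠ 0 := fun h0 => by simp [h0] at hs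
    refine (hasSplitting_tangentialBlock h.norm_eq hker hk0).conj
      ((LinearEquiv.refl ℝ _).prodCongr (LinearEquiv.smulOfNeZero ℝ _ s hs0)) fun v => ?_
    refine Prod.ext ?_ ?_
    · simp [tangentialBlock_apply]
    · simp only [tangentialBlock_apply, LinearMap.smul_apply, LinearEquiv.prodCongr_apply,
        LinearEquiv.refl_apply, LinearEquiv.smulOfNeZero_apply, Prod.smul_snd, smul_smul, hs,
        one_smul]
      congr 2
      linear_combination (-2 * k) * hs
  have hsplit : HasSplitting B (IsLocalMinOn L.Ul (Metric.sphere 0 1) q) := by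
    have h2 : 0 < s * -(2 * ν) := by linarith
    have h3 : 0 < s * -(L.l * ν) := by nlinarith
    exact ((hasSplitting_smul h2.ne' fun _ => h2).prodMap
      (hasSplitting_smul h3.ne' fun _ => h3)).prodMap hblock
  set E := adaptedCoord h.norm_eq (L.l / 2 * ν) ν with hE
  set c : (ℝ × ℝ) × (sphereTangent q × sphereTangent q) :=
    ((0, inner ℝ q (L.couplingVector (0, q, ν • q))),
      (0, (sphereTangent q).orthogonalProjectionOnto (L.couplingVector (0, q, ν • q)))) with hc
  obtain ⟨S, U, i1, i2, i3, i4, i5, i6, e, As, Au, α, K, hα, hK, hAs, hAu, he, he1, hS⟩ :=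
    hsplit.triangular hν (s • c)
      (s • (E.toLinearMap ∘ₗ (fderiv ℝ L.field (0, q, ν • q)).toLinearMap ∘ₗ E.symm.toLinearMap))
      fun v => by
        have := h.adaptedCoord_fderiv hmag (E.symm v)
        simp only [← hE, LinearEquiv.apply_symm_apply, ← hk] at this
        simp only [LinearMap.smul_apply, LinearMap.comp_apply, LinearEquiv.coe_coe,
          ContinuousLinearMap.coe_coe, this]
        refine Prod.ext ?_ (Prod.ext (Prod.ext ?_ ?_) ?_)
        · simp [mul_assoc]
        · simp [hB, hc]; ring
        · simp [hB, hc]; ring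
        · simp only [hB, hc, Prod.smul_snd, Prod.snd_add, LinearMap.prodMap_apply,
            LinearMap.smul_apply]
          module
  exact ⟨S, U, i1, i2, i3, i4, i5, i6, E.trans e, As, Au, α, K, hα, hK, hAs, hAu,
    fun v => by simpa using! he (E v), fun v => he1 (E v), hS⟩

end LagrangianSystem
end McGehee

namespace McGehee

/-! ### The spectrum of the linearization -/

section Charpoly

open Polynomial

theorem charpoly_of_subsingleton {V : Type*} [AddCommGroup V] [Module ℝ V] [Module.Finite ℝ V]
    [Subsingleton V] (A : V →ₗ[ℝ] V) : A.charpoly = 1 := by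
  refine (Polynomial.Monic.natDegree_eq_zero A.charpoly_monic).1 ?_
  rw [LinearMap.charpoly_natDegree, Module.finrank_zero_of_subsingleton]

theorem charpoly_pi {V : Type*} [AddCommGroup V] [Module ℝ V] [Module.Finite ℝ V] {N : ℕ}
    (A : Fin N → V →ₗ[ℝ] V) :
    (LinearMap.pi fun i => A i ∘ₗ LinearMap.proj i : (Fin N → V) →ₗ[ℝ] (Fin N → V)).charpoly
      = ∏ i, (A i).charpoly := by
  induction N with
  | zero => rw [charpoly_of_subsingleton]; simp
  | succ N ih =>
    rw [Fin.prod_univ_succ, ← ih fun i => A i.succ, ← LinearMap.charpoly_prodMap,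
      ← LinearEquiv.charpoly_conj (Fin.consLinearEquiv ℝ fun _ : Fin (N + 1) => V).symm]
    congr 1

theorem charpoly_eq_of_conj {V W : Type*} [AddCommGroup V] [Module ℝ V] [Module.Finite ℝ V]
    [AddCommGroup W] [Module ℝ W] [Module.Finite ℝ W] {A : V →ₗ[ℝ] V} {B : W →ₗ[ℝ] W}
    (f : V ≃ₗ[ℝ] W) (hf : ∀ v, f (A v) = B (f v)) : A.charpoly = B.charpoly := by
  rw [← LinearEquiv.charpoly_conj f]
  congr 1
  ext w
  simp [LinearEquiv.conj_apply, hf]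

theorem charpoly_triangular {V W : Type*} [AddCommGroup V] [Module ℝ V] [Module.Finite ℝ V]
    [AddCommGroup W] [Module ℝ W] [Module.Finite ℝ W] (A : V →ₗ[ℝ] V) (B : W →ₗ[ℝ] W)
    (C : V →ₗ[ℝ] W) {T : V × W →ₗ[ℝ] V × W} (hT : ∀ v, T v = (A v.1, B v.2 + C v.1)) :
    T.charpoly = A.charpoly * B.charpoly := by
  set b₁ := Module.finBasis ℝ V
  set b₂ := Module.finBasis ℝ W
  rw [← LinearMap.charpoly_toMatrix T (b₁.prod b₂), ← LinearMap.charpoly_toMatrix A b₁,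
    ← LinearMap.charpoly_toMatrix B b₂]
  have : LinearMap.toMatrix (b₁.prod b₂) (b₁.prod b₂) T = Matrix.fromBlocks
      (LinearMap.toMatrix b₁ b₁ A) 0 (LinearMap.toMatrix b₁ b₂ C) (LinearMap.toMatrix b₂ b₂ B) := by
    ext (i | i) (j | j) <;> simp [LinearMap.toMatrix_apply, hT]
  rw [this, Matrix.charpoly_fromBlocks_zero₁₂]

theorem charpoly_smul_id (c : ℝ) : (c • LinearMap.id : ℝ →ₗ[ℝ] ℝ).charpoly = X - C c := by
  rw [← LinearMap.charpoly_toMatrix _ (Module.Basis.singleton Unit ℝ), Matrix.charpoly,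
    Matrix.det_unique, Matrix.charmatrix_apply, LinearMap.toMatrix_apply]
  simp

theorem charpoly_oscillator (k lam : ℝ) :
    (oscillator k lam).charpoly = X ^ 2 - C (2 * k) * X + C lam := by
  rw [← LinearMap.charpoly_toMatrix _ (Module.Basis.finTwoProd ℝ), Matrix.charpoly_fin_two,
    Matrix.trace_fin_two, Matrix.det_fin_two]
  simp only [LinearMap.toMatrix_apply]
  simp [oscillator]

theorem map_charpoly_oscillator (l : ℕ) (ν lam : ℝ) :
    (oscillator (-(ν * (l / 2 + 1)) / 2) lam).charpoly.map (algebraMap ℝ ℂ)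
      = (X - C (boundaryEigenvalue l ν lam 1)) * (X - C (boundaryEigenvalue l ν lam (-1))) := by
  rw [charpoly_oscillator]
  set w : ℂ := ((ν ^ 2 * ((l : ℝ) / 2 + 1) ^ 2 - 4 * lam : ℝ) : ℂ) ^ (1 / 2 : ℂ) with hw
  have hww : w * w = ν ^ 2 * ((l : ℂ) / 2 + 1) ^ 2 - 4 * lam := by
    have := Complex.cpow_nat_inv_pow ((ν ^ 2 * ((l : ℝ) / 2 + 1) ^ 2 - 4 * lam : ℝ) : ℂ)
      (n := 2) two_ne_zero
    rw [← sq, hw, one_div]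
    push_cast at this ⊢
    exact this
  have h1 : boundaryEigenvalue l ν lam 1 + boundaryEigenvalue l ν lam (-1)
      = ((2 * (-(ν * (l / 2 + 1)) / 2) : ℝ) : ℂ) := by
    simp only [boundaryEigenvalue]; push_cast; ring
  have h2 : boundaryEigenvalue l ν lam 1 * boundaryEigenvalue l ν lam (-1) = (lam : ℂ) := by
    simp only [boundaryEigenvalue, ← hw]
    linear_combination (-1 / 4 : ℂ) * hww
  have h3 : (X - C (boundaryEigenvalue l ν lam 1)) * (X - C (boundaryEigenvalue l ν lam (-1)))
      = X ^ 2 - C (boundaryEigenvalue l ν lam 1 + boundaryEigenvalue l ν lam (-1)) * X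
        + C (boundaryEigenvalue l ν lam 1 * boundaryEigenvalue l ν lam (-1)) := by
    simp only [C_add, C_mul]; ring
  rw [h3, h1, h2]
  simp

end Charpoly

namespace LagrangianSystem

variable {n : ℕ} {L : LagrangianSystem n} {q : Vec n} {ν : ℝ}

theorem mem_tangentExtended {v : Amb n} :
    v ∈ L.tangentExtended (0, q, ν • q) ↔ inner ℝ q v.2.1 = (0 : ℝ) := by
  simp [tangentExtended, Submodule.mem_orthogonal_singleton_iff_inner_right]

theorem IsFixed.mapsTo_tangentExtended (hmag : L.WeakMagnetism) (h : L.IsFixed q ν) (v : Amb n)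
    (hv : v ∈ L.tangentExtended (0, q, ν • q)) :
    fderiv ℝ L.field (0, q, ν • q) v ∈ L.tangentExtended (0, q, ν • q) := by
  rw [mem_tangentExtended] at hv ⊢
  have h1 := congrArg (fun x => x.2.1.1) (h.adaptedCoord_fderiv hmag v)
  simpa [adaptedCoord, hv] using h1

theorem IsFixed.injective_fderiv (hmag : L.WeakMagnetism) (h : L.IsFixed q ν)
    (hker : LinearMap.ker (sphereHess L.Ul q) = ⊥) :
    LinearMap.ker (fderiv ℝ L.field (0, q, ν • q)).toLinearMap = ⊥ := by
  rw [Submodule.eq_bot_iff]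
  intro v hv
  have hl : (L.l : ℝ) ≠ 0 := by exact_mod_cast (Nat.one_le_iff_ne_zero.1 L.one_le_l)
  have h1 := h.adaptedCoord_fderiv hmag v
  have hv' : fderiv ℝ L.field (0, q, ν • q) v = 0 := hv
  rw [hv', map_zero] at h1
  have h2 := congrArg (fun x => x.1) h1
  have h3 := congrArg (fun x => x.2.1.1) h1
  have h4 := congrArg (fun x => x.2.1.2) h1
  have h5 := congrArg (fun x => x.2.2.1) h1
  have h6 := congrArg (fun x => x.2.2.2) h1
  set x := adaptedCoord h.norm_eq (L.l / 2 * ν) ν v with hx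
  have g1 : x.1 = 0 := by simpa [h.ne_zero] using h2.symm
  have g2 : x.2.1.1 = 0 := by simpa [h.ne_zero] using h3.symm
  have g3 : x.2.1.2 = 0 := by simpa [h.ne_zero, hl, g1] using h4.symm
  have g4 : x.2.2.2 = 0 := by simpa [tangentialBlock_apply] using h5.symm
  have g5 : x.2.2.1 = 0 := by
    have : sphereHess L.Ul q x.2.2.1 = 0 := by simpa [tangentialBlock_apply, g1, g4] using h6.symm
    exact (Submodule.eq_bot_iff _).1 hker _ this
  have : x = 0 := Prod.ext g1 (Prod.ext (Prod.ext g2 g3) (Prod.ext g5 g4))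
  exact (adaptedCoord h.norm_eq (L.l / 2 * ν) ν).map_eq_zero_iff.1 (hx ▸ this)

/-- Coordinates on the tangent space of the extended McGehee manifold: those of `adaptedCoord`
without the radial part of `q`, which vanishes there. -/
noncomputable def tangentCoord (L : LagrangianSystem n) {q : Vec n} (hq : ‖q‖ = 1) (κ ν : ℝ) :
    L.tangentExtended (0, q, ν • q) ≃ₗ[ℝ] ℝ × (ℝ × (sphereTangent q × sphereTangent q)) where
  toFun v := ((adaptedCoord hq κ ν v).1, (adaptedCoord hq κ ν v).2.1.2, (adaptedCoord hq κ ν v).2.2)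
  map_add' v w := by simp
  map_smul' c v := by simp
  invFun x := ⟨(adaptedCoord hq κ ν).symm (x.1, ((0, x.2.1), x.2.2)), by
    rw [mem_tangentExtended]
    simp [adaptedCoord, inner_sphereTangent]⟩
  left_inv v := by
    have hv := mem_tangentExtended.1 v.2
    refine Subtype.ext ?_
    simp only [LinearEquiv.symm_apply_eq]
    refine Prod.ext rfl (Prod.ext (Prod.ext ?_ rfl) rfl)
    simp [adaptedCoord, hv]
  right_inv x := by simp

/-- The linearization on the tangent space of the extended manifold, where the eigenvalue `-2ν` of
the normal direction is absent. -/
theorem IsFixed.exists_linearization (hmag : L.WeakMagnetism) (h : L.IsFixed q ν)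
    (hker : LinearMap.ker (sphereHess L.Ul q) = ⊥) :
    ∃ T : L.tangentExtended (0, q, ν • q) →ₗ[ℝ] L.tangentExtended (0, q, ν • q),
        L.IsLinearization (0, q, ν • q) T ∧ McGehee.IsHyperbolic T ∧
        T.charpoly.map (algebraMap ℝ ℂ) =
          (Polynomial.X - Polynomial.C (ν : ℂ)) *
          (Polynomial.X - Polynomial.C (-(L.l : ℂ) * ν)) *
          ((McGehee.sphereHess L.Ul q).charpoly.roots.map fun lam =>
            (Polynomial.X - Polynomial.C (McGehee.boundaryEigenvalue L.l ν lam 1)) *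
            (Polynomial.X - Polynomial.C (McGehee.boundaryEigenvalue L.l ν lam (-1)))).prod := by
  set D := fderiv ℝ L.field (0, q, ν • q) with hD
  set T := D.toLinearMap.restrict (h.mapsTo_tangentExtended hmag) with hT
  set k := -(ν * ((L.l : ℝ) / 2 + 1)) / 2 with hk
  have hlpos : (0 : ℝ) < L.l := by exact_mod_cast L.one_le_l
  have hk0 : k ≠ 0 := by
    have : ν * ((L.l : ℝ) / 2 + 1) ≠ 0 := mul_ne_zero h.ne_zero (by positivity)
    rw [hk]
    simpa using this
  obtain ⟨N, lam, f, hf, hlam, hcharH⟩ := exists_eigenCoord L q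
  set c := L.couplingVector (0, q, ν • q) with hc
  have hTchar : T.charpoly = (Polynomial.X - Polynomial.C ν) *
      (Polynomial.X - Polynomial.C (-(L.l * ν))) * ∏ i, (oscillator k (lam i)).charpoly := by
    set E := L.tangentCoord h.norm_eq (L.l / 2 * ν) ν with hE
    set B := ((-(L.l * ν)) • LinearMap.id : ℝ →ₗ[ℝ] ℝ).prodMap
      (tangentialBlock k (sphereHess L.Ul q)) with hB
    have h1 : T.charpoly = (ν • LinearMap.id : ℝ →ₗ[ℝ] ℝ).charpoly * B.charpoly := by
      set M : ℝ × (ℝ × (sphereTangent q × sphereTangent q)) →ₗ[ℝ] _ :=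
        ((ν • LinearMap.id : ℝ →ₗ[ℝ] ℝ) ∘ₗ LinearMap.fst ℝ _ _).prod
        (B ∘ₗ LinearMap.snd ℝ _ _ + (LinearMap.toSpanSingleton ℝ _
          ((inner ℝ q c, (0, (sphereTangent q).orthogonalProjectionOnto c)) :
            ℝ × (sphereTangent q × sphereTangent q))) ∘ₗ LinearMap.fst ℝ _ _) with hM
      rw [charpoly_eq_of_conj (B := M) E fun v => ?_]
      · exact charpoly_triangular _ _ (LinearMap.toSpanSingleton ℝ _ _) fun v => rfl
      · have := h.adaptedCoord_fderiv hmag (v : Amb n)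
        have h2 : E (T v) = _ := congrArg (fun x => (x.1, x.2.1.2, x.2.2)) this
        rw [h2]
        refine Prod.ext ?_ (Prod.ext ?_ ?_)
        · simp [hM, hE, tangentCoord]
        · simp [hM, hB, hE, tangentCoord, hc]
        · simp [hM, hB, hE, tangentCoord, hc, hk]
    rw [h1, hB, LinearMap.charpoly_prodMap, charpoly_smul_id, charpoly_smul_id, mul_assoc,
      ← charpoly_pi]
    congr 2
    refine charpoly_eq_of_conj f fun v => ?_
    ext1 i
    rw [hf]
    simp
  have hroots : (sphereHess L.Ul q).charpoly.roots = Multiset.map lam Finset.univ.val := by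
    rw [hcharH]
    have := Polynomial.roots_multiset_prod_X_sub_C (Multiset.map lam Finset.univ.val)
    rw [Multiset.map_map] at this
    exact this
  refine ⟨T, ⟨D, (hasStrictFDerivAt_field hmag
    (L.mem_domain_of_fst_eq_zero rfl)).hasFDerivAt.hasFDerivWithinAt, fun v => rfl⟩,
    fun z hz => ?_, ?_⟩
  · rw [hTchar, Polynomial.map_mul, Polynomial.map_mul, Polynomial.map_prod] at hz
    have hz' := Polynomial.IsRoot.def.1 hz
    simp only [Polynomial.eval_mul, Polynomial.eval_prod, mul_eq_zero, Finset.prod_eq_zero_iff,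
      Finset.mem_univ, true_and] at hz'
    rcases hz' with (hz' | hz') | ⟨i, hz'⟩
    · have : z = ν := by simpa [sub_eq_zero] using hz'
      simpa [this] using h.ne_zero
    · have : z = ((-(L.l * ν) : ℝ) : ℂ) := by simpa [sub_eq_zero, add_eq_zero_iff_eq_neg] using hz'
      rw [this, Complex.ofReal_re]
      exact neg_ne_zero.2 (mul_ne_zero hlpos.ne' h.ne_zero)
    -- on the imaginary axis, the imaginary part of `z² - 2 k z + λ` forces `z = 0`, hence `λ = 0`
    · intro hre
      rw [charpoly_oscillator] at hz'
      have h2 : z ^ 2 - 2 * k * z + lam i = 0 := by simpa using hz'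
      have him := congrArg Complex.im h2
      have hre' := congrArg Complex.re h2
      simp [sq, hre, hk0] at him hre'
      simp [him] at hre'
      exact eigenvalue_ne_zero hker (hlam i) hre'
  · rw [hTchar, hroots, Multiset.map_map, Polynomial.map_mul, Polynomial.map_mul,
      Polynomial.map_prod]
    congr 1
    · simp
    · exact Finset.prod_congr rfl fun i _ => map_charpoly_oscillator _ _ _

/-- The fixed points form a compact set; they are isolated, as the linearization is injective. -/
theorem finite_fixedPoints (hmag : L.WeakMagnetism) (hMorse : IsSphereMorse L.Ul)
    (hreg : IsSphereRegularValue L.Ul 0) : (L.fixedPoints L.bdryZero).Finite := by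
  have hclosed : IsClosed (L.fixedPoints L.bdryZero) := by
    have h1 : L.fixedPoints L.bdryZero = {ζ : Amb n | ζ.1 = 0 ∧ ‖ζ.2.1‖ = 1 ∧
        ‖ζ.2.2‖ ^ 2 / 2 + L.Ul ζ.2.1 = 0 ∧ L.boundaryField ζ = 0} := by
      ext ζ
      constructor
      · rintro ⟨⟨⟨h1, h2⟩, h3⟩, h4⟩
        rw [rescaledEnergy_of_fst_eq_zero h1] at h3
        rw [field_of_fst_eq_zero L hmag h1] at h4
        exact ⟨h1, h2, h3, h4⟩
      · rintro ⟨h1, h2, h3, h4⟩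
        rw [← rescaledEnergy_of_fst_eq_zero h1] at h3
        rw [← field_of_fst_eq_zero L hmag h1] at h4
        exact ⟨⟨⟨h1, h2⟩, h3⟩, h4⟩
    rw [h1]
    have hU : Continuous L.Ul := (L.contDiff_Ul (k := 1)).continuous
    have hb := L.contDiff_boundaryField.continuous
    exact (isClosed_eq (by fun_prop) (by fun_prop)).inter ((isClosed_eq (by fun_prop)
      (by fun_prop)).inter ((isClosed_eq (by fun_prop) (by fun_prop)).inter
      (isClosed_eq hb continuous_const)))
  obtain ⟨C, hC⟩ := (isCompact_sphere (0 : Vec n) 1).exists_bound_of_continuousOn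
    (L.contDiff_Ul (k := 1)).continuous.continuousOn
  have hbdd : L.fixedPoints L.bdryZero ⊆ Metric.closedBall 0 (1 + 2 * C) := by
    rintro ⟨r, q, y⟩ ⟨⟨⟨h1, h2⟩, h3⟩, -⟩
    rw [rescaledEnergy_of_fst_eq_zero h1] at h3
    simp only at h1 h2 h3
    have h4 := (abs_le.1 (hC q (by simpa using h2))).1
    have h5 := (norm_nonneg _).trans (hC q (by simpa using h2))
    have h6 : ‖y‖ ≤ 1 + 2 * C := by nlinarith [norm_nonneg y]
    rw [mem_closedBall_zero_iff, Prod.norm_def, Prod.norm_def]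
    simp only [h1, h2, norm_zero, max_le_iff]
    exact ⟨by linarith, by linarith, h6⟩
  have hK := Metric.isCompact_of_isClosed_isBounded hclosed
    (Metric.isBounded_closedBall.subset hbdd)
  by_contra hinf
  obtain ⟨ζ, hζ, hacc⟩ := Set.Infinite.exists_accPt_of_subset_isCompact hinf hK Subset.rfl
  obtain ⟨h1, h2⟩ := isFixed_of_field_eq_zero hmag hreg hζ.1.1 hζ.2
  have hinj := h2.injective_fderiv hmag (hMorse _ h2.isSphereCritical)
  rw [← h1] at hinj
  obtain ⟨K, -, hKL⟩ := LinearMap.exists_antilipschitzWith _ hinj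
  have hd := (hasStrictFDerivAt_field hmag (L.mem_domain_of_fst_eq_zero hζ.1.1.1)).hasFDerivAt
  have hne := hd.eventually_ne (c := 0) ⟨K, hKL⟩
  obtain ⟨z, hz1, hz2⟩ := ((accPt_iff_frequently_nhdsNE.1 hacc).and_eventually hne).exists
  exact hz2 hz1.2

end LagrangianSystem
end McGehee

namespace McGehee

/-! ### Analytic charts -/

section Charts

variable {V W : Type*} [NormedAddCommGroup V] [NormedSpace ℝ V] [FiniteDimensional ℝ V]
  [NormedAddCommGroup W] [NormedSpace ℝ W]

/-- The analytic inverse function theorem, on the set where the derivative is invertible. -/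
theorem exists_analytic_openPartialHomeomorph {Ψ : V → W} (hΨ : ContDiff ℝ ω Ψ) {x : V}
    {A : V ≃L[ℝ] W} (hA : HasFDerivAt Ψ (A : V →L[ℝ] W) x) {O : Set V} (hO : IsOpen O)
    (hx : x ∈ O) :
    ∃ Φ : OpenPartialHomeomorph V W, x ∈ Φ.source ∧ Φ.source ⊆ O ∧ (∀ z, Φ z = Ψ z) ∧
      ContDiffOn ℝ ω Φ Φ.source ∧ ContDiffOn ℝ ω Φ.symm Φ.target := by
  have : CompleteSpace V := FiniteDimensional.complete ℝ V
  set Φ₀ := hΨ.contDiffAt.toOpenPartialHomeomorph Ψ hA (by simp) with hΦ₀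
  set O' : Set V := {z | fderiv ℝ Ψ z ∈ range ((↑) : (V ≃L[ℝ] W) → V →L[ℝ] W)} with hO'
  have hO'open : IsOpen O' :=
    ContinuousLinearEquiv.isOpen.preimage (hΨ.continuous_fderiv (by simp))
  have hxO' : x ∈ O' := ⟨A, hA.fderiv.symm⟩
  refine ⟨Φ₀.restrOpen (O ∩ O') (hO.inter hO'open), ⟨?_, hx, hxO'⟩, fun z hz => hz.2.1,
    fun z => rfl, hΨ.contDiffOn, fun w hw => ContDiffAt.contDiffWithinAt ?_⟩
  · exact hΨ.contDiffAt.mem_toOpenPartialHomeomorph_source hA (by simp)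
  · have h1 := (Φ₀.restrOpen (O ∩ O') (hO.inter hO'open)).map_target hw
    obtain ⟨B, hB⟩ := h1.2.2
    refine OpenPartialHomeomorph.contDiffAt_symm _ hw (f₀' := B) ?_ hΨ.contDiffAt
    rw [hB]
    exact (hΨ.differentiable (by simp) _).hasFDerivAt

/-- A surjective linear map is the second component of a linear isomorphism. -/
theorem exists_continuousLinearEquiv_snd {d m : ℕ} (hd : Module.finrank ℝ V = d + m)
    (f : V →L[ℝ] (Fin m → ℝ)) (hf : Function.Surjective f) :
    ∃ A : V ≃L[ℝ] (Fin d → ℝ) × (Fin m → ℝ), ∀ v, (A v).2 = f v := by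
  have hk : Module.finrank ℝ (LinearMap.ker f.toLinearMap) = Module.finrank ℝ (Fin d → ℝ) := by
    have h1 := LinearMap.finrank_range_add_finrank_ker f.toLinearMap
    rw [LinearMap.range_eq_top.2 hf, finrank_top, hd] at h1
    simp at h1 ⊢
    omega
  obtain ⟨P, hP⟩ := Submodule.exists_isCompl (LinearMap.ker f.toLinearMap)
  set π := (Submodule.projectionOnto _ P hP) with hπ
  set B : V →ₗ[ℝ] (Fin d → ℝ) × (Fin m → ℝ) :=
    ((LinearEquiv.ofFinrankEq _ _ hk).toLinearMap ∘ₗ π).prod f.toLinearMap with hB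
  have hinj : Function.Injective B := by
    rw [injective_iff_map_eq_zero]
    intro v hv
    have h1 : π v = 0 := by simpa [hB] using congrArg Prod.fst hv
    have h2 : f v = 0 := by simpa [hB] using congrArg Prod.snd hv
    have h3 := Submodule.projectionOnto_apply_left hP ⟨v, h2⟩
    rw [← hπ] at h3
    simp only [h1] at h3
    exact (congrArg Subtype.val h3).symm
  exact ⟨(LinearEquiv.ofInjectiveOfFinrankEq B hinj (by simp [hd])).toContinuousLinearEquiv,
    fun v => rfl⟩

/-- Near a point where an analytic map is a submersion it is a part of an analytic chart. -/
theorem exists_chart_of_submersion {d m : ℕ} (hd : Module.finrank ℝ V = d + m)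
    {F : V → Fin m → ℝ} (hF : ContDiff ℝ ω F) {x : V}
    (hsurj : ∀ w, ∃ v, HasDerivAt (fun t : ℝ => F (x + t • v)) w 0) {O : Set V} (hO : IsOpen O)
    (hx : x ∈ O) :
    ∃ Φ : OpenPartialHomeomorph V ((Fin d → ℝ) × (Fin m → ℝ)), x ∈ Φ.source ∧ Φ.source ⊆ O ∧
      (∀ z, (Φ z).2 = F z) ∧
      ContDiffOn ℝ ω Φ Φ.source ∧ ContDiffOn ℝ ω Φ.symm Φ.target := by
  have hFd := (hF.differentiable (by simp) x).hasFDerivAt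
  obtain ⟨A, hA⟩ := exists_continuousLinearEquiv_snd hd (fderiv ℝ F x) fun w => by
    obtain ⟨v, hv⟩ := hsurj w
    have hline : HasDerivAt (fun t : ℝ => x + t • v) v 0 := by
      simpa using! ((hasDerivAt_id (0 : ℝ)).smul_const v).const_add x
    exact ⟨v, (hFd.comp_hasDerivAt_of_eq (0 : ℝ) hline (by simp)).unique hv⟩
  have h1 : HasFDerivAt (fun z => ((A z).1, F z)) (A : V →L[ℝ] _) x := by
    have h2 := (((ContinuousLinearMap.fst ℝ _ _).comp
      (A : V →L[ℝ] (Fin d → ℝ) × (Fin m → ℝ))).hasFDerivAt (x := x)).prodMk hFd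
    refine h2.congr_fderiv ?_
    ext1 v
    exact Prod.ext rfl (hA v).symm
  obtain ⟨Φ, h1, h2, h3, h4, h5⟩ := exists_analytic_openPartialHomeomorph (Ψ := fun z =>
    ((A z).1, F z)) ((contDiff_fst.comp A.contDiff).prodMk hF) h1 hO hx
  exact ⟨Φ, h1, h2, fun z => by rw [h3], h4, h5⟩

end Charts

/-- The linear coordinates with the first defining function moved to the first factor. -/
noncomputable def shiftCoord (d k : ℕ) :
    ((Fin d → ℝ) × (Fin (k + 1) → ℝ)) ≃ₗ[ℝ] (Fin (d + 1) → ℝ) × (Fin k → ℝ) where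
  toFun v := (Fin.cons (v.2 0) v.1, Fin.tail v.2)
  map_add' v w := by
    refine Prod.ext (funext fun i => Fin.cases ?_ (fun j => ?_) i) rfl <;> simp
  map_smul' c v := by
    refine Prod.ext (funext fun i => Fin.cases ?_ (fun j => ?_) i) rfl <;> simp
  invFun v := (Fin.tail v.1, Fin.cons (v.1 0) v.2)
  left_inv v := by simp
  right_inv v := by simp

namespace LagrangianSystem

variable {n : ℕ} {L : LagrangianSystem n}

/-- The analytic extension to the ambient space of the rescaled energy on the boundary. -/
noncomputable def boundaryEnergy (L : LagrangianSystem n) (ζ : Amb n) : ℝ :=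
  ‖ζ.2.2‖ ^ 2 / 2 + L.Ul ζ.2.1

theorem contDiff_boundaryEnergy : ContDiff ℝ ω L.boundaryEnergy := by
  have h1 : ContDiff ℝ ω fun ζ : Amb n => L.Ul ζ.2.1 :=
    L.contDiff_Ul.comp (contDiff_fst.comp contDiff_snd)
  have h2 : ContDiff ℝ ω fun ζ : Amb n => ‖ζ.2.2‖ ^ 2 / 2 :=
    ((contDiff_norm_sq ℝ).comp (contDiff_snd.comp contDiff_snd)).div_const 2
  exact h2.add h1

theorem hasDerivAt_boundaryEnergy_line (ζ v : Amb n) :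
    HasDerivAt (fun t : ℝ => L.boundaryEnergy (ζ + t • v))
      (inner ℝ ζ.2.2 v.2.2 + inner ℝ (∇ L.Ul ζ.2.1) v.2.1) 0 := by
  have hq : HasDerivAt (fun t : ℝ => ζ.2.1 + t • v.2.1) v.2.1 0 := by
    simpa using! ((hasDerivAt_id (0 : ℝ)).smul_const v.2.1).const_add ζ.2.1
  have hy : HasDerivAt (fun t : ℝ => ζ.2.2 + t • v.2.2) v.2.2 0 := by
    simpa using! ((hasDerivAt_id (0 : ℝ)).smul_const v.2.2).const_add ζ.2.2
  have h1 := (((L.contDiff_Ul (k := 1)).differentiable one_ne_zero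
    ζ.2.1).hasFDerivAt).comp_hasDerivAt_of_eq (0 : ℝ) hq (by simp)
  refine ((hy.norm_sq.div_const 2).fun_add h1).congr_deriv ?_
  rw [inner_gradient_left]
  simp

theorem hasDerivAt_sphere_line (ζ v : Amb n) :
    HasDerivAt (fun t : ℝ => ‖(ζ + t • v).2.1‖ ^ 2 - 1) (2 * inner ℝ ζ.2.1 v.2.1) 0 := by
  have hq : HasDerivAt (fun t : ℝ => ζ.2.1 + t • v.2.1) v.2.1 0 := by
    simpa using! ((hasDerivAt_id (0 : ℝ)).smul_const v.2.1).const_add ζ.2.1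
  simpa using! hq.norm_sq.sub_const 1

theorem hasDerivAt_fst_line (ζ v : Amb n) :
    HasDerivAt (fun t : ℝ => (ζ + t • v).1) v.1 0 := by
  simpa using! ((hasDerivAt_id (0 : ℝ)).mul_const v.1).const_add ζ.1

theorem contDiff_sphere : ContDiff ℝ ω fun ζ : Amb n => ‖ζ.2.1‖ ^ 2 - 1 :=
  ((contDiff_norm_sq ℝ).comp (contDiff_fst.comp contDiff_snd)).sub contDiff_const

theorem mem_bdry_iff {ζ : Amb n} : ζ ∈ L.bdry ↔ ζ.1 = 0 ∧ ‖ζ.2.1‖ ^ 2 - 1 = 0 := by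
  refine and_congr_right fun _ => ?_
  rw [sub_eq_zero, pow_eq_one_iff_of_nonneg (norm_nonneg _) two_ne_zero]

theorem mem_bdryLE_iff {ζ : Amb n} : ζ ∈ L.bdryLE ↔ ζ ∈ L.bdry ∧ L.boundaryEnergy ζ ≤ 0 :=
  and_congr_right fun h => by rw [rescaledEnergy_of_fst_eq_zero h.1, boundaryEnergy]

theorem mem_bdryZero_iff {ζ : Amb n} : ζ ∈ L.bdryZero ↔ ζ ∈ L.bdry ∧ L.boundaryEnergy ζ = 0 :=
  and_congr_right fun h => by rw [rescaledEnergy_of_fst_eq_zero h.1, boundaryEnergy]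

theorem finrank_amb (hn : 1 ≤ n) : Module.finrank ℝ (Amb n) = (2 * n - 1) + 2 := by
  simp [Module.finrank_prod]
  omega

/-- The energy is a submersion on the critical boundary. -/
theorem exists_tangent_boundaryEnergy (hreg : IsSphereRegularValue L.Ul 0) {x : Amb n}
    (hx : x ∈ L.bdryZero) (c a b : ℝ) : ∃ v : Amb n,
      -(inner ℝ x.2.2 v.2.2 + inner ℝ (∇ L.Ul x.2.1) v.2.1) = c ∧ v.1 = a ∧
      2 * inner ℝ x.2.1 v.2.1 = b := by
  obtain ⟨⟨-, hq⟩, hE⟩ := mem_bdryZero_iff.1 hx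
  obtain ⟨r, q, y⟩ := x
  simp only at hq hE ⊢
  have hqq : inner ℝ q q = (1 : ℝ) := by rw [real_inner_self_eq_norm_sq, hq]; norm_num
  -- where `y = 0` the potential vanishes, so that its gradient on the sphere does not
  by_cases hy : y = 0
  · have hU : L.Ul q = 0 := by simpa [boundaryEnergy, hy] using hE
    set w := sphereGrad L.Ul q with hw
    have hw0 : w ≠ 0 := fun h => hreg q ⟨hq, h⟩ hU
    have hqw : inner ℝ q w = (0 : ℝ) := by
      rw [hw, sphereGrad, inner_sub_right, inner_smul_right, hqq, real_inner_comm]; ring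
    have hUw : inner ℝ (∇ L.Ul q) w = ‖w‖ ^ 2 := by
      have : ∇ L.Ul q = w + (inner ℝ (∇ L.Ul q) q : ℝ) • q := by rw [hw, sphereGrad]; abel
      conv_lhs => rw [this]
      rw [inner_add_left, inner_smul_left, hqw, real_inner_self_eq_norm_sq, mul_zero, add_zero]
    have hww : ‖w‖ ^ 2 ≠ 0 := by simpa using hw0
    refine ⟨(a, (b / 2) • q + ((-c - b / 2 * inner ℝ (∇ L.Ul q) q) / ‖w‖ ^ 2) • w, 0), ?_, rfl, ?_⟩
    · simp only [inner_add_right, inner_smul_right, hUw, inner_zero_right]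
      field_simp
      ring
    · simp only [inner_add_right, inner_smul_right, hqw, hqq]
      ring
  · have hyy : ‖y‖ ^ 2 ≠ 0 := by simpa using hy
    refine ⟨(a, (b / 2) • q, ((-c - b / 2 * inner ℝ (∇ L.Ul q) q) / ‖y‖ ^ 2) • y), ?_, rfl, ?_⟩
    · simp only [inner_smul_right, real_inner_self_eq_norm_sq y]
      field_simp
      ring
    · simp only [inner_smul_right, hqq]
      ring

/-- The defining functions are `r` and `‖q‖² - 1`; at the boundary points the negative of the energy
is the coordinate that bounds the half-space. -/
theorem isSubmanifoldWithBoundary_bdryLE (hreg : IsSphereRegularValue L.Ul 0) :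
    IsSubmanifoldWithBoundary (2 * n - 1) L.bdryLE L.bdryZero := by
  refine ⟨fun ζ hζ => ⟨hζ.1, hζ.2.le⟩, fun x hx => ?_⟩
  obtain ⟨hxb, hxE⟩ := mem_bdryLE_iff.1 hx
  have hn : 1 ≤ n := by
    rw [Nat.one_le_iff_ne_zero]
    rintro rfl
    have : x.2.1 = 0 := Subsingleton.elim _ _
    have h1 := hxb.2
    simp [this] at h1
  have hEc := (L.contDiff_boundaryEnergy).continuous
  have hqq : inner ℝ x.2.1 x.2.1 = (1 : ℝ) := by
    rw [real_inner_self_eq_norm_sq, hxb.2]; norm_num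
  rcases hxE.lt_or_eq with hlt | heq
  · set F : Amb n → Fin 2 → ℝ := fun ζ => ![ζ.1, ‖ζ.2.1‖ ^ 2 - 1] with hF
    have hFs : ContDiff ℝ ω F := by
      rw [contDiff_pi, Fin.forall_fin_two]
      exact ⟨contDiff_fst, contDiff_sphere⟩
    obtain ⟨Φ, h1, h2, h3, h4, h5⟩ := exists_chart_of_submersion (finrank_amb hn) hFs (x := x)
      (fun w => ⟨(w 0, (w 1 / 2) • x.2.1, 0), by
        rw [hasDerivAt_pi, Fin.forall_fin_two]
        refine ⟨hasDerivAt_fst_line x _, (hasDerivAt_sphere_line x _).congr_deriv ?_⟩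
        simp only [inner_smul_right, hqq]
        ring⟩)
      (hEc.isOpen_preimage (Iio 0) isOpen_Iio) hlt
    refine ⟨2, Φ, h1, h4, h5, Or.inl ⟨fun h => ?_, ?_, ?_⟩⟩
    · exact hlt.ne (mem_bdryZero_iff.1 h).2
    · rw [Set.eq_empty_iff_forall_notMem]
      rintro z ⟨hz1, hz2⟩
      exact (h2 hz1 : L.boundaryEnergy z < 0).ne (mem_bdryZero_iff.1 hz2).2
    · ext z
      refine and_congr_right fun hz => ?_
      rw [h3, mem_bdryLE_iff, and_iff_left (h2 hz : L.boundaryEnergy z < 0).le, mem_bdry_iff]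
      simp [hF, funext_iff, Fin.forall_fin_two]
  · have hx0 : x ∈ L.bdryZero := mem_bdryZero_iff.2 ⟨hxb, heq⟩
    set F : Amb n → Fin 3 → ℝ := fun ζ => ![-L.boundaryEnergy ζ, ζ.1, ‖ζ.2.1‖ ^ 2 - 1] with hF
    have hall : ∀ p : Fin 3 → Prop, (∀ i, p i) ↔ p 0 ∧ p 1 ∧ p 2 := fun p =>
      ⟨fun h => ⟨h 0, h 1, h 2⟩, fun h i => by fin_cases i; exacts [h.1, h.2.1, h.2.2]⟩
    have hFs : ContDiff ℝ ω F := by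
      rw [contDiff_pi, hall]
      exact ⟨L.contDiff_boundaryEnergy.neg, contDiff_fst, contDiff_sphere⟩
    obtain ⟨m, rfl⟩ : ∃ m, n = m + 1 := ⟨n - 1, by omega⟩
    have hdim : 2 * (m + 1) - 1 = 2 * m + 1 := by omega
    rw [hdim]
    obtain ⟨Φ, h1, h2, h3, h4, h5⟩ := exists_chart_of_submersion (d := 2 * m) (m := 3)
      ((finrank_amb hn).trans (by omega)) hFs (x := x)
      (fun w => by
        obtain ⟨v, g1, g2, g3⟩ := exists_tangent_boundaryEnergy hreg hx0 (w 0) (w 1) (w 2)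
        refine ⟨v, ?_⟩
        rw [hasDerivAt_pi, hall]
        exact ⟨(hasDerivAt_boundaryEnergy_line x v).neg.congr_deriv g1,
          (hasDerivAt_fst_line x v).congr_deriv g2, (hasDerivAt_sphere_line x v).congr_deriv g3⟩)
      isOpen_univ (mem_univ x)
    set C := (shiftCoord (2 * m) 2).toContinuousLinearEquiv with hC
    have hC1 : ∀ z, C z = (Fin.cons (z.2 0) z.1, Fin.tail z.2) := fun z => rfl
    refine ⟨2, Φ.transHomeomorph C.toHomeomorph, h1, C.contDiff.comp_contDiffOn h4,
      h5.comp C.symm.contDiff.contDiffOn fun w hw => hw, Or.inr ⟨hx0, 0, ?_, ?_⟩⟩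
    · ext z
      refine and_congr_right fun hz => ?_
      change _ ↔ (C (Φ z)).2 = 0 ∧ 0 ≤ (C (Φ z)).1 0
      rw [hC1, mem_bdryLE_iff, mem_bdry_iff]
      simp [h3, hF, funext_iff, Fin.forall_fin_two]
    · ext z
      refine and_congr_right fun hz => ?_
      change _ ↔ (C (Φ z)).2 = 0 ∧ (C (Φ z)).1 0 = 0
      rw [hC1, mem_bdryZero_iff, mem_bdry_iff]
      simp [h3, hF, funext_iff, Fin.forall_fin_two]

end LagrangianSystem
end McGehee

/-! ### Integral curves near a hyperbolic fixed point -/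

section Transfer

variable {E S U : Type*} [NormedAddCommGroup E] [NormedSpace ℝ E]
  [NormedAddCommGroup S] [NormedSpace ℝ S] [NormedAddCommGroup U] [NormedSpace ℝ U]
  {X : E → E} {D : E →L[ℝ] E} {ζ : E} {As : S →L[ℝ] S} {Au : U →L[ℝ] U} {α : ℝ}

theorem IsIntegralCurveOn.map_equiv (e : E ≃L[ℝ] S × U) {γ : ℝ → E} {I : Set ℝ}
    (h : IsIntegralCurveOn γ (fun _ => X) I) :
    IsIntegralCurveOn (fun t => e (γ t - ζ)) (fun _ z => e (X (ζ + e.symm z))) I := fun t ht => by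
  have h1 := e.hasFDerivAt.comp_hasDerivWithinAt t ((h t ht).sub_const ζ)
  simp only [add_sub_cancel, ContinuousLinearEquiv.symm_apply_apply]
  exact h1

theorem IsIntegralCurveOn.of_map_equiv (e : E ≃L[ℝ] S × U) {γ : ℝ → S × U} {I : Set ℝ}
    (h : IsIntegralCurveOn γ (fun _ z => e (X (ζ + e.symm z))) I) :
    IsIntegralCurveOn (fun t => ζ + e.symm (γ t)) (fun _ => X) I := fun t ht => by
  have h1 := (e.symm.hasFDerivAt.comp_hasDerivWithinAt t (h t ht)).const_add ζ
  simpa using! h1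

theorem hasStrictFDerivAt_conj (hX : HasStrictFDerivAt X D ζ) (e : E ≃L[ℝ] S × U)
    (he : ∀ v, e (D v) = (As (e v).1, Au (e v).2)) :
    HasStrictFDerivAt (fun z => e (X (ζ + e.symm z))) (As.prodMap Au) 0 := by
  have h1 : HasStrictFDerivAt (fun z => ζ + e.symm z) (e.symm : S × U →L[ℝ] E) 0 :=
    e.symm.hasStrictFDerivAt.const_add ζ
  have h2 : HasStrictFDerivAt X D (ζ + e.symm 0) := by simpa using hX
  refine (e.hasStrictFDerivAt.comp 0 (h2.comp 0 h1)).congr_fderiv ?_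
  refine ContinuousLinearMap.ext fun z => ?_
  have h3 := he (e.symm z)
  rw [ContinuousLinearEquiv.apply_symm_apply] at h3
  exact h3

theorem exists_stable_integralCurve [FiniteDimensional ℝ S] [FiniteDimensional ℝ U]
    (hX : HasStrictFDerivAt X D ζ) (h0 : X ζ = 0)
    (e : E ≃L[ℝ] S × U) (he : ∀ v, e (D v) = (As (e v).1, Au (e v).2)) (hα : 0 < α)
    (hAs : IsContracting α As) (hAu : IsExpanding α Au) :
    ∃ ε > 0, ∀ s₀ : S, ‖s₀‖ < ε → ∃ γ : ℝ → E, (e (γ 0 - ζ)).1 = s₀ ∧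
      IsIntegralCurveOn γ (fun _ => X) (Ici 0) ∧ (∀ t ∈ Ici (0 : ℝ), ‖e (γ t - ζ)‖ ≤ 2 * ‖s₀‖) ∧
      Tendsto γ atTop (𝓝 ζ) := by
  obtain ⟨ε, hε, H⟩ := exists_integralCurve_tendsto hα hAs hAu (hasStrictFDerivAt_conj hX e he)
    (by simp [h0])
  refine ⟨ε, hε, fun s₀ hs₀ => ?_⟩
  obtain ⟨γ, h1, h2, h3, h4⟩ := H s₀ hs₀
  refine ⟨fun t => ζ + e.symm (γ t), by simpa using h1, h2.of_map_equiv e, by simpa using h3, ?_⟩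
  have h5 : Tendsto (fun z => ζ + e.symm z) (𝓝 0) (𝓝 ζ) :=
    Continuous.tendsto' (by fun_prop) _ _ (by simp)
  exact h5.comp h4

theorem exists_stable_cone [FiniteDimensional ℝ S] [FiniteDimensional ℝ U]
    (hX : HasStrictFDerivAt X D ζ) (h0 : X ζ = 0)
    (e : E ≃L[ℝ] S × U) (he : ∀ v, e (D v) = (As (e v).1, Au (e v).2)) (hα : 0 < α)
    (hAs : IsContracting α As) (hAu : IsExpanding α Au) {κ : ℝ} (hκ0 : 0 < κ) (hκ1 : κ ≤ 1) :
    ∃ δ > 0, ∀ γ γ' : ℝ → E, IsIntegralCurveOn γ (fun _ => X) (Ici 0) →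
      IsIntegralCurveOn γ' (fun _ => X) (Ici 0) → (∀ t ∈ Ici (0 : ℝ), ‖e (γ t - ζ)‖ ≤ δ) →
      (∀ t ∈ Ici (0 : ℝ), ‖e (γ' t - ζ)‖ ≤ δ) →
      ‖(e (γ 0 - γ' 0)).2‖ ≤ κ * ‖(e (γ 0 - γ' 0)).1‖ := by
  obtain ⟨δ, hδ, H⟩ := exists_cone_of_integralCurve hα hAs hAu (hasStrictFDerivAt_conj hX e he)
    (by simp [h0]) hκ0 hκ1
  refine ⟨δ, hδ, fun γ γ' h1 h2 h3 h4 => ?_⟩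
  have := H _ _ (h1.map_equiv (ζ := ζ) e) (h2.map_equiv (ζ := ζ) e) h3 h4
  rwa [← map_sub, sub_sub_sub_cancel_right] at this

end Transfer

namespace McGehee
namespace LagrangianSystem

variable {n : ℕ} {L : LagrangianSystem n}

/-! ### Invariant sets of the ambient McGehee field -/

theorem integralCurve_parts {γ : ℝ → Amb n} {I : Set ℝ}
    (h : IsIntegralCurveOn γ (fun _ => L.field) I) {t : ℝ} (ht : t ∈ I) :
    HasDerivWithinAt (fun t => (γ t).1) (inner ℝ (γ t).2.1 (γ t).2.2 * (γ t).1) I t ∧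
    HasDerivWithinAt (fun t => 1 - ‖(γ t).2.1‖ ^ 2)
      ((-2 * inner ℝ (γ t).2.1 (γ t).2.2) * (1 - ‖(γ t).2.1‖ ^ 2)) I t := by
  have h1 : HasDerivWithinAt γ (L.field (γ t)) I t := h t ht
  have h3 := ((ContinuousLinearMap.fst ℝ (Vec n) (Vec n)).comp
    (ContinuousLinearMap.snd ℝ ℝ (Vec n × Vec n))).hasFDerivAt.comp_hasDerivWithinAt t h1
  refine ⟨(ContinuousLinearMap.fst ℝ ℝ (Vec n × Vec n)).hasFDerivAt.comp_hasDerivWithinAt t h1,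
    ?_⟩
  have h4 : HasDerivWithinAt (fun t => (γ t).2.1)
      ((γ t).2.2 - inner ℝ (γ t).2.1 (γ t).2.2 • (γ t).2.1) I t := h3
  refine (h4.norm_sq.const_sub 1).congr_deriv ?_
  rw [inner_sub_right, inner_smul_right, real_inner_self_eq_norm_sq]
  ring

theorem continuousOn_inner {γ : ℝ → Amb n} {I : Set ℝ} (h : ContinuousOn γ I) (c : ℝ) :
    ContinuousOn (fun t => c * inner ℝ (γ t).2.1 (γ t).2.2) I := by fun_prop

theorem fst_eq_mul_exp {γ : ℝ → Amb n} {a b t : ℝ}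
    (h : IsIntegralCurveOn γ (fun _ => L.field) (Icc a b)) (ht : t ∈ Icc a b) :
    (γ t).1 = (γ a).1 * Real.exp (∫ s in a..t, 1 * inner ℝ (γ s).2.1 (γ s).2.2) :=
  eq_mul_exp_of_hasDerivWithinAt (continuousOn_inner h.continuousOn 1)
    (fun s hs => (integralCurve_parts h hs).1.congr_deriv (by ring)) ht

theorem sphere_eq_mul_exp {γ : ℝ → Amb n} {a b t : ℝ}
    (h : IsIntegralCurveOn γ (fun _ => L.field) (Icc a b)) (ht : t ∈ Icc a b) :
    1 - ‖(γ t).2.1‖ ^ 2 = (1 - ‖(γ a).2.1‖ ^ 2)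
      * Real.exp (∫ s in a..t, -2 * inner ℝ (γ s).2.1 (γ s).2.2) :=
  eq_mul_exp_of_hasDerivWithinAt (p := fun t => 1 - ‖(γ t).2.1‖ ^ 2)
    (continuousOn_inner h.continuousOn (-2))
    (fun _ hs => (integralCurve_parts h hs).2) ht

/-- The sign of `r` is constant along integral curves. -/
theorem exists_pos_fst_eq {γ : ℝ → Amb n} {a b : ℝ}
    (h : IsIntegralCurveOn γ (fun _ => L.field) (uIcc a b)) :
    ∃ c > 0, (γ b).1 = c * (γ a).1 := by
  rcases le_total a b with hab | hab
  · rw [uIcc_of_le hab] at h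
    exact ⟨_, Real.exp_pos _, by rw [fst_eq_mul_exp h (right_mem_Icc.2 hab), mul_comm]⟩
  · rw [uIcc_of_ge hab] at h
    have h1 := fst_eq_mul_exp h (right_mem_Icc.2 hab)
    set w := ∫ s in b..a, 1 * inner ℝ (γ s).2.1 (γ s).2.2
    refine ⟨(Real.exp w)⁻¹, inv_pos.2 (Real.exp_pos _), ?_⟩
    rw [h1, mul_comm _ (Real.exp w), inv_mul_cancel_left₀ (Real.exp_pos _).ne']

/-- The extended McGehee manifold is invariant. -/
theorem norm_eq_one_of_integralCurve {γ : ℝ → Amb n} {a b : ℝ}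
    (h : IsIntegralCurveOn γ (fun _ => L.field) (uIcc a b)) (ha : ‖(γ a).2.1‖ = 1) :
    ‖(γ b).2.1‖ = 1 := by
  have key : 1 - ‖(γ b).2.1‖ ^ 2 = 0 := by
    rcases le_total a b with hab | hab
    · rw [uIcc_of_le hab] at h
      rw [sphere_eq_mul_exp h (right_mem_Icc.2 hab), ha]
      norm_num
    · rw [uIcc_of_ge hab] at h
      have h1 := sphere_eq_mul_exp h (right_mem_Icc.2 hab)
      rw [ha] at h1
      have h2 := (mul_eq_zero.1 (h1.symm.trans (by norm_num))).resolve_right (Real.exp_pos _).ne'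
      exact h2
  have h3 : ‖(γ b).2.1‖ ^ 2 = 1 := by linarith
  exact (pow_eq_one_iff_of_nonneg (norm_nonneg _) two_ne_zero).1 h3

/-- The extended McGehee manifold is repelling where `⟨q, y⟩ < 0`: a curve there that converges to
a point of the manifold lies on it. -/
theorem norm_eq_one_of_tendsto {γ : ℝ → Amb n} {ζ : Amb n}
    (h : IsIntegralCurveOn γ (fun _ => L.field) (Ici 0)) (hζ : ‖ζ.2.1‖ = 1)
    (hγ : Tendsto γ atTop (𝓝 ζ)) (hneg : ∀ t ∈ Ici (0 : ℝ), inner ℝ (γ t).2.1 (γ t).2.2 ≤ (0 : ℝ))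
    {t : ℝ} (ht : 0 ≤ t) : ‖(γ t).2.1‖ = 1 := by
  have h0 : 1 - ‖(γ 0).2.1‖ ^ 2 = 0 := by
    have hlim : Tendsto (fun t => |1 - ‖(γ t).2.1‖ ^ 2|) atTop (𝓝 0) := by
      have h1 : Continuous fun z : Amb n => |1 - ‖z.2.1‖ ^ 2| := by fun_prop
      have h2 := (h1.tendsto ζ).comp hγ
      rw [hζ] at h2
      simpa using! h2
    have hge : ∀ t ∈ Ici (0 : ℝ), |1 - ‖(γ 0).2.1‖ ^ 2| ≤ |1 - ‖(γ t).2.1‖ ^ 2| := fun t ht => by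
      rw [sphere_eq_mul_exp (h.mono Icc_subset_Ici_self) (right_mem_Icc.2 ht), abs_mul,
        abs_of_pos (Real.exp_pos _)]
      refine le_mul_of_one_le_right (abs_nonneg _) (Real.one_le_exp ?_)
      refine intervalIntegral.integral_nonneg ht fun s hs => ?_
      have := hneg s hs.1
      linarith
    have := ge_of_tendsto hlim ((eventually_ge_atTop 0).mono hge)
    exact abs_nonpos_iff.1 this
  refine norm_eq_one_of_integralCurve (a := 0) (h.mono ?_)
    ((pow_eq_one_iff_of_nonneg (norm_nonneg _) two_ne_zero).1 (by linarith))
  rw [uIcc_of_le ht]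
  exact Icc_subset_Ici_self

end LagrangianSystem

/-! ### Conservation of energy -/

/-- The algebra behind the conservation of energy: the potential force and the Christoffel terms
cancel the change of `g` and `U`, and the magnetic force does no work. -/
theorem energy_algebra {n : ℕ} {M : Matrix (Fin n) (Fin n) ℝ} (hM : M.PosDef)
    {F : Matrix (Fin n) (Fin n) ℝ} (hF : Fᵀ = -F) (dg : Fin n → Fin n → Fin n → ℝ)
    (dU v : Fin n → ℝ) (a : Fin n → ℝ)
    (ha : a = -(M⁻¹ *ᵥ dU) - (fun k => ∑ i, ∑ j, (1 / 2 : ℝ) * (∑ m, M⁻¹ k m *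
      (dg i j m + dg j i m - dg m i j)) * v i * v j) + M⁻¹ *ᵥ (F *ᵥ v)) :
    v ⬝ᵥ (M *ᵥ a) + (∑ i, ∑ j, (∑ k, v k * dg k i j) * v i * v j) / 2 + v ⬝ᵥ dU = 0 := by
  set C : Fin n → ℝ := fun m => ∑ i, ∑ j, (1 / 2 : ℝ) * (dg i j m + dg j i m - dg m i j) * v i * v j
    with hC
  have hS : ∀ w : Fin n → Fin n → Fin n → ℝ, (∑ m, ∑ i, ∑ j, w i j m) = ∑ m, ∑ i, ∑ j, w m i j := by
    intro w
    rw [Finset.sum_comm]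
    exact Finset.sum_congr rfl fun i _ => Finset.sum_comm
  have hdet : IsUnit M.det := hM.det_pos.ne'.isUnit
  have hΓ : (fun k => ∑ i, ∑ j, (1 / 2 : ℝ) * (∑ m, M⁻¹ k m *
      (dg i j m + dg j i m - dg m i j)) * v i * v j) = M⁻¹ *ᵥ C := by
    ext k
    simp only [Matrix.mulVec, dotProduct, hC, Finset.mul_sum, Finset.sum_mul]
    refine (hS fun i j m => 1 / 2 * (M⁻¹ k m * (dg i j m + dg j i m - dg m i j)) * v i * v j).symm.trans
      (Finset.sum_congr rfl fun m _ => Finset.sum_congr rfl fun i _ =>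
        Finset.sum_congr rfl fun j _ => ?_)
    ring
  have hMa : M *ᵥ a = -dU - C + F *ᵥ v := by
    rw [ha, hΓ]
    simp only [Matrix.mulVec_add, Matrix.mulVec_sub, Matrix.mulVec_neg, Matrix.mulVec_mulVec,
      Matrix.mul_nonsing_inv _ hdet, Matrix.one_mulVec, ← Matrix.mul_assoc, Matrix.one_mul]
  have hFv : v ⬝ᵥ (F *ᵥ v) = 0 := by
    have h1 : v ⬝ᵥ (F *ᵥ v) = v ⬝ᵥ (Fᵀ *ᵥ v) := by
      rw [Matrix.mulVec_transpose, Matrix.dotProduct_mulVec, dotProduct_comm]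
    rw [hF, Matrix.neg_mulVec, dotProduct_neg] at h1
    linarith
  have hvC : v ⬝ᵥ C = (∑ i, ∑ j, (∑ k, v k * dg k i j) * v i * v j) / 2 := by
    set S := ∑ m, ∑ i, ∑ j, dg m i j * v m * v i * v j with hSdef
    have e1 : (∑ i, ∑ j, (∑ k, v k * dg k i j) * v i * v j) = S := by
      simp only [Finset.sum_mul]
      refine (hS fun i j k => v k * dg k i j * v i * v j).symm.trans
        (Finset.sum_congr rfl fun m _ => Finset.sum_congr rfl fun i _ =>
        Finset.sum_congr rfl fun j _ => ?_)
      ring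
    have e2 : v ⬝ᵥ C = (1/2) * ((∑ m, ∑ i, ∑ j, dg i j m * v i * v j * v m)
        + (∑ m, ∑ i, ∑ j, dg j i m * v j * v i * v m) - S) := by
      simp only [hSdef, dotProduct, hC, ← Finset.sum_add_distrib, ← Finset.sum_sub_distrib,
        Finset.mul_sum]
      refine Finset.sum_congr rfl fun m _ => Finset.sum_congr rfl fun i _ =>
        Finset.sum_congr rfl fun j _ => ?_
      ring
    have e3 : (∑ m, ∑ i, ∑ j, dg i j m * v i * v j * v m) = S :=
      hS fun i j m => dg i j m * v i * v j * v m
    have e4 : (∑ m, ∑ i, ∑ j, dg j i m * v j * v i * v m) = S := by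
      rw [← e3]
      exact Finset.sum_congr rfl fun i _ => Finset.sum_comm
    rw [e1, e2, e3, e4]
    ring
  rw [hMa, dotProduct_add, dotProduct_sub, dotProduct_neg, hFv, hvC]
  ring

namespace LagrangianSystem

variable {n : ℕ} {L : LagrangianSystem n}

theorem fderiv_eq_sum_partialDeriv (w : Vec n → ℝ) (x v : Vec n) :
    fderiv ℝ w x v = ∑ k, v k * partialDeriv k w x := by
  conv_lhs => rw [← (EuclideanSpace.basisFun (Fin n) ℝ).sum_repr v, map_sum]
  simp [partialDeriv]

/-- The energy is conserved, also along time-rescaled solutions. -/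
theorem hasDerivWithinAt_energy {x v : ℝ → Vec n} {I : Set ℝ} {t : ℝ}
    (hx : x t ∈ Metric.ball (0 : Vec n) L.rE) {c : ℝ} (h1 : HasDerivWithinAt x (c • v t) I t)
    (h2 : HasDerivWithinAt v (c • (L.eulerLagrange (x t, v t)).2) I t) :
    HasDerivWithinAt (fun t => L.energy (x t, v t)) 0 I t := by
  set a := (L.eulerLagrange (x t, v t)).2 with ha
  have hw : ∀ w : Vec n → ℝ, DifferentiableAt ℝ w (x t) →
      HasDerivWithinAt (fun t => w (x t)) (c * ∑ k, v t k * partialDeriv k w (x t)) I t := by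
    intro w hw
    refine (hw.hasFDerivAt.comp_hasDerivWithinAt t h1).congr_deriv ?_
    rw [map_smul, fderiv_eq_sum_partialDeriv, smul_eq_mul]
  have hv : ∀ i, HasDerivWithinAt (fun t => v t i) (c * a i) I t := fun i =>
    (EuclideanSpace.proj i : Vec n →L[ℝ] ℝ).hasFDerivAt.comp_hasDerivWithinAt t h2
  have hg : ∀ i j, HasDerivWithinAt (fun t => L.g (x t) i j)
      (c * ∑ k, v t k * partialDeriv k (fun z => L.g z i j) (x t)) I t := fun i j =>
    hw _ (L.g_analytic i j _ hx).differentiableAt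
  have hU := hw L.U (L.U_analytic _ hx).differentiableAt
  have hE : ∀ t, L.energy (x t, v t) = (∑ i, ∑ j, L.g (x t) i j * v t i * v t j) / 2
      + L.U (x t) := by
    intro t
    simp only [energy, PiLp.inner_apply, Matrix.toLpLin_apply, Matrix.mulVec, dotProduct]
    congr 2
    refine Finset.sum_congr rfl fun i _ => ?_
    simp only [RCLike.inner_apply, conj_trivial, Finset.sum_mul]
    refine Finset.sum_congr rfl fun j _ => ?_
    ring
  have hd := ((HasDerivWithinAt.fun_sum (u := Finset.univ) fun i _ =>
    HasDerivWithinAt.fun_sum (u := Finset.univ) fun j _ =>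
      ((hg i j).fun_mul (hv i)).fun_mul (hv j)).div_const 2).fun_add hU
  simp only [hE]
  refine hd.congr_deriv ?_
  have hpos := L.g_posDef _ hx
  have hsymm : ∀ i j, L.g (x t) i j = L.g (x t) j i := fun i j => by
    simpa using (hpos.1.apply i j).symm
  have key := energy_algebra hpos (F := L.magnetic (x t))
    (by ext i j; simp [magnetic]) (fun k i j => partialDeriv k (fun z => L.g z i j) (x t))
    (fun k => partialDeriv k L.U (x t)) (v t) a (by
      have hgrad : (∇ L.U (x t)).ofLp = fun k => partialDeriv k L.U (x t) := by
        ext k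
        rw [partialDeriv, ← inner_gradient_left, EuclideanSpace.inner_single_right]
        simp
      rw [ha, ← hgrad]
      ext k
      simp [eulerLagrange, christoffel, Matrix.toLpLin_apply])
  have e1 : v t ⬝ᵥ (L.g (x t) *ᵥ a) = (∑ i, ∑ j, (L.g (x t) i j * a i * v t j
      + L.g (x t) i j * v t i * a j)) / 2 := by
    simp only [Finset.sum_add_distrib, dotProduct, Matrix.mulVec, Finset.mul_sum]
    have : (∑ i, ∑ j, L.g (x t) i j * a i * v t j) = ∑ i, ∑ j, v t i * (L.g (x t) i j * a j) := by
      rw [Finset.sum_comm]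
      refine Finset.sum_congr rfl fun i _ => Finset.sum_congr rfl fun j _ => ?_
      rw [hsymm]; ring
    rw [this]
    have : (∑ i, ∑ j, L.g (x t) i j * v t i * a j) = ∑ i, ∑ j, v t i * (L.g (x t) i j * a j) :=
      Finset.sum_congr rfl fun i _ => Finset.sum_congr rfl fun j _ => by ring
    rw [this]; ring
  rw [e1] at key
  have e2 : (∑ i, ∑ j, ((c * (∑ k, v t k * partialDeriv k (fun z => L.g z i j) (x t)) * v t i
      + L.g (x t) i j * (c * a i)) * v t j + L.g (x t) i j * v t i * (c * a j)))
      = c * ((∑ i, ∑ j, (L.g (x t) i j * a i * v t j + L.g (x t) i j * v t i * a j))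
        + ∑ i, ∑ j, (∑ k, v t k * partialDeriv k (fun z => L.g z i j) (x t)) * v t i * v t j) := by
    rw [← Finset.sum_add_distrib, Finset.mul_sum]
    refine Finset.sum_congr rfl fun i _ => ?_
    rw [← Finset.sum_add_distrib, Finset.mul_sum]
    exact Finset.sum_congr rfl fun j _ => by ring
  rw [e2]
  simp only [dotProduct] at key
  linear_combination c * key

end LagrangianSystem
end McGehee

namespace McGehee
namespace LagrangianSystem

variable {n : ℕ} {L : LagrangianSystem n}

/-! ### Orbits of zero energy -/

theorem IsSolutionOn.isIntegralCurveOn {γ : ℝ → Amb n} {I : Set ℝ} (h : L.IsSolutionOn γ I) :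
    IsIntegralCurveOn γ (fun _ => L.field) I := fun t ht => (h t ht).2

theorem IsSolutionOn.mono {γ : ℝ → Amb n} {I J : Set ℝ} (h : L.IsSolutionOn γ I) (hJ : J ⊆ I) :
    L.IsSolutionOn γ J := fun t ht => ⟨(h t (hJ ht)).1, (h t (hJ ht)).2.mono hJ⟩

theorem IsSolutionOn.mem_interiorM {γ : ℝ → Amb n} {a b : ℝ} (h : L.IsSolutionOn γ (uIcc a b))
    (ha : 0 < (γ a).1) : γ b ∈ L.interiorM := by
  obtain ⟨c, hc, hcb⟩ := exists_pos_fst_eq h.isIntegralCurveOn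
  have h1 := (h b right_mem_uIcc).1
  have h2 : 0 < (γ b).1 := hcb ▸ mul_pos hc ha
  exact ⟨h2, (abs_of_pos h2) ▸ h1.1, h1.2⟩

theorem orbit_subset_interiorM {z : Amb n} (hz : 0 < z.1) : L.orbit z ⊆ L.interiorM := by
  rintro w ⟨γ, t, h, rfl, rfl⟩
  exact h.mem_interiorM hz

theorem IsSolutionOn.energy_eq (hmag : L.WeakMagnetism) {γ : ℝ → Amb n} {a b : ℝ}
    (h : L.IsSolutionOn γ (uIcc a b)) (ha : 0 < (γ a).1) :
    L.energy (L.blowdown (γ b)) = L.energy (L.blowdown (γ a)) := by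
  have hpos : ∀ t ∈ uIcc a b, γ t ∈ L.interiorM := fun t ht =>
    (h.mono (uIcc_subset_uIcc_left ht)).mem_interiorM ha
  have hder : ∀ t ∈ uIcc a b, HasDerivWithinAt (fun t => L.energy (L.blowdown (γ t))) 0
      (uIcc a b) t := by
    intro t ht
    obtain ⟨h1, h2⟩ := L.field_pushforward hmag (hpos t ht)
    have h3 := h1.comp_hasDerivWithinAt t (h t ht).2
    rw [h2] at h3
    have h4 := (ContinuousLinearMap.fst ℝ (Vec n) (Vec n)).hasFDerivAt.comp_hasDerivWithinAt t h3
    have h5 := (ContinuousLinearMap.snd ℝ (Vec n) (Vec n)).hasFDerivAt.comp_hasDerivWithinAt t h3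
    refine hasDerivWithinAt_energy (x := fun t => (L.blowdown (γ t)).1)
      (v := fun t => (L.blowdown (γ t)).2) ?_ h4 h5
    exact L.extendedManifold_subset_domain (h t ht).1
  have key : ∀ {c d : ℝ}, c ≤ d → (∀ t ∈ Icc c d,
      HasDerivWithinAt (fun t => L.energy (L.blowdown (γ t))) 0 (Icc c d) t) →
      L.energy (L.blowdown (γ d)) = L.energy (L.blowdown (γ c)) := fun {c d} hcd hd => by
    have := eq_mul_exp_of_hasDerivWithinAt (p := fun t => L.energy (L.blowdown (γ t)))
      (c := fun _ => 0) continuousOn_const (fun t ht => by simpa using hd t ht)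
      (right_mem_Icc.2 hcd)
    simpa using this
  rcases le_total a b with hab | hab
  · rw [uIcc_of_le hab] at hder
    exact key hab hder
  · rw [uIcc_of_ge hab] at hder
    exact (key hab hder).symm

theorem continuousAt_energy : ContinuousAt L.energy 0 := by
  set s : Set (Vec n × Vec n) := {z | z.1 ∈ Metric.ball (0 : Vec n) L.rE} with hs
  have hso : IsOpen s := Metric.isOpen_ball.preimage continuous_fst
  have h0 : (0 : Vec n × Vec n) ∈ s := Metric.mem_ball_self L.rE_pos
  have hU : ContinuousOn (fun z : Vec n × Vec n => L.U z.1) s :=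
    L.U_analytic.continuousOn.comp continuous_fst.continuousOn fun z hz => hz
  have hg : ContDiffOn ℝ 0 (fun z : Vec n × Vec n => (L.g z.1).toEuclideanLin z.2) s :=
    contDiffOn_toEuclideanLin (fun i j => contDiffOn_zero.2
      ((L.g_analytic i j).continuousOn.comp continuous_fst.continuousOn fun z hz => hz))
      contDiff_snd.contDiffOn
  exact (((ContinuousOn.inner continuous_snd.continuousOn hg.continuousOn).div_const 2).add
    hU).continuousAt (hso.mem_nhds h0)

theorem tendsto_energy_blowdown {ζ : Amb n} (hζ : ζ.1 = 0) :
    Tendsto (fun z => L.energy (L.blowdown z)) (𝓝 ζ) (𝓝 0) := by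
  have hl : (0 : ℝ) < L.l / 2 := by
    have : (0 : ℝ) < L.l := by exact_mod_cast L.one_le_l
    positivity
  have hb : ContinuousAt L.blowdown ζ := by
    have h1 : Continuous fun z : Amb n => z.1 ^ ((L.l : ℝ) / 2) :=
      continuous_fst.rpow_const fun _ => Or.inr hl.le
    have h2 : Continuous L.blowdown := by
      unfold blowdown
      exact (by fun_prop : Continuous fun z : Amb n => z.1 • z.2.1).prodMk
        (h1.smul (by fun_prop))
    exact h2.continuousAt
  have h0 : L.blowdown ζ = 0 := by
    simp [blowdown, hζ, Real.zero_rpow hl.ne']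
  have h1 : L.energy 0 = 0 := by simp [energy, L.U_zero]
  have h2 : ContinuousAt L.energy (L.blowdown ζ) := h0 ▸ continuousAt_energy
  have h3 := h2.tendsto.comp hb.tendsto
  rw [h0, h1] at h3
  exact h3

/-- The energy is constant on the orbit and tends to `0`, its value at the origin. -/
theorem rescaledEnergy_eq_zero_of_mem_orbit (hmag : L.WeakMagnetism) {ζ z w : Amb n}
    (hζ : ζ.1 = 0) (hz : z ∈ L.stableManifold ζ) (hz0 : 0 < z.1) (hw : w ∈ L.orbit z) :
    L.rescaledEnergy w = 0 := by
  obtain ⟨γ, hγ, rfl, hlim⟩ := hz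
  have h1 : L.energy (L.blowdown (γ 0)) = 0 := by
    have h2 : Tendsto (fun t => L.energy (L.blowdown (γ t))) atTop (𝓝 0) :=
      (tendsto_energy_blowdown hζ).comp hlim
    refine tendsto_nhds_unique tendsto_const_nhds (h2.congr' ?_)
    filter_upwards [eventually_ge_atTop 0] with t ht
    refine (hγ.mono ?_).energy_eq hmag hz0
    rw [uIcc_of_le ht]
    exact Icc_subset_Ici_self
  obtain ⟨η, t, h, h0, rfl⟩ := hw
  have h2 := h.energy_eq hmag (h0 ▸ hz0)
  have h3 : 0 < (η t).1 := (h.mem_interiorM (h0 ▸ hz0)).1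
  rw [rescaledEnergy, if_neg h3.ne', h2, h0, h1, mul_zero]

theorem exists_norm_le_mem {E F : Type*} [NormedAddCommGroup E] [NormedSpace ℝ E]
    [NormedAddCommGroup F] [NormedSpace ℝ F] (e : E ≃L[ℝ] F) {ζ : E} {N : Set E} (hN : N ∈ 𝓝 ζ) :
    ∃ δ > 0, ∀ z, ‖e (z - ζ)‖ ≤ δ → z ∈ N := by
  have h1 : Tendsto (fun w => ζ + e.symm w) (𝓝 0) (𝓝 ζ) :=
    Continuous.tendsto' (by fun_prop) _ _ (by simp)
  obtain ⟨δ, hδ, h2⟩ := Metric.nhds_basis_closedBall.mem_iff.1 (h1 hN)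
  refine ⟨δ, hδ, fun z hz => ?_⟩
  simpa using h2 (mem_closedBall_zero_iff.2 hz)

theorem mem_nhds_of_neg {q : Vec n} {ν : ℝ} (h : L.IsFixed q ν) (hν : ν < 0) :
    {z : Amb n | |z.1| < L.rE ∧ inner ℝ z.2.1 z.2.2 < (0 : ℝ)} ∈ 𝓝 ((0, q, ν • q) : Amb n) := by
  have h1 : IsOpen {z : Amb n | |z.1| < L.rE ∧ inner ℝ z.2.1 z.2.2 < (0 : ℝ)} :=
    IsOpen.and (isOpen_lt (f := fun z : Amb n => |z.1|) (by fun_prop) continuous_const)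
      (isOpen_lt (f := fun z : Amb n => (inner ℝ z.2.1 z.2.2 : ℝ)) (by fun_prop) continuous_const)
  refine h1.mem_nhds ⟨by simpa using L.rE_pos, ?_⟩
  simp only [h.inner_smul]
  exact hν

/-- Integral curves that stay near a fixed point with `ν < 0` and converge to it lie on the
extended McGehee manifold. -/
theorem IsFixed.isSolutionOn {q : Vec n} {ν : ℝ} (h : L.IsFixed q ν) {γ : ℝ → Amb n}
    (hγ : IsIntegralCurveOn γ (fun _ => L.field) (Ici 0))
    (hN : ∀ t ∈ Ici (0 : ℝ), |(γ t).1| < L.rE ∧ inner ℝ (γ t).2.1 (γ t).2.2 < (0 : ℝ))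
    (hlim : Tendsto γ atTop (𝓝 (0, q, ν • q))) : L.IsSolutionOn γ (Ici 0) := by
  intro t ht
  have h1 : ‖((0, q, ν • q) : Amb n).2.1‖ = 1 := h.norm_eq
  exact ⟨⟨(hN t ht).1, norm_eq_one_of_tendsto hγ h1 hlim (fun s hs => (hN s hs).2.le) ht⟩, hγ t ht⟩

/-- There is a point of the stable manifold with `r > 0`. -/
theorem IsFixed.exists_mem_stableManifold (hmag : L.WeakMagnetism) {q : Vec n} {ν : ℝ}
    (h : L.IsFixed q ν) (hker : LinearMap.ker (sphereHess L.Ul q) = ⊥) (hν : ν < 0) :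
    ∃ z ∈ L.stableManifold (0, q, ν • q), 0 < z.1 := by
  obtain ⟨S, U, _, _, _, _, _, _, e, As, Au, α, K, hα, hK, hAs, hAu, he, he1, -⟩ :=
    h.exists_splitting hmag hker (s := 1) (by norm_num) (by linarith)
  simp only [one_smul] at he
  set E := e.toContinuousLinearEquiv with hE
  obtain ⟨ε, hε, H⟩ := exists_stable_integralCurve
    (hasStrictFDerivAt_field hmag (L.mem_domain_of_fst_eq_zero rfl)) (h.field_eq_zero hmag) E he hα
    hAs hAu
  obtain ⟨δ, hδ, hδN⟩ := exists_norm_le_mem E (mem_nhds_of_neg h hν)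
  set ρ := min (ε / 2) (δ / 2) with hρ
  have hρ0 : 0 < ρ := by positivity
  have hnorm : ‖((ρ, 0) : ℝ × S)‖ = ρ := by simp [Prod.norm_def, hρ0.le]
  obtain ⟨γ, h1, h2, h3, h4⟩ := H (ρ, 0) (by
    rw [hnorm]; exact (min_le_left _ _).trans_lt (by linarith))
  have h5 : ∀ t ∈ Ici (0 : ℝ), ‖E (γ t - (0, q, ν • q))‖ ≤ δ := fun t ht =>
    (h3 t ht).trans (by rw [hnorm]; linarith [min_le_right (ε / 2) (δ / 2)])
  refine ⟨γ 0, ⟨γ, h.isSolutionOn h2 (fun t ht => hδN _ (h5 t ht)) h4, rfl, h4⟩, ?_⟩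
  have h6 := he1 (γ 0 - (0, q, ν • q))
  have h7 : (e (γ 0 - (0, q, ν • q))).1.1 = ρ := congrArg Prod.fst h1
  rw [h7] at h6
  simp only [Prod.fst_sub, sub_zero] at h6
  exact pos_of_mul_pos_right (h6 ▸ hρ0) hK.le

theorem IsFixed.exists_stable_orbit (hmag : L.WeakMagnetism) {q : Vec n} {ν : ℝ}
    (h : L.IsFixed q ν) (hker : LinearMap.ker (sphereHess L.Ul q) = ⊥) (hν : ν < 0) :
    ∃ z ∈ L.stableManifold (0, q, ν • q),
        L.orbit z ⊆ L.interiorM ∧ ∀ w ∈ L.orbit z, L.rescaledEnergy w = 0 := by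
  obtain ⟨z, hz, hz0⟩ := h.exists_mem_stableManifold hmag hker hν
  exact ⟨z, hz, orbit_subset_interiorM hz0, fun w hw =>
    rescaledEnergy_eq_zero_of_mem_orbit hmag rfl hz hz0 hw⟩

/-! ### Time reversal -/

/-- The system with the opposite magnetic field. -/
noncomputable def neg (L : LagrangianSystem n) : LagrangianSystem n :=
  { L with
    A := fun x => -L.A x
    A_analytic := L.A_analytic.neg }

/-- Time reversal `(r, q, y) ↦ (r, q, -y)`. -/
noncomputable def reversal (n : ℕ) : Amb n ≃L[ℝ] Amb n :=
  (ContinuousLinearEquiv.refl ℝ ℝ).prodCongr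
    ((ContinuousLinearEquiv.refl ℝ (Vec n)).prodCongr (ContinuousLinearEquiv.neg ℝ))

theorem reversal_apply (ζ : Amb n) : reversal n ζ = (ζ.1, ζ.2.1, -ζ.2.2) := rfl

theorem reversal_reversal (ζ : Amb n) : reversal n (reversal n ζ) = ζ := by
  simp [reversal_apply]

theorem neg_neg (L : LagrangianSystem n) : L.neg.neg = L := by
  simp [neg]

theorem neg_d : L.neg.d = L.d := by
  have : (fun x => -L.A x) = -L.A := rfl
  simp only [d, jetDegree, neg, this, iteratedFDeriv_neg, ne_eq]
  simp

theorem neg_weakMagnetism (hmag : L.WeakMagnetism) : L.neg.WeakMagnetism := by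
  intro h
  have h1 := hmag fun h0 => h (by
    filter_upwards [h0] with x hx
    simp [neg, hx])
  rw [neg_d]
  exact h1

theorem neg_magnetic (x : Vec n) : L.neg.magnetic x = -L.magnetic x := by
  ext a b
  have h : ∀ b, (fun z => (-L.A z) b) = -fun z => L.A z b := fun b => rfl
  simp only [magnetic, partialDeriv, neg, Matrix.of_apply, Matrix.neg_apply, h, fderiv_neg]
  simp
  ring

theorem neg_field (ζ : Amb n) : L.neg.field (reversal n ζ) = -reversal n (L.field ζ) := by
  have h1 : ∀ x v : Vec n, L.neg.christoffel x v = L.christoffel x v := fun x v => rfl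
  have h2 : L.christoffel (ζ.1 • ζ.2.1) (-ζ.2.2) = L.christoffel (ζ.1 • ζ.2.1) ζ.2.2 := by
    have := L.christoffel_smul (ζ.1 • ζ.2.1) ζ.2.2 (-1)
    simpa using this
  have h3 : L.neg.correction (reversal n ζ) = L.correction ζ := by
    simp only [correction, reversal_apply, h1, h2]
    rfl
  have h4 : L.neg.magneticCorrection (reversal n ζ) = L.magneticCorrection ζ := by
    simp only [magneticCorrection, reversal_apply, neg_magnetic, neg_d]
    simp
    rfl
  have h5 : L.neg.magneticFactor = L.magneticFactor := by
    funext r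
    simp only [magneticFactor, neg_d]
    rfl
  have hl : L.neg.l = L.l := rfl
  have hU : L.neg.Ul = L.Ul := rfl
  refine Prod.ext ?_ (Prod.ext ?_ ?_)
  · simp [field, reversal_apply]
  · simp [field, reversal_apply]
    abel
  · simp only [field, h3, h4, h5, hl, hU]
    simp [reversal_apply]
    abel

theorem IsSolutionOn.reverse {γ : ℝ → Amb n} {I J : Set ℝ} (h : L.IsSolutionOn γ I)
    (hJ : ∀ t ∈ J, -t ∈ I) : L.neg.IsSolutionOn (fun t => reversal n (γ (-t))) J := fun t ht => by
  obtain ⟨h1, h2⟩ := h (-t) (hJ t ht)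
  refine ⟨h1, ?_⟩
  have h3 : HasDerivWithinAt (fun t : ℝ => -t) (-1) J t := (hasDerivAt_neg t).hasDerivWithinAt
  have h4 := h2.scomp t h3 hJ
  have h5 := (reversal n).hasFDerivAt.comp_hasDerivWithinAt t h4
  rw [neg_field]
  simpa using! h5

theorem reversal_mem_stableManifold {ζ w : Amb n} (h : w ∈ L.unstableManifold ζ) :
    reversal n w ∈ L.neg.stableManifold (reversal n ζ) := by
  obtain ⟨γ, h1, rfl, h2⟩ := h
  refine ⟨fun t => reversal n (γ (-t)), h1.reverse fun t ht => ?_, by simp, ?_⟩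
  · exact neg_nonpos.2 (mem_Ici.1 ht)
  · exact ((reversal n).continuous.tendsto ζ).comp (h2.comp tendsto_neg_atTop_atBot)

theorem reversal_mem_unstableManifold {ζ w : Amb n} (h : w ∈ L.stableManifold ζ) :
    reversal n w ∈ L.neg.unstableManifold (reversal n ζ) := by
  obtain ⟨γ, h1, rfl, h2⟩ := h
  refine ⟨fun t => reversal n (γ (-t)), h1.reverse fun t ht => ?_, by simp, ?_⟩
  · exact neg_nonneg.2 (mem_Iic.1 ht)
  · exact ((reversal n).continuous.tendsto ζ).comp (h2.comp tendsto_neg_atBot_atTop)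

/-- Time reversal exchanges stable and unstable manifolds. -/
theorem unstableManifold_eq (L : LagrangianSystem n) (ζ : Amb n) :
    L.unstableManifold ζ = reversal n ⁻¹' L.neg.stableManifold (reversal n ζ) := by
  ext w
  refine ⟨reversal_mem_stableManifold, fun h => ?_⟩
  have := reversal_mem_unstableManifold h
  rwa [neg_neg, reversal_reversal, reversal_reversal] at this

theorem reversal_mem_orbit {z w : Amb n} (h : w ∈ L.orbit z) :
    reversal n w ∈ L.neg.orbit (reversal n z) := by
  obtain ⟨γ, t, h1, rfl, rfl⟩ := h
  refine ⟨fun s => reversal n (γ (-s)), -t, h1.reverse fun s hs => ?_, by simp, by simp⟩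
  simpa using (Set.neg_mem_neg.2 hs : -s ∈ -uIcc 0 (-t))

theorem blowdown_reversal (ζ : Amb n) :
    L.neg.blowdown (reversal n ζ) = ((L.blowdown ζ).1, -(L.blowdown ζ).2) := by
  simp [blowdown, reversal_apply]
  rfl

theorem rescaledEnergy_reversal (ζ : Amb n) :
    L.neg.rescaledEnergy (reversal n ζ) = L.rescaledEnergy ζ := by
  have h1 : L.neg.energy (L.neg.blowdown (reversal n ζ)) = L.energy (L.blowdown ζ) := by
    rw [blowdown_reversal]
    simp [energy]
    rfl
  simp only [rescaledEnergy, h1]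
  simp [reversal_apply]
  rfl

theorem IsFixed.neg {q : Vec n} {ν : ℝ} (h : L.IsFixed q ν) : L.neg.IsFixed q (-ν) :=
  ⟨h.norm_eq, by rw [neg_sq]; exact h.gradient_eq, neg_ne_zero.2 h.ne_zero⟩

theorem IsFixed.exists_unstable_orbit (hmag : L.WeakMagnetism) {q : Vec n} {ν : ℝ}
    (h : L.IsFixed q ν) (hker : LinearMap.ker (sphereHess L.Ul q) = ⊥) (hν : 0 < ν) :
    ∃ z ∈ L.unstableManifold (0, q, ν • q),
        L.orbit z ⊆ L.interiorM ∧ ∀ w ∈ L.orbit z, L.rescaledEnergy w = 0 := by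
  obtain ⟨z, h1, h2, h3⟩ := h.neg.exists_stable_orbit (neg_weakMagnetism hmag) hker (by linarith)
  have hz : reversal n (0, q, ν • q) = (0, q, (-ν) • q) := by simp [reversal_apply]
  refine ⟨reversal n z, ?_, fun w hw => ?_, fun w hw => ?_⟩
  · rw [unstableManifold_eq, mem_preimage, reversal_reversal, hz]
    exact h1
  · have := h2 (by simpa [reversal_reversal] using reversal_mem_orbit hw)
    exact this
  · have := h3 _ (by simpa [reversal_reversal] using reversal_mem_orbit hw)
    rwa [rescaledEnergy_reversal] at this

end LagrangianSystem
end McGehee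

namespace McGehee
namespace LagrangianSystem

variable {n : ℕ} {L : LagrangianSystem n}

/-! ### The stable manifold of a sink of the boundary flow -/

theorem bdry_subset_extendedManifold : L.bdry ⊆ L.extendedManifold := fun ζ hζ =>
  ⟨by rw [hζ.1, abs_zero]; exact L.rE_pos, hζ.2⟩

/-- The boundary is invariant. -/
theorem mem_bdry_of_integralCurve {γ : ℝ → Amb n} {I : Set ℝ}
    (h : IsIntegralCurveOn γ (fun _ => L.field) I) (hI : I.OrdConnected) {a b : ℝ} (haI : a ∈ I)
    (hbI : b ∈ I) (ha : γ a ∈ L.bdry) : γ b ∈ L.bdry := by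
  have h1 := h.mono (hI.uIcc_subset haI hbI)
  obtain ⟨c, -, hc⟩ := exists_pos_fst_eq h1
  exact ⟨by rw [hc, ha.1, mul_zero], norm_eq_one_of_integralCurve h1 ha.2⟩

theorem isSolutionOn_of_mem_bdry {γ : ℝ → Amb n} {I : Set ℝ}
    (h : IsIntegralCurveOn γ (fun _ => L.field) I) (hI : I.OrdConnected) {a : ℝ} (haI : a ∈ I)
    (ha : γ a ∈ L.bdry) : L.IsSolutionOn γ I := fun t ht =>
  ⟨bdry_subset_extendedManifold (mem_bdry_of_integralCurve h hI haI ht ha), h t ht⟩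

theorem IsSolutionOn.concat {f g : ℝ → Amb n} {I J : Set ℝ} {b : ℝ}
    (hf : L.IsSolutionOn f I) (hg : L.IsSolutionOn g J) (hI : I ⊆ Iic b)
    (hJ : J ⊆ Ici b) (hbI : b ∈ I) (hbJ : b ∈ J) (hfg : f b = g b) :
    L.IsSolutionOn (fun t => if t ≤ b then f t else g t) (I ∪ J) := fun t ht => by
  refine ⟨?_, hf.isIntegralCurveOn.concat hg.isIntegralCurveOn hI hJ hbI hbJ hfg t ht⟩
  rcases ht with h | h
  · have h1 : t ≤ b := hI h
    simpa [h1] using (hf t h).1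
  · rcases (show b ≤ t from hJ h).eq_or_lt with rfl | h1
    · simpa using (hf b hbI).1
    · simpa [not_le.2 h1] using (hg t h).1

theorem IsSolutionOn.comp_add_const {γ : ℝ → Amb n} {I J : Set ℝ} (h : L.IsSolutionOn γ I) (c : ℝ)
    (hJ : ∀ t ∈ J, t + c ∈ I) : L.IsSolutionOn (fun t => γ (t + c)) J := fun t ht =>
  ⟨(h _ (hJ t ht)).1, h.isIntegralCurveOn.comp_add_const c hJ t ht⟩

/-- Points that flow into the stable manifold belong to it. -/
theorem IsSolutionOn.mem_stableManifold {γ : ℝ → Amb n} {T : ℝ} {ζ : Amb n} (hT : 0 ≤ T)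
    (h : L.IsSolutionOn γ (Icc 0 T)) (hmem : γ T ∈ L.stableManifold ζ) :
    γ 0 ∈ L.stableManifold ζ := by
  obtain ⟨η, h1, h2, h3⟩ := hmem
  have h4 : L.IsSolutionOn (fun t => η (t + -T)) (Ici T) :=
    h1.comp_add_const _ fun t ht => by simpa using mem_Ici.1 ht
  refine ⟨fun t => if t ≤ T then γ t else η (t + -T), ?_, by simp [hT], ?_⟩
  · have := h.concat h4 Icc_subset_Iic_self Subset.rfl (right_mem_Icc.2 hT) self_mem_Ici
      (by simp [h2])
    rwa [Icc_union_Ici_eq_Ici hT] at this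
  · have h5 : Tendsto (fun t => η (t + -T)) atTop (𝓝 ζ) :=
      h3.comp (tendsto_atTop_add_const_right _ _ tendsto_id)
    refine h5.congr' ?_
    filter_upwards [eventually_gt_atTop T] with t ht
    simp [not_le.2 ht]

theorem mem_stableManifold_of_isSolutionOn {γ : ℝ → Amb n} {T : ℝ} {ζ : Amb n}
    (h : L.IsSolutionOn γ (Ici T)) (hlim : Tendsto γ atTop (𝓝 ζ)) : γ T ∈ L.stableManifold ζ :=
  ⟨fun t => γ (t + T), h.comp_add_const T fun t ht => by simpa using mem_Ici.1 ht, by simp,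
    hlim.comp (tendsto_atTop_add_const_right _ _ tendsto_id)⟩

/-- Where `⟨q, y⟩ > 0` the boundary is repelling. -/
theorem fst_eq_zero_of_tendsto {γ : ℝ → Amb n} {ζ : Amb n}
    (h : IsIntegralCurveOn γ (fun _ => L.field) (Ici 0)) (hζ : ζ.1 = 0)
    (hpos : 0 < (inner ℝ ζ.2.1 ζ.2.2 : ℝ)) (hlim : Tendsto γ atTop (𝓝 ζ)) : (γ 0).1 = 0 := by
  have hev : ∀ᶠ z in 𝓝 ζ, 0 < (inner ℝ z.2.1 z.2.2 : ℝ) :=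
    (ContinuousAt.eventually_lt (f := fun _ => (0 : ℝ)) (by fun_prop)
      (g := fun z : Amb n => (inner ℝ z.2.1 z.2.2 : ℝ)) (by fun_prop) hpos)
  obtain ⟨T, hT⟩ := eventually_atTop.1 ((hlim.eventually hev).and (eventually_ge_atTop 0))
  have hT0 : 0 ≤ T := (hT T le_rfl).2
  have hlim1 : Tendsto (fun t => |(γ t).1|) atTop (𝓝 0) := by
    have h1 : Continuous fun z : Amb n => |z.1| := by fun_prop
    have h2 := (h1.tendsto ζ).comp hlim
    rw [hζ, abs_zero] at h2
    exact h2
  have hge : ∀ t ≥ T, |(γ T).1| ≤ |(γ t).1| := fun t ht => by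
    rw [fst_eq_mul_exp (h.mono fun s hs => hT0.trans hs.1) (right_mem_Icc.2 ht), abs_mul,
      abs_of_pos (Real.exp_pos _)]
    refine le_mul_of_one_le_right (abs_nonneg _) (Real.one_le_exp ?_)
    refine intervalIntegral.integral_nonneg ht fun s hs => ?_
    have := (hT s hs.1).1
    linarith
  have h0 : (γ T).1 = 0 := abs_nonpos_iff.1 (ge_of_tendsto hlim1 ((eventually_ge_atTop T).mono hge))
  obtain ⟨c, hc, hcT⟩ := exists_pos_fst_eq (a := 0) (b := T) (h.mono (by
    rw [uIcc_of_le hT0]; exact Icc_subset_Ici_self))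
  rw [h0] at hcT
  exact (mul_eq_zero.1 hcT.symm).resolve_left hc.ne'

variable {q : Vec n} {ν : ℝ}

theorem IsFixed.stableManifold_subset_bdry (h : L.IsFixed q ν) (hν : 0 < ν) :
    L.stableManifold (0, q, ν • q) ⊆ L.bdry := by
  rintro w ⟨γ, h1, rfl, h2⟩
  refine ⟨fst_eq_zero_of_tendsto h1.isIntegralCurveOn rfl ?_ h2, (h1 0 self_mem_Ici).1.2⟩
  simp only [h.inner_smul]
  exact hν

/-- Over a local minimum, the fixed point with `ν > 0` attracts a neighborhood in the boundary. -/
theorem IsFixed.exists_basin (hmag : L.WeakMagnetism) (h : L.IsFixed q ν)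
    (hker : LinearMap.ker (sphereHess L.Ul q) = ⊥) (hν : 0 < ν)
    (hmin : IsLocalMinOn L.Ul (Metric.sphere 0 1) q) :
    ∃ B : Set (Amb n), IsOpen B ∧ (0, q, ν • q) ∈ B ∧
      B ∩ L.bdry ⊆ L.stableManifold (0, q, ν • q) := by
  obtain ⟨S, U, _, _, _, _, _, _, e, As, Au, α, K, hα, hK, hAs, hAu, he, he1, hS⟩ :=
    h.exists_splitting hmag hker (s := -1) (by norm_num) (by linarith)
  have := hS hmin
  set E := (e.trans (LinearEquiv.prodComm ℝ _ _)).toContinuousLinearEquiv with hE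
  have hE1 : ∀ v, E v = ((e v).2, (e v).1) := fun v => rfl
  have hEv : ∀ v, E (fderiv ℝ L.field (0, q, ν • q) v) = ((-Au) (E v).1, (-As) (E v).2) := by
    intro v
    have h1 := he v
    rw [map_smul, neg_smul, one_smul, neg_eq_iff_eq_neg] at h1
    simp [hE1, h1]
  obtain ⟨ε, hε, H⟩ := exists_stable_integralCurve
    (hasStrictFDerivAt_field hmag (L.mem_domain_of_fst_eq_zero rfl)) (h.field_eq_zero hmag) E hEv
    (α := α / 2) (by positivity) (hAu.neg hα) (hAs.neg hα)
  refine ⟨{w | ‖(E (w - (0, q, ν • q))).1‖ < ε}, isOpen_lt (by fun_prop) continuous_const,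
    by simpa using hε, ?_⟩
  rintro w ⟨hw, hwb⟩
  obtain ⟨γ, h1, h2, h3, h4⟩ := H _ hw
  have hr : (γ 0).1 = 0 := fst_eq_zero_of_tendsto h2 rfl (by simp only [h.inner_smul]; exact hν) h4
  -- the only coordinate that is not prescribed is the multiple of `r`, which vanishes
  have hw0 : γ 0 = w := by
    have : E (γ 0 - (0, q, ν • q)) = E (w - (0, q, ν • q)) := by
      refine Prod.ext h1 (Prod.ext ?_ (Subsingleton.elim _ _))
      rw [hE1, hE1, he1, he1]
      simp [hr, hwb.1]
    exact sub_left_injective (E.injective this)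
  exact ⟨γ, isSolutionOn_of_mem_bdry h2 ordConnected_Ici self_mem_Ici (hw0 ▸ hwb), hw0, h4⟩

/-- Over a local minimum, the stable manifold of the fixed point with `ν > 0` is open in the
boundary: solutions starting nearby are carried into the basin. -/
theorem IsFixed.isOpenSubsetOf_stableManifold (hmag : L.WeakMagnetism) (h : L.IsFixed q ν)
    (hker : LinearMap.ker (sphereHess L.Ul q) = ⊥) (hν : 0 < ν)
    (hmin : IsLocalMinOn L.Ul (Metric.sphere 0 1) q) :
    IsOpenSubsetOf (L.stableManifold (0, q, ν • q)) L.bdry := by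
  obtain ⟨B, hB, hζB, hBW⟩ := h.exists_basin hmag hker hν hmin
  have hsub := h.stableManifold_subset_bdry hν
  have key : ∀ w ∈ L.stableManifold (0, q, ν • q), ∃ δ > 0,
      Metric.ball w δ ∩ L.bdry ⊆ L.stableManifold (0, q, ν • q) := by
    intro w hw
    have hwb := hsub hw
    obtain ⟨γ, h1, rfl, h2⟩ := hw
    obtain ⟨T, hT⟩ := eventually_atTop.1
      ((h2.eventually (hB.mem_nhds hζB)).and (eventually_ge_atTop 0))
    obtain ⟨hTB, hT0⟩ := hT T le_rfl
    obtain ⟨ε, hε, hεB⟩ := Metric.isOpen_iff.1 hB _ hTB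
    obtain ⟨δ, hδ, hδ'⟩ := (h1.isIntegralCurveOn.mono
      (Icc_subset_Ici_self : Icc 0 T ⊆ Ici 0)).exists_nearby L.isOpen_domain
      (L.contDiffOn_field hmag) (fun t ht => L.extendedManifold_subset_domain (h1 t ht.1).1) hε
    refine ⟨δ, hδ, ?_⟩
    rintro x ⟨hx, hxb⟩
    obtain ⟨γ', rfl, g2, g3⟩ := hδ' x hx
    have hsol := isSolutionOn_of_mem_bdry g2 ordConnected_Icc (left_mem_Icc.2 hT0) hxb
    refine hsol.mem_stableManifold hT0 (hBW ⟨hεB (g3 T (right_mem_Icc.2 hT0)).1, ?_⟩)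
    exact mem_bdry_of_integralCurve g2 ordConnected_Icc (left_mem_Icc.2 hT0)
      (right_mem_Icc.2 hT0) hxb
  choose! δ hδ hδW using key
  refine ⟨hsub, ⋃ w ∈ L.stableManifold (0, q, ν • q), Metric.ball w (δ w),
    isOpen_biUnion fun w _ => Metric.isOpen_ball, ?_⟩
  refine Subset.antisymm (fun w hw => ⟨mem_biUnion hw (Metric.mem_ball_self (hδ w hw)), hsub hw⟩) ?_
  rintro x ⟨hx, hxb⟩
  obtain ⟨w, hw, hxw⟩ := mem_iUnion₂.1 hx
  exact hδW w hw ⟨hxw, hxb⟩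

theorem isOpenSubsetOf_inter {V : Type*} [TopologicalSpace V] {W S T : Set V}
    (h : IsOpenSubsetOf W S) (hT : T ⊆ S) :
    IsOpenSubsetOf (W ∩ T) T := by
  obtain ⟨-, O, hO, rfl⟩ := h
  refine ⟨inter_subset_right, O, hO, ?_⟩
  rw [inter_assoc, inter_eq_right.2 hT]

/-- Over a local minimum, the unstable manifold of the fixed point with `ν < 0` is open in the
boundary. -/
theorem IsFixed.isOpenSubsetOf_unstableManifold (hmag : L.WeakMagnetism) (h : L.IsFixed q ν)
    (hker : LinearMap.ker (sphereHess L.Ul q) = ⊥) (hν : ν < 0)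
    (hmin : IsLocalMinOn L.Ul (Metric.sphere 0 1) q) :
    IsOpenSubsetOf (L.unstableManifold (0, q, ν • q)) L.bdry := by
  have hz : reversal n (0, q, ν • q) = (0, q, (-ν) • q) := by simp [reversal_apply]
  obtain ⟨h1, O, hO, hW⟩ := h.neg.isOpenSubsetOf_stableManifold (neg_weakMagnetism hmag) hker
    (by linarith) hmin
  have hb : reversal n ⁻¹' L.neg.bdry = L.bdry := rfl
  rw [unstableManifold_eq, hz, hW]
  exact ⟨inter_subset_right, _, hO.preimage (reversal n).continuous, rfl⟩

end LagrangianSystem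
end McGehee

namespace McGehee
namespace LagrangianSystem

variable {n : ℕ} {L : LagrangianSystem n} {q : Vec n} {ν : ℝ}

/-! ### The local stable manifold over a local minimum -/

/-- Near `ζ` the stable manifold is a curve parametrized by `r`: a neighborhood of `0` consists of
values of `r` on it, solutions that remain near `ζ` are determined by their value of `r`, and `v`,
an eigenvector for the eigenvalue `ν` that is normalized by `dr(v) = 1`, is tangent to the curve
at `ζ`. -/
def IsLocalStableCurve (L : LagrangianSystem n) (ζ : Amb n) (ν : ℝ) (v : Amb n) : Prop :=
  v.1 = 1 ∧ fderiv ℝ L.field ζ v = ν • v ∧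
    (∃ δ > 0, ∀ ρ : ℝ, |ρ| < δ → ∃ γ : ℝ → Amb n, L.IsSolutionOn γ (Ici 0) ∧ (γ 0).1 = ρ ∧
      Tendsto γ atTop (𝓝 ζ)) ∧
    (∃ N ∈ 𝓝 ζ, ∀ γ γ' : ℝ → Amb n,
      IsIntegralCurveOn γ (fun _ => L.field) (Ici 0) →
      IsIntegralCurveOn γ' (fun _ => L.field) (Ici 0) → (∀ t ∈ Ici (0 : ℝ), γ t ∈ N) →
      (∀ t ∈ Ici (0 : ℝ), γ' t ∈ N) → (γ 0).1 = (γ' 0).1 → γ 0 = γ' 0) ∧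
    ∀ κ > 0, ∃ N ∈ 𝓝 ζ, ∀ γ : ℝ → Amb n,
      IsIntegralCurveOn γ (fun _ => L.field) (Ici 0) → (∀ t ∈ Ici (0 : ℝ), γ t ∈ N) →
      ‖γ 0 - ζ - (γ 0).1 • v‖ ≤ κ * |(γ 0).1|

/-- Over a local minimum, the contracting directions of a fixed point with `ν < 0` reduce to the
eigenvector of the eigenvalue `ν`, which is transversal to the boundary. -/
theorem IsFixed.exists_isLocalStableCurve (hmag : L.WeakMagnetism) (h : L.IsFixed q ν)
    (hker : LinearMap.ker (sphereHess L.Ul q) = ⊥) (hν : ν < 0)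
    (hmin : IsLocalMinOn L.Ul (Metric.sphere 0 1) q) :
    ∃ v : Amb n, L.IsLocalStableCurve (0, q, ν • q) ν v := by
  obtain ⟨S, U, _, _, _, _, _, _, e, As, Au, α, K, hα, hK, hAs, hAu, he, he1, hS⟩ :=
    h.exists_splitting hmag hker (s := 1) (by norm_num) (by linarith)
  have := hS hmin
  simp only [one_smul] at he
  set ζ : Amb n := (0, q, ν • q) with hζ
  set E := e.toContinuousLinearEquiv with hE
  have hE1 : ∀ v, E v = e v := fun v => rfl
  have hX := hasStrictFDerivAt_field hmag (L.mem_domain_of_fst_eq_zero (ζ := ζ) rfl)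
  have h0 := h.field_eq_zero hmag
  have hEfst : ∀ v, (E v).1 = (K * v.1, 0) := fun v => Prod.ext (he1 v) (Subsingleton.elim _ _)
  have hEfst_norm : ∀ v, ‖(E v).1‖ = K * |v.1| := fun v => by
    rw [hEfst, Prod.norm_def]
    simp [abs_of_pos hK]
    positivity
  have hball : ∀ δ > 0, {z | ‖E (z - ζ)‖ < δ} ∈ 𝓝 ζ := fun δ hδ =>
    (isOpen_lt (by fun_prop) continuous_const).mem_nhds (by simpa using hδ)
  set v : Amb n := E.symm ((K, 0), 0) with hv
  have hEv : E v = ((K, 0), 0) := by simp [hv]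
  have hv1 : v.1 = 1 := by
    have := congrArg (fun x => x.1.1) hEv
    rw [hE1] at this
    simp only [he1] at this
    field_simp at this
    exact this
  refine ⟨v, hv1, ?_, ?_, ?_, fun κ hκ => ?_⟩
  · refine E.injective (Prod.ext ?_ ?_)
    · rw [hEfst, hEfst, h.fderiv_field_apply hmag]
      simp
    · rw [hE1, he, map_smul, ← hE1, hEv]
      simp
  · obtain ⟨ε, hε, H⟩ := exists_stable_integralCurve hX h0 E he hα hAs hAu
    obtain ⟨δ, hδ, hδN⟩ := exists_norm_le_mem E (mem_nhds_of_neg h hν)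
    refine ⟨min ε (δ / 2) / K, by positivity, fun ρ hρ => ?_⟩
    rw [lt_div_iff₀ hK] at hρ
    have hnorm : ‖((K * ρ, 0) : ℝ × S)‖ = K * |ρ| := by
      rw [Prod.norm_def]
      simp [abs_of_pos hK]
      positivity
    obtain ⟨γ, h1, h2, h3, h4⟩ := H (K * ρ, 0) (by
      rw [hnorm, mul_comm]; exact hρ.trans_le (min_le_left _ _))
    have h5 : ∀ t ∈ Ici (0 : ℝ), ‖E (γ t - ζ)‖ ≤ δ := fun t ht =>
      (h3 t ht).trans (by rw [hnorm]; linarith [min_le_right ε (δ / 2)])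
    refine ⟨γ, h.isSolutionOn h2 (fun t ht => hδN _ (h5 t ht)) h4, ?_, h4⟩
    rw [hEfst] at h1
    have h6 := congrArg Prod.fst h1
    simpa [hζ, hK.ne'] using h6
  · obtain ⟨δ, hδ, H⟩ := exists_stable_cone hX h0 E he hα hAs hAu one_pos le_rfl
    refine ⟨_, hball δ hδ, fun γ γ' h1 h2 h3 h4 h5 => ?_⟩
    have h6 := H γ γ' h1 h2 (fun t ht => (h3 t ht).le) fun t ht => (h4 t ht).le
    have h7 : (E (γ 0 - γ' 0)).1 = 0 := by
      rw [hEfst, Prod.fst_sub, h5, sub_self, mul_zero]; rfl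
    rw [h7, norm_zero, mul_zero] at h6
    have h8 : E (γ 0 - γ' 0) = 0 := Prod.ext h7 (norm_le_zero_iff.1 h6)
    exact sub_eq_zero.1 (E.map_eq_zero_iff.1 h8)
  · set C := ‖(E.symm : (ℝ × S) × U →L[ℝ] Amb n)‖ with hC
    have hC0 : 0 ≤ C := norm_nonneg _
    obtain ⟨δ, hδ, H⟩ := exists_stable_cone hX h0 E he hα hAs hAu
      (κ := min 1 (κ / (C * K + 1))) (by positivity) (min_le_left _ _)
    refine ⟨_, hball δ hδ, fun γ h1 h3 => ?_⟩
    have h6 := H γ (fun _ => ζ) h1 (fun t _ => by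
      have : L.field ζ = 0 := h0
      simpa [this] using! hasDerivWithinAt_const t (Ici (0 : ℝ)) ζ) (fun t ht => (h3 t ht).le)
      fun t ht => by simpa using hδ.le
    set w := γ 0 - ζ - (γ 0).1 • v with hw
    have hw1 : (γ 0 - ζ).1 = (γ 0).1 := by simp [hζ]
    have h7 : E w = (0, (E (γ 0 - ζ)).2) := by
      refine Prod.ext ?_ ?_
      · rw [hEfst, hw, Prod.fst_sub, hw1]
        simp [hv1]
      · rw [hw, map_sub, map_smul, hEv]
        simp
    have h8 : ‖E w‖ ≤ κ / (C * K + 1) * (K * |(γ 0).1|) := by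
      rw [h7, Prod.norm_def, norm_zero, max_eq_right (norm_nonneg _)]
      rw [hEfst_norm, hw1] at h6
      exact h6.trans (by gcongr; exact min_le_right _ _)
    calc ‖w‖ = ‖(E.symm : (ℝ × S) × U →L[ℝ] Amb n) (E w)‖ := by simp
      _ ≤ C * (κ / (C * K + 1) * (K * |(γ 0).1|)) := ContinuousLinearMap.le_opNorm_of_le _ h8
      _ = C * K / (C * K + 1) * (κ * |(γ 0).1|) := by ring
      _ ≤ 1 * (κ * |(γ 0).1|) := by
          gcongr
          rw [div_le_one (by positivity)]
          linarith
      _ = _ := one_mul _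

/-! ### Maximal solutions -/

theorem IsSolutionOn.eqOn (hmag : L.WeakMagnetism) {f g : ℝ → Amb n} {I : Set ℝ}
    (hI : I.OrdConnected) (hf : L.IsSolutionOn f I) (hg : L.IsSolutionOn g I) {t₀ : ℝ}
    (ht₀ : t₀ ∈ I) (h : f t₀ = g t₀) : EqOn f g I :=
  hf.isIntegralCurveOn.eqOn L.isOpen_domain (L.contDiffOn_field hmag) hI hg.isIntegralCurveOn
    (fun t ht => L.extendedManifold_subset_domain (hf t ht).1)
    (fun t ht => L.extendedManifold_subset_domain (hg t ht).1) ht₀ h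

/-- Solutions on a closed half-line can be continued to earlier times. -/
theorem IsSolutionOn.exists_extension (hmag : L.WeakMagnetism) {γ : ℝ → Amb n} {a : ℝ}
    (h : L.IsSolutionOn γ (Ici a)) :
    ∃ a' < a, ∃ γ' : ℝ → Amb n, L.IsSolutionOn γ' (Ici a') ∧ EqOn γ' γ (Ici a) := by
  have ha := (h a self_mem_Ici).1
  obtain ⟨η, ε, hε, h0, hη⟩ := exists_isIntegralCurveOn_Ioo L.isOpen_domain
    (L.contDiffOn_field hmag) (L.extendedManifold_subset_domain ha) a
  have hcont : ContinuousAt η a := (hη a ⟨by linarith, by linarith⟩).2.continuousAt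
  have hev : ∀ᶠ t in 𝓝 a, |(η t).1| < L.rE := by
    have h1 : ContinuousAt (fun t => |(η t).1|) a := by fun_prop
    exact h1.eventually (gt_mem_nhds (by simpa only [h0] using ha.1))
  obtain ⟨δ, hδ, hδr⟩ := Metric.eventually_nhds_iff_ball.1 hev
  set m := min (ε / 2) (δ / 2) with hm
  have hm0 : 0 < m := by positivity
  have hm1 : m ≤ ε / 2 := min_le_left _ _
  have hm2 : m ≤ δ / 2 := min_le_right _ _
  have hint : IsIntegralCurveOn η (fun _ => L.field) (Icc (a - m) a) := fun t ht =>
    (hη t ⟨by linarith [ht.1], by linarith [ht.2]⟩).2.hasDerivWithinAt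
  have hsol : L.IsSolutionOn η (Icc (a - m) a) := fun t ht => by
    refine ⟨⟨hδr t ?_, ?_⟩, hint t ht⟩
    · rw [Real.ball_eq_Ioo]
      exact ⟨by linarith [ht.1], by linarith [ht.2]⟩
    · refine norm_eq_one_of_integralCurve (a := a) (hint.mono ?_) (by rw [h0]; exact ha.2)
      exact ordConnected_Icc.uIcc_subset (right_mem_Icc.2 (by linarith)) ht
  refine ⟨a - m, by linarith, fun t => if t ≤ a then η t else γ t, ?_, ?_⟩
  · have := hsol.concat h Icc_subset_Iic_self Subset.rfl (right_mem_Icc.2 (by linarith))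
      self_mem_Ici h0
    rwa [Icc_union_Ici_eq_Ici (by linarith)] at this
  · intro t ht
    rcases (mem_Ici.1 ht).eq_or_lt with rfl | h1
    · simp [h0]
    · simp [not_le.2 h1]

/-- The maximal backward continuation of a solution on a half-line. -/
theorem IsSolutionOn.exists_maximal (hmag : L.WeakMagnetism) {γ₀ : ℝ → Amb n}
    (h₀ : L.IsSolutionOn γ₀ (Ici 0)) :
    ∃ (I : Set ℝ) (Γ : ℝ → Amb n), IsOpen I ∧ IsUpperSet I ∧ (0 : ℝ) ∈ I ∧
      (∀ t ∈ I, L.IsSolutionOn Γ (Ici t)) ∧ (∀ t ∈ I, HasDerivAt Γ (L.field (Γ t)) t) ∧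
      EqOn Γ γ₀ (Ici 0) ∧
      ∀ a ≤ 0, ∀ γ, L.IsSolutionOn γ (Ici a) → EqOn γ γ₀ (Ici 0) → a ∈ I ∧ γ a = Γ a := by
  classical
  set Ext : ℝ → (ℝ → Amb n) → Prop := fun a γ => a ≤ 0 ∧ L.IsSolutionOn γ (Ici a) ∧
    EqOn γ γ₀ (Ici 0) with hExt
  set I : Set ℝ := {t | ∃ a < t, ∃ γ, Ext a γ} with hI
  have huniq : ∀ {a a' γ γ' t}, Ext a γ → Ext a' γ' → a ≤ t → a' ≤ t → γ t = γ' t := by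
    intro a a' γ γ' t h h' ht ht'
    have hsub := (h.2.1.mono (Ici_subset_Ici.2 (le_max_left a a')))
    have hsub' := (h'.2.1.mono (Ici_subset_Ici.2 (le_max_right a a')))
    refine hsub.eqOn hmag ordConnected_Ici hsub' (t₀ := 0) (max_le h.1 h'.1) ?_ (max_le ht ht')
    rw [h.2.2 self_mem_Ici, h'.2.2 self_mem_Ici]
  have hextend : ∀ {a γ}, Ext a γ → ∃ a' < a, ∃ γ', Ext a' γ' := by
    intro a γ h
    obtain ⟨a', ha', γ', h1, h2⟩ := h.2.1.exists_extension hmag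
    exact ⟨a', ha', γ', ha'.le.trans h.1, h1, fun t ht =>
      (h2 (h.1.trans ht)).trans (h.2.2 ht)⟩
  choose! A hA G hG using fun t (ht : t ∈ I) => ht
  have hmem : ∀ {a γ t}, Ext a γ → a ≤ t → t ∈ I := fun h hat => by
    obtain ⟨a', ha', γ', h'⟩ := hextend h
    exact ⟨a', ha'.trans_le hat, γ', h'⟩
  have hΓ : ∀ {a γ t}, Ext a γ → a ≤ t → γ t = G t t := fun h hat =>
    huniq h (hG _ (hmem h hat)) hat (hA _ (hmem h hat)).le
  have hbase : Ext 0 γ₀ := ⟨le_rfl, h₀, fun _ _ => rfl⟩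
  refine ⟨I, fun t => G t t, ?_, fun t s hts ⟨a, ha, γ, h⟩ => ⟨a, ha.trans_le hts, γ, h⟩,
    hmem hbase le_rfl, fun t ht s hs => ?_, fun t ht => ?_, fun t ht => (hΓ hbase ht).symm, ?_⟩
  · have : I = ⋃ a ∈ {a | ∃ γ, Ext a γ}, Ioi a := by
      ext t
      simp only [hI, mem_ofPred_eq, mem_iUnion, mem_Ioi, exists_prop]
      exact ⟨fun ⟨a, h1, h2⟩ => ⟨a, h2, h1⟩, fun ⟨a, h1, h2⟩ => ⟨a, h2, h1⟩⟩
    rw [this]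
    exact isOpen_biUnion fun a _ => isOpen_Ioi
  · obtain ⟨a, ha, γ, h⟩ := ht
    have has : a ≤ s := ha.le.trans hs
    have h1 := (h.2.1.mono (Ici_subset_Ici.2 ha.le)) s hs
    simp only [← hΓ h has]
    exact ⟨h1.1, h1.2.congr (fun u hu => (hΓ h (ha.le.trans hu)).symm) (hΓ h has).symm⟩
  · obtain ⟨a, ha, γ, h⟩ := ht
    have h1 := (h.2.1 t ha.le).2.hasDerivAt (Ici_mem_nhds ha)
    simp only [← hΓ h ha.le]
    refine h1.congr_of_eventuallyEq ?_
    filter_upwards [Ioi_mem_nhds ha] with u hu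
    exact (hΓ h (le_of_lt hu)).symm
  · exact fun a ha γ h1 h2 => ⟨hmem ⟨ha, h1, h2⟩ le_rfl, hΓ ⟨ha, h1, h2⟩ le_rfl⟩

end LagrangianSystem
end McGehee

namespace McGehee
namespace LagrangianSystem

variable {n : ℕ} {L : LagrangianSystem n} {q : Vec n} {ν : ℝ} {v : Amb n}

/-! ### Asymptotics of solutions on the stable curve -/

/-- Close to their limit `ζ`, convergent solutions are determined by their value of `r`. -/
theorem IsLocalStableCurve.exists_eq_of_fst_eq {ζ : Amb n} (H : L.IsLocalStableCurve ζ ν v)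
    {γ γ' : ℝ → Amb n} {a a' : ℝ} (h : L.IsSolutionOn γ (Ici a)) (h' : L.IsSolutionOn γ' (Ici a'))
    (hlim : Tendsto γ atTop (𝓝 ζ)) (hlim' : Tendsto γ' atTop (𝓝 ζ)) :
    ∃ T ≥ max a a', ∀ t ≥ T, ∀ t' ≥ T, (γ t).1 = (γ' t').1 → γ t = γ' t' := by
  obtain ⟨-, -, -, ⟨N, hN, HN⟩, -⟩ := H
  obtain ⟨T, hT⟩ := eventually_atTop.1 ((hlim.eventually hN).and (hlim'.eventually hN))
  refine ⟨max T (max a a'), le_max_right _ _, fun t ht t' ht' htt' => ?_⟩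
  have h1 : max a a' ≤ t := (le_max_right _ _).trans ht
  have h2 : max a a' ≤ t' := (le_max_right _ _).trans ht'
  have h3 : T ≤ t := (le_max_left _ _).trans ht
  have h4 : T ≤ t' := (le_max_left _ _).trans ht'
  have h5 := h.comp_add_const (J := Ici 0) t fun s hs =>
    ((le_max_left a a').trans h1).trans (le_add_of_nonneg_left hs)
  have h6 := h'.comp_add_const (J := Ici 0) t' fun s hs =>
    ((le_max_right a a').trans h2).trans (le_add_of_nonneg_left hs)
  simpa using HN _ _ h5.isIntegralCurveOn h6.isIntegralCurveOn
    (fun s hs => (hT _ (h3.trans (le_add_of_nonneg_left hs))).1)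
    (fun s hs => (hT _ (h4.trans (le_add_of_nonneg_left hs))).2) (by simpa using htt')

theorem IsLocalStableCurve.isLittleO {ζ : Amb n} (H : L.IsLocalStableCurve ζ ν v)
    {γ : ℝ → Amb n} {a : ℝ} (h : L.IsSolutionOn γ (Ici a)) (hlim : Tendsto γ atTop (𝓝 ζ)) :
    (fun t => γ t - ζ - (γ t).1 • v) =o[atTop] fun t => (γ t).1 := by
  refine Asymptotics.isLittleO_iff.2 fun κ hκ => ?_
  obtain ⟨N, hN, HN⟩ := H.2.2.2.2 κ hκ
  obtain ⟨T, hT⟩ := eventually_atTop.1 (hlim.eventually hN)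
  filter_upwards [eventually_ge_atTop (max T a)] with t ht
  have h5 := h.comp_add_const (J := Ici 0) t fun s hs =>
    ((le_max_right T a).trans ht).trans (le_add_of_nonneg_left hs)
  simpa using HN _ h5.isIntegralCurveOn
    (fun s hs => hT _ (((le_max_left T a).trans ht).trans (le_add_of_nonneg_left hs)))

theorem IsLocalStableCurve.isBigO {ζ : Amb n} (H : L.IsLocalStableCurve ζ ν v)
    {γ : ℝ → Amb n} {a : ℝ} (h : L.IsSolutionOn γ (Ici a)) (hlim : Tendsto γ atTop (𝓝 ζ)) :
    (fun t => γ t - ζ) =O[atTop] fun t => (γ t).1 := by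
  have h1 : (fun t => (γ t).1 • v) =O[atTop] fun t => (γ t).1 :=
    Asymptotics.IsBigO.of_bound ‖v‖ (Eventually.of_forall fun t => by rw [norm_smul, mul_comm])
  simpa using (H.isLittleO h hlim).isBigO.add h1

theorem IsLocalStableCurve.field_isLittleO (hmag : L.WeakMagnetism) (hF : L.IsFixed q ν)
    (H : L.IsLocalStableCurve (0, q, ν • q) ν v)
    {γ : ℝ → Amb n} {a : ℝ} (h : L.IsSolutionOn γ (Ici a))
    (hlim : Tendsto γ atTop (𝓝 (0, q, ν • q))) :
    (fun t => L.field (γ t) - (γ t).1 • ν • v) =o[atTop] fun t => (γ t).1 := by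
  have h1 := (hasStrictFDerivAt_field hmag (L.mem_domain_of_fst_eq_zero
    (ζ := (0, q, ν • q)) rfl)).hasFDerivAt.isLittleO
  have h2 := (h1.comp_tendsto hlim).trans_isBigO (H.isBigO h hlim)
  have h3 := ((fderiv ℝ L.field (0, q, ν • q)).isBigO_comp
    (fun t => γ t - (0, q, ν • q) - (γ t).1 • v) atTop).trans_isLittleO (H.isLittleO h hlim)
  refine (h2.add h3).congr_left fun t => ?_
  simp only [Function.comp, hF.field_eq_zero hmag, map_sub, map_smul, H.2.1]
  abel

/-- Along the stable curve, `r` is asymptotic to a multiple of `e^{νt}`. -/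
theorem IsLocalStableCurve.exists_tendsto_fst (hF : L.IsFixed q ν) (hν : ν < 0)
    (H : L.IsLocalStableCurve (0, q, ν • q) ν v) {γ : ℝ → Amb n} {a : ℝ}
    (h : L.IsSolutionOn γ (Ici a)) (hlim : Tendsto γ atTop (𝓝 (0, q, ν • q)))
    (hr : (γ a).1 ≠ 0) :
    ∃ C : ℝ, 0 < C * (γ a).1 ∧
      Tendsto (fun t => Real.exp (-ν * t) * (γ t).1) atTop (𝓝 C) := by
  set ζ : Amb n := (0, q, ν • q) with hζ
  set P : Amb n → ℝ := fun z => inner ℝ z.2.1 z.2.2 with hP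
  have hPζ : P ζ = ν := hF.inner_smul
  have hPd : DifferentiableAt ℝ P ζ :=
    DifferentiableAt.inner ℝ (by fun_prop) (by fun_prop)
  have hPcont : Continuous P := by
    simp only [hP]
    fun_prop
  obtain ⟨T, hT⟩ := eventually_atTop.1 ((hlim.eventually
    (hPcont.continuousAt.eventually (gt_mem_nhds (show P ζ < ν / 2 by rw [hPζ]; linarith)))).and
      (eventually_ge_atTop a))
  have haT : a ≤ T := (hT T le_rfl).2
  have hIcc : ∀ b, IsIntegralCurveOn γ (fun _ => L.field) (Icc T b) := fun b =>
    h.isIntegralCurveOn.mono fun s hs => haT.trans hs.1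
  have hcont : ContinuousOn γ (Ici T) :=
    (h.isIntegralCurveOn.mono (Ici_subset_Ici.2 haT)).continuousOn
  have hg : ContinuousOn (fun t => P (γ t) - ν) (Ici T) :=
    (hPcont.comp_continuousOn hcont).sub continuousOn_const
  -- `r` decays at least at half of the expected rate, which makes `⟨q, y⟩ - ν` integrable
  have hdecay : (fun t => (γ t).1) =O[atTop] fun t => Real.exp (-(-ν / 2) * t) := by
    refine Asymptotics.IsBigO.of_bound (|(γ T).1| * Real.exp (-(ν / 2) * T)) ?_
    filter_upwards [eventually_ge_atTop T] with t ht
    rw [fst_eq_mul_exp (hIcc t) (right_mem_Icc.2 ht), Real.norm_eq_abs, abs_mul, Real.abs_exp,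
      Real.norm_eq_abs, Real.abs_exp, mul_assoc, ← Real.exp_add]
    gcongr
    have h1 : (∫ s in T..t, 1 * inner ℝ (γ s).2.1 (γ s).2.2) ≤ ∫ _ in T..t, ν / 2 := by
      refine intervalIntegral.integral_mono_on ht ?_ intervalIntegrable_const fun s hs => ?_
      · refine ContinuousOn.intervalIntegrable (continuousOn_inner ?_ 1)
        rw [uIcc_of_le ht]
        exact hcont.mono Icc_subset_Ici_self
      · rw [one_mul]
        exact (hT s hs.1).1.le
    rw [intervalIntegral.integral_const, smul_eq_mul] at h1
    linarith
  have hO : (fun t => P (γ t) - ν) =O[atTop] fun t => Real.exp (-(-ν / 2) * t) := by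
    have h1 := (hPd.isBigO_sub.comp_tendsto hlim).trans ((H.isBigO h hlim).trans hdecay)
    rw [hPζ] at h1
    exact h1
  have hint := integrable_of_isBigO_exp_neg (by linarith) hg hO
  have hJ := MeasureTheory.intervalIntegral_tendsto_integral_Ioi T hint tendsto_id
  set J := ∫ s in Ioi T, (P (γ s) - ν) with hJdef
  refine ⟨(γ T).1 * Real.exp (-ν * T) * Real.exp J, ?_, ?_⟩
  · obtain ⟨c, hc, hcT⟩ := exists_pos_fst_eq (a := a) (b := T)
      (h.isIntegralCurveOn.mono (by rw [uIcc_of_le haT]; exact Icc_subset_Ici_self))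
    rw [hcT]
    have : 0 < (γ a).1 * (γ a).1 := mul_self_pos.2 hr
    calc (0 : ℝ) < c * ((γ a).1 * (γ a).1) * (Real.exp (-ν * T) * Real.exp J) := by positivity
      _ = _ := by ring
  · have h2 := ((Real.continuous_exp.tendsto J).comp hJ).const_mul
      ((γ T).1 * Real.exp (-ν * T))
    refine h2.congr' ?_
    filter_upwards [eventually_ge_atTop T] with t ht
    have hi : IntervalIntegrable (fun s => 1 * inner ℝ (γ s).2.1 (γ s).2.2)
        MeasureTheory.volume T t := by
      refine ContinuousOn.intervalIntegrable (continuousOn_inner ?_ 1)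
      rw [uIcc_of_le ht]
      exact hcont.mono Icc_subset_Ici_self
    have h3 : (∫ s in T..t, (P (γ s) - ν)) =
        (∫ s in T..t, 1 * inner ℝ (γ s).2.1 (γ s).2.2) - (t - T) * ν := by
      rw [← smul_eq_mul (t - T), ← intervalIntegral.integral_const,
        ← intervalIntegral.integral_sub hi intervalIntegrable_const]
      simp [hP]
    rw [fst_eq_mul_exp (hIcc t) (right_mem_Icc.2 ht)]
    simp only [Function.comp, id, h3]
    rw [mul_assoc, ← Real.exp_add, mul_left_comm, ← Real.exp_add]
    congr 2
    ring

/-- In the parameter `e^{νt}` the velocity of a solution on the stable curve converges. -/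
theorem IsLocalStableCurve.tendsto_exp_smul_field (hmag : L.WeakMagnetism) (hF : L.IsFixed q ν)
    (H : L.IsLocalStableCurve (0, q, ν • q) ν v) {γ : ℝ → Amb n} {a C : ℝ}
    (h : L.IsSolutionOn γ (Ici a)) (hlim : Tendsto γ atTop (𝓝 (0, q, ν • q)))
    (hC : Tendsto (fun t => Real.exp (-ν * t) * (γ t).1) atTop (𝓝 C)) :
    Tendsto (fun t => Real.exp (-ν * t) • L.field (γ t)) atTop (𝓝 (C • ν • v)) := by
  have h1 : (fun t => Real.exp (-ν * t) • (L.field (γ t) - (γ t).1 • ν • v)) =o[atTop]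
      fun t => Real.exp (-ν * t) • (γ t).1 :=
    (Asymptotics.isBigO_refl _ _).smul_isLittleO (H.field_isLittleO hmag hF h hlim)
  have h2 : (fun t => Real.exp (-ν * t) • (L.field (γ t) - (γ t).1 • ν • v)) =o[atTop]
      fun _ => (1 : ℝ) := h1.trans_isBigO (hC.isBigO_one ℝ)
  have h3 := (Asymptotics.isLittleO_one_iff ℝ).1 h2
  have h4 := h3.add (hC.smul_const (ν • v))
  rw [zero_add] at h4
  refine h4.congr fun t => ?_
  rw [smul_sub, smul_smul]
  abel

/-! ### The two branches of the stable curve -/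

/-- Two solutions that converge to `ζ` from the same side meet. -/
theorem IsLocalStableCurve.exists_meet {ζ : Amb n} (H : L.IsLocalStableCurve ζ ν v)
    (hζ : ζ.1 = 0) {γ η : ℝ → Amb n} (hγ : L.IsSolutionOn γ (Ici 0)) (hη : L.IsSolutionOn η (Ici 0))
    (hγlim : Tendsto γ atTop (𝓝 ζ)) (hηlim : Tendsto η atTop (𝓝 ζ))
    (hsign : 0 < (γ 0).1 * (η 0).1) : ∃ t ≥ 0, ∃ t' ≥ 0, γ t = η t' := by
  set σ := (γ 0).1 with hσ
  have hσ0 : σ ≠ 0 := fun h0 => by simp [h0] at hsign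
  have hpos : ∀ {f : ℝ → Amb n}, L.IsSolutionOn f (Ici 0) → 0 < σ * (f 0).1 →
      ∀ t ≥ 0, 0 < σ * (f t).1 := fun hf h0 t ht => by
    obtain ⟨c, hc, hct⟩ := exists_pos_fst_eq (a := 0) (b := t)
      (hf.isIntegralCurveOn.mono (by rw [uIcc_of_le ht]; exact Icc_subset_Ici_self))
    rw [hct, mul_left_comm]
    exact mul_pos hc h0
  have hivt : ∀ {f : ℝ → Amb n}, L.IsSolutionOn f (Ici 0) → Tendsto f atTop (𝓝 ζ) → ∀ T ≥ 0,
      ∀ ρ, 0 < σ * ρ → σ * ρ ≤ σ * (f T).1 → ∃ t ≥ T, (f t).1 = ρ := by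
    intro f hf hlim T hT ρ hρ hle
    have h1 : ContinuousOn (fun t => σ * (f t).1) (Ici T) :=
      continuousOn_const.mul (continuous_fst.comp_continuousOn
        (hf.isIntegralCurveOn.mono (Ici_subset_Ici.2 hT)).continuousOn)
    have h2 : Tendsto (fun t => σ * (f t).1) atTop (𝓝 0) := by
      simpa [hζ] using ((continuous_fst.tendsto ζ).comp hlim).const_mul σ
    obtain ⟨t, ht, h3⟩ := isPreconnected_Ici.intermediate_value_Ioc (self_mem_Ici (a := T))
      (le_principal_iff.2 (Ici_mem_atTop T)) h1 h2 ⟨hρ, hle⟩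
    exact ⟨t, ht, mul_left_cancel₀ hσ0 h3⟩
  obtain ⟨T, hT, HT⟩ := H.exists_eq_of_fst_eq hγ hη hγlim hηlim
  have hT0 : 0 ≤ T := by simpa using hT
  have hγT := hpos hγ (mul_self_pos.2 hσ0) T hT0
  have hηT := hpos hη hsign T hT0
  rcases le_total (σ * (γ T).1) (σ * (η T).1) with hle | hle
  · obtain ⟨t, ht, h1⟩ := hivt hη hηlim T hT0 _ hγT hle
    exact ⟨T, hT0, t, hT0.trans ht, HT T le_rfl t ht h1.symm⟩
  · obtain ⟨t, ht, h1⟩ := hivt hγ hγlim T hT0 _ hηT hle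
    exact ⟨t, hT0.trans ht, T, hT0, HT t ht T le_rfl h1⟩

theorem IsLocalStableCurve.eq_of_fst_eq_zero (hmag : L.WeakMagnetism) (hF : L.IsFixed q ν)
    (H : L.IsLocalStableCurve (0, q, ν • q) ν v) {w : Amb n}
    (hw : w ∈ L.stableManifold (0, q, ν • q)) (hw0 : w.1 = 0) : w = (0, q, ν • q) := by
  obtain ⟨γ, h1, rfl, h2⟩ := hw
  have h0 : L.IsSolutionOn (fun _ => ((0, q, ν • q) : Amb n)) (Ici 0) := fun t _ => by
    refine ⟨bdry_subset_extendedManifold ⟨rfl, hF.norm_eq⟩, ?_⟩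
    rw [hF.field_eq_zero hmag]
    exact hasDerivWithinAt_const _ _ _
  obtain ⟨T, hT, HT⟩ := H.exists_eq_of_fst_eq h1 h0 h2 tendsto_const_nhds
  have hT0 : 0 ≤ T := by simpa using hT
  have h3 := mem_bdry_of_integralCurve h1.isIntegralCurveOn ordConnected_Ici self_mem_Ici
    (mem_Ici.2 hT0) ⟨hw0, (h1 0 self_mem_Ici).1.2⟩
  exact h1.eqOn hmag ordConnected_Ici h0 hT0 (HT T le_rfl T le_rfl h3.1) self_mem_Ici

/-- A convergent solution that does not attain its limit is injective. -/
theorem injOn_of_tendsto (hmag : L.WeakMagnetism) {Γ : ℝ → Amb n} {I : Set ℝ} {ζ : Amb n}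
    (hΓ : ∀ t ∈ I, L.IsSolutionOn Γ (Ici t)) (hlim : Tendsto Γ atTop (𝓝 ζ))
    (hne : ∀ t ∈ I, Γ t ≠ ζ) : InjOn Γ I := by
  have key : ∀ s ∈ I, ∀ t ∈ I, s < t → Γ s ≠ Γ t := by
    intro s hs t ht hst heq
    -- a solution with a repeated value is periodic, and constant if it converges
    have h1 : EqOn Γ (fun u => Γ (u + (t - s))) (Ici s) :=
      (hΓ s hs).eqOn hmag ordConnected_Ici ((hΓ s hs).comp_add_const _ fun u hu => by
        have := mem_Ici.1 hu
        exact mem_Ici.2 (by linarith)) self_mem_Ici (by simpa using heq)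
    have h2 : ∀ k : ℕ, Γ (s + k * (t - s)) = Γ s := fun k => by
      induction k with
      | zero => simp
      | succ k ih =>
        rw [← ih, h1 (x := s + k * (t - s))]
        · push_cast
          ring_nf
        · have : 0 ≤ (k : ℝ) * (t - s) := mul_nonneg k.cast_nonneg (by linarith)
          exact mem_Ici.2 (by linarith)
    have h3 : Tendsto (fun k : ℕ => s + k * (t - s)) atTop atTop :=
      tendsto_atTop_add_const_left _ _
        (tendsto_natCast_atTop_atTop.atTop_mul_const (by linarith))
    have h4 := hlim.comp h3
    simp only [Function.comp_def, h2] at h4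
    exact hne s hs (tendsto_nhds_unique tendsto_const_nhds h4)
  intro s hs t ht heq
  rcases lt_trichotomy s t with h | h | h
  · exact absurd heq (key s hs t ht h)
  · exact h
  · exact absurd heq.symm (key t ht s hs h)

/-- An open half-line or the whole line, described by an inequality for `e^{νt}`. -/
theorem exists_mem_iff_mul_exp_lt (hν : ν < 0) {I : Set ℝ} (hI : IsOpen I) (hup : IsUpperSet I)
    (hne : I.Nonempty) {κ : ℝ} (hκ : 0 < κ) :
    ∃ β ≥ 0, ∀ t, t ∈ I ↔ β * Real.exp (ν * t) < κ := by
  by_cases hb : BddBelow I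
  · refine ⟨κ * Real.exp (-ν * sInf I), by positivity, fun t => ?_⟩
    have h1 : κ * Real.exp (-ν * sInf I) * Real.exp (ν * t) < κ ↔ sInf I < t := by
      rw [mul_assoc, ← Real.exp_add, mul_lt_iff_lt_one_right hκ, Real.exp_lt_one_iff]
      constructor <;> intro h <;> nlinarith
    rw [h1]
    constructor
    · intro ht
      obtain ⟨ε, hε, hεI⟩ := Metric.isOpen_iff.1 hI t ht
      have h2 : t - ε / 2 ∈ I := hεI (by
        rw [Real.ball_eq_Ioo]
        exact ⟨by linarith, by linarith⟩)
      linarith [csInf_le hb h2]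
    · intro ht
      obtain ⟨s, hs, hst⟩ := exists_lt_of_csInf_lt hne ht
      exact hup hst.le hs
  · refine ⟨0, le_rfl, fun t => ?_⟩
    simp only [zero_mul, hκ, iff_true]
    obtain ⟨s, hs, hst⟩ := not_bddBelow_iff.1 hb t
    exact hup hst.le hs

end LagrangianSystem
end McGehee

namespace McGehee
namespace LagrangianSystem

variable {n : ℕ} {L : LagrangianSystem n} {q : Vec n} {ν : ℝ} {v : Amb n}

/-- One of the two branches (`σ = ±1`) of the stable curve. The parameter `x` is, up to a Möbius
transformation, a multiple of `e^{νt}`; the factor is chosen so that `r ∼ σ x` as `x → 0`, and the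
Möbius transformation so that `x → ∞` at the beginning of the solution. -/
theorem IsLocalStableCurve.exists_branch (hmag : L.WeakMagnetism) (hF : L.IsFixed q ν) (hν : ν < 0)
    (H : L.IsLocalStableCurve (0, q, ν • q) ν v) {σ : ℝ} (hσ : |σ| = 1) :
    ∃ c c' : ℝ → Amb n, (∀ x > 0, HasDerivAt c (c' x) x) ∧ ContinuousOn c' (Ioi 0) ∧
      (∀ x > 0, c' x ≠ 0) ∧ InjOn c (Ioi 0) ∧
      c '' Ioi 0 = {w ∈ L.stableManifold (0, q, ν • q) | 0 < σ * w.1} ∧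
      Tendsto c (𝓝[>] 0) (𝓝 (0, q, ν • q)) ∧ Tendsto c' (𝓝[>] 0) (𝓝 (σ • v)) := by
  set ζ : Amb n := (0, q, ν • q) with hζ
  have hσσ : σ * σ = 1 := by rw [← abs_mul_abs_self, hσ, one_mul]
  obtain ⟨δ, hδ, hδγ⟩ := H.2.2.1
  obtain ⟨γ₀, hγ₀, hr₀, hlim₀⟩ := hδγ (σ * (δ / 2)) (by
    rw [abs_mul, hσ, one_mul, abs_of_pos (by positivity)]
    linarith)
  obtain ⟨I, Γ, hI, hup, h0I, hΓ, hΓ', hΓγ, hmax⟩ := hγ₀.exists_maximal hmag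
  have hlim : Tendsto Γ atTop (𝓝 ζ) := hlim₀.congr' (by
    filter_upwards [eventually_ge_atTop 0] with t ht
    exact (hΓγ ht).symm)
  have hrΓ0 : 0 < σ * (Γ 0).1 := by
    rw [hΓγ self_mem_Ici, hr₀, ← mul_assoc, hσσ]
    linarith
  have hrΓ : ∀ t ∈ I, 0 < σ * (Γ t).1 := fun t ht => by
    obtain ⟨c, hc, hct⟩ := exists_pos_fst_eq (L := L) (γ := Γ) (a := 0) (b := t) fun s hs =>
      (hΓ' s (hup.ordConnected.uIcc_subset h0I ht hs)).hasDerivWithinAt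
    rw [hct, mul_left_comm]
    exact mul_pos hc hrΓ0
  have hrne : ∀ t ∈ I, (Γ t).1 ≠ 0 := fun t ht h => by simpa [h] using hrΓ t ht
  have hinj : InjOn Γ I := injOn_of_tendsto hmag hΓ hlim fun t ht h => hrne t ht (by rw [h])
  have himage : Γ '' I = {w ∈ L.stableManifold ζ | 0 < σ * w.1} := by
    refine Subset.antisymm ?_ ?_
    · rintro _ ⟨t, ht, rfl⟩
      exact ⟨mem_stableManifold_of_isSolutionOn (hΓ t ht) hlim, hrΓ t ht⟩
    -- a solution in the stable manifold meets `γ₀`, so a time shift of it is a continuation of `γ₀`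
    · rintro _ ⟨⟨η, hη, rfl, hηlim⟩, hw⟩
      have hsign : 0 < (γ₀ 0).1 * (η 0).1 := by
        rw [hr₀, mul_right_comm]
        positivity
      obtain ⟨t, ht, t', ht', heq⟩ := H.exists_meet rfl hγ₀ hη hlim₀ hηlim hsign
      set μ : ℝ → Amb n := fun s => η (s + (t' - t)) with hμ
      have hμsol : L.IsSolutionOn μ (Ici (t - t')) :=
        hη.comp_add_const _ fun s hs => by
          have := mem_Ici.1 hs
          exact mem_Ici.2 (by linarith)
      have hμ0 : μ (t - t') = η 0 := by simp [hμ]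
      have hμt : μ t = γ₀ t := by simp [hμ, heq]
      rcases le_total (t - t') 0 with h | h
      · obtain ⟨h1, h2⟩ := hmax _ h μ hμsol ((hμsol.mono (Ici_subset_Ici.2 h)).eqOn hmag
          ordConnected_Ici hγ₀ (mem_Ici.2 ht) hμt)
        exact ⟨_, h1, by rw [← h2, hμ0]⟩
      · refine ⟨t - t', hup h h0I, ?_⟩
        rw [hΓγ h, ← hμ0]
        exact ((hγ₀.mono (Ici_subset_Ici.2 h)).eqOn hmag ordConnected_Ici hμsol
          (mem_Ici.2 (by linarith)) hμt.symm) self_mem_Ici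
  obtain ⟨C, hC0, hC⟩ := H.exists_tendsto_fst hF hν (hΓ 0 h0I) hlim (hrne 0 h0I)
  have hσC : 0 < σ * C := by
    have h1 : 0 < (σ * C) * (σ * (Γ 0).1) := by
      rw [show (σ * C) * (σ * (Γ 0).1) = (σ * σ) * (C * (Γ 0).1) by ring, hσσ, one_mul]
      exact hC0
    exact (mul_pos_iff_of_pos_right hrΓ0).1 h1
  have hfield := H.tendsto_exp_smul_field hmag hF (hΓ 0 h0I) hlim hC
  -- `κ` normalizes `r`; `β` is read off from the infimum of the interval of existence
  set κ := (σ * C)⁻¹ with hκ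
  have hκ0 : 0 < κ := inv_pos.2 hσC
  obtain ⟨β, hβ, hIβ⟩ := exists_mem_iff_mul_exp_lt hν hI hup ⟨0, h0I⟩ hκ0
  set τ : ℝ → ℝ := fun x => (Real.log κ + Real.log x - Real.log (1 + β * x)) / ν with hτ
  have h1β : ∀ x > 0, 0 < 1 + β * x := fun x hx => by positivity
  have hexp : ∀ x > 0, Real.exp (ν * τ x) = κ * x / (1 + β * x) := fun x hx => by
    rw [hτ, mul_div_cancel₀ _ hν.ne, Real.exp_sub, Real.exp_add, Real.exp_log hκ0, Real.exp_log hx,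
      Real.exp_log (h1β x hx)]
  have hτI : ∀ x > 0, τ x ∈ I := fun x hx => by
    have := h1β x hx
    rw [hIβ, hexp x hx, mul_div_assoc', div_lt_iff₀ this]
    nlinarith
  have hτd : ∀ x > 0, HasDerivAt τ ((ν * x * (1 + β * x))⁻¹) x := fun x hx => by
    have h1 := (Real.hasDerivAt_log hx.ne').const_add (Real.log κ)
    have h2 := (((hasDerivAt_id x).const_mul β).const_add 1).log (h1β x hx).ne'
    refine ((h1.sub h2).div_const ν).congr_deriv ?_
    have := h1β x hx
    have := hν.ne
    simp only [id]
    field_simp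
    ring
  have hτinj : InjOn τ (Ioi 0) := fun x hx y hy hxy => by
    have hx : 0 < x := hx
    have hy : 0 < y := hy
    have h1 := hexp x hx
    rw [hxy, hexp y hy, div_eq_div_iff (h1β y hy).ne' (h1β x hx).ne'] at h1
    refine mul_left_cancel₀ hκ0.ne' ?_
    linarith
  have hτimage : τ '' Ioi 0 = I := by
    refine Subset.antisymm (image_subset_iff.2 hτI) fun t ht => ?_
    have h1 := sub_pos.2 ((hIβ t).1 ht)
    have h2 := Real.exp_pos (ν * t)
    set x := Real.exp (ν * t) / (κ - β * Real.exp (ν * t)) with hx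
    have hx0 : 0 < x := by positivity
    refine ⟨x, hx0, mul_left_cancel₀ hν.ne (Real.exp_injective ?_)⟩
    have hx1 : x * (κ - β * Real.exp (ν * t)) = Real.exp (ν * t) := div_mul_cancel₀ _ h1.ne'
    rw [hexp x hx0, div_eq_iff (h1β x hx0).ne']
    linear_combination hx1
  have hτlim : Tendsto τ (𝓝[>] 0) atTop := by
    have h1 : Tendsto (fun x => Real.log (1 + β * x)) (𝓝[>] 0) (𝓝 (Real.log (1 + β * 0))) := by
      refine Tendsto.log ?_ (by simp)
      exact ((continuous_const.add (continuous_const.mul continuous_id)).tendsto 0).mono_left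
        nhdsWithin_le_nhds
    have h2 := (tendsto_atBot_add_const_left (𝓝[>] (0 : ℝ)) (Real.log κ)
      Real.tendsto_log_nhdsGT_zero).atBot_add h1.neg
    have h3 := h2.atBot_mul_const_of_neg (inv_lt_zero.2 hν)
    exact h3.congr fun x => by simp only [hτ]; ring
  refine ⟨fun x => Γ (τ x), fun x => (ν * x * (1 + β * x))⁻¹ • L.field (Γ (τ x)),
    fun x hx => (hΓ' _ (hτI x hx)).scomp x (hτd x hx), ?_, fun x hx => ?_, ?_, ?_, hlim.comp hτlim,
    ?_⟩
  · have hc : ContinuousOn (fun x => Γ (τ x)) (Ioi 0) := fun x hx =>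
      ((hΓ' _ (hτI x hx)).scomp x (hτd x hx)).continuousAt.continuousWithinAt
    have hp : Continuous fun x : ℝ => ν * x * (1 + β * x) := by fun_prop
    refine ContinuousOn.smul (hp.continuousOn.inv₀ fun x hx => ?_) ?_
    · exact mul_ne_zero (mul_ne_zero hν.ne (ne_of_gt hx)) (h1β x hx).ne'
    · exact (L.contDiffOn_field hmag).continuousOn.comp hc fun x hx =>
        L.extendedManifold_subset_domain (hΓ _ (hτI x hx) _ self_mem_Ici).1
  · refine smul_ne_zero (inv_ne_zero (mul_ne_zero (mul_ne_zero hν.ne hx.ne') (h1β x hx).ne')) ?_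
    -- an equilibrium on the branch would be a repeated value of the solution
    intro h0
    have hsol := hΓ _ (hτI x hx)
    have hconst : L.IsSolutionOn (fun _ => Γ (τ x)) (Ici (τ x)) := fun t _ => by
      refine ⟨(hsol _ self_mem_Ici).1, ?_⟩
      rw [h0]
      exact hasDerivWithinAt_const _ _ _
    have h1 := hsol.eqOn hmag ordConnected_Ici hconst self_mem_Ici rfl
    have h2 : τ x ≤ τ x + 1 := by linarith
    have h3 := hinj (hup h2 (hτI x hx)) (hτI x hx) (h1 (mem_Ici.2 h2))
    linarith
  · exact hinj.comp hτinj hτI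
  · rw [← himage, ← hτimage, image_image]
  · have h1 : Tendsto (fun x : ℝ => κ / (ν * (1 + β * x) ^ 2)) (𝓝[>] 0)
        (𝓝 (κ / (ν * (1 + β * 0) ^ 2))) := by
      have h2 : ContinuousAt (fun x : ℝ => κ / (ν * (1 + β * x) ^ 2)) 0 :=
        continuousAt_const.div (by fun_prop) (by simpa using hν.ne)
      exact h2.tendsto.mono_left nhdsWithin_le_nhds
    have h2 := h1.smul (hfield.comp hτlim)
    have h3 : (κ / (ν * (1 + β * 0) ^ 2)) • C • ν • v = σ • v := by
      rw [smul_smul, smul_smul]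
      congr 1
      have hσ0 : σ ≠ 0 := fun h => by simp [h] at hσσ
      have hC0 : C ≠ 0 := fun h => by simp [h] at hσC
      have := hν.ne
      rw [hκ, mul_zero, add_zero]
      field_simp
      linarith
    rw [h3] at h2
    refine h2.congr' ?_
    filter_upwards [self_mem_nhdsWithin] with x hx
    have hx0 : 0 < x := hx
    have h4 : Real.exp (-ν * τ x) = (1 + β * x) / (κ * x) := by
      rw [neg_mul, Real.exp_neg, hexp x hx0, inv_div]
    simp only [Function.comp, h4, smul_smul]
    congr 1
    have := h1β x hx0
    have := hν.ne
    field_simp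

/-- A curve glued from two half-open pieces that have the same tangent at their common endpoint. -/
theorem contDiff_one_of_branches {E : Type*} [NormedAddCommGroup E] [NormedSpace ℝ E]
    {f g f' g' : ℝ → E} {z w : E} (hf : ∀ x > 0, HasDerivAt f (f' x) x)
    (hg : ∀ x > 0, HasDerivAt g (g' x) x) (hf' : ContinuousOn f' (Ioi 0))
    (hg' : ContinuousOn g' (Ioi 0)) (hfz : Tendsto f (𝓝[>] 0) (𝓝 z))
    (hgz : Tendsto g (𝓝[>] 0) (𝓝 z)) (hfw : Tendsto f' (𝓝[>] 0) (𝓝 w))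
    (hgw : Tendsto g' (𝓝[>] 0) (𝓝 (-w))) {c : ℝ → E} (hc0 : c 0 = z)
    (hcf : ∀ x > 0, c x = f x) (hcg : ∀ x > 0, c (-x) = g x) :
    ContDiff ℝ 1 c ∧ deriv c 0 = w ∧ (∀ x > 0, deriv c x = f' x) ∧
      ∀ x > 0, deriv c (-x) = -g' x := by
  have hpos : ∀ x > 0, HasDerivAt c (f' x) x := fun x hx =>
    (hf x hx).congr_of_eventuallyEq (by
      filter_upwards [Ioi_mem_nhds hx] with y hy
      exact hcf y hy)
  have hneg : ∀ x < 0, HasDerivAt c (-g' (-x)) x := fun x hx => by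
    have h1 := (hg (-x) (by linarith)).scomp x (hasDerivAt_neg x)
    rw [neg_smul, one_smul] at h1
    refine h1.congr_of_eventuallyEq ?_
    filter_upwards [Iio_mem_nhds hx] with y hy
    have := hcg (-y) (by linarith [mem_Iio.1 hy])
    rwa [_root_.neg_neg] at this
  have hflip : Tendsto (fun x : ℝ => -x) (𝓝[<] 0) (𝓝[>] 0) := by
    simpa using tendsto_neg_nhdsLT (a := (0 : ℝ))
  set c' : ℝ → E := fun x => if x < 0 then -g' (-x) else if 0 < x then f' x else w with hc'
  have hc'pos : ∀ x > 0, c' x = f' x := fun x hx => by simp [hc', hx, not_lt.2 hx.le]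
  have hc'neg : ∀ x < 0, c' x = -g' (-x) := fun x hx => by simp [hc', hx]
  have hc'0 : c' 0 = w := by simp [hc']
  have hne : ∀ x ≠ 0, HasDerivAt c (c' x) x := fun x hx => by
    rcases hx.lt_or_gt with h | h
    · rw [hc'neg x h]
      exact hneg x h
    · rw [hc'pos x h]
      exact hpos x h
  have hcont0 : ∀ {a : ℝ → E}, Tendsto a (𝓝[<] 0) (𝓝 (a 0)) → Tendsto a (𝓝[>] 0) (𝓝 (a 0)) →
      ContinuousAt a 0 := fun h1 h2 =>
    continuousAt_iff_continuous_left'_right'.2 ⟨h1, h2⟩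
  have hcc : ContinuousAt c 0 := by
    refine hcont0 ?_ ?_ <;> rw [hc0]
    · refine (hgz.comp hflip).congr' ?_
      filter_upwards [self_mem_nhdsWithin] with x hx
      have := hcg (-x) (by linarith [mem_Iio.1 hx])
      rw [_root_.neg_neg] at this
      exact this.symm
    · refine hfz.congr' ?_
      filter_upwards [self_mem_nhdsWithin] with x hx
      exact (hcf x hx).symm
  have hc'c : ContinuousAt c' 0 := by
    refine hcont0 ?_ ?_ <;> rw [hc'0]
    · have h1 := (hgw.comp hflip).neg
      rw [_root_.neg_neg] at h1
      refine h1.congr' ?_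
      filter_upwards [self_mem_nhdsWithin] with x hx
      exact (hc'neg x hx).symm
    · refine hfw.congr' ?_
      filter_upwards [self_mem_nhdsWithin] with x hx
      exact (hc'pos x hx).symm
  have hd : ∀ x, HasDerivAt c (c' x) x := fun x =>
    hasDerivAt_of_hasDerivAt_of_ne' (fun y hy => hne y hy) hcc hc'c x
  have hderiv : deriv c = c' := funext fun x => (hd x).deriv
  refine ⟨contDiff_one_iff_deriv.2 ⟨fun x => (hd x).differentiableAt, ?_⟩, ?_, ?_, ?_⟩
  · rw [hderiv, continuous_iff_continuousAt]
    intro x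
    rcases lt_trichotomy x 0 with h | rfl | h
    · have h1 : ContinuousAt (fun y => -g' (-y)) x :=
        ((hg'.continuousAt (Ioi_mem_nhds (by linarith))).comp
          (f := fun y : ℝ => -y) continuous_neg.continuousAt).neg
      refine h1.congr ?_
      filter_upwards [Iio_mem_nhds h] with y hy
      exact (hc'neg y hy).symm
    · exact hc'c
    · refine (hf'.continuousAt (Ioi_mem_nhds h)).congr ?_
      filter_upwards [Ioi_mem_nhds h] with y hy
      exact (hc'pos y hy).symm
  · rw [hderiv, hc'0]
  · intro x hx
    rw [hderiv, hc'pos x hx]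
  · intro x hx
    rw [hderiv, hc'neg (-x) (by linarith), _root_.neg_neg]

/-- The stable manifold is the union of the two branches and of the fixed point, which they leave in
the directions `v` and `-v`. -/
theorem IsFixed.exists_isImmersedLine_stableManifold (hmag : L.WeakMagnetism) (h : L.IsFixed q ν)
    (hν : ν < 0) (H : L.IsLocalStableCurve (0, q, ν • q) ν v) :
    ∃ c : ℝ → Amb n, IsImmersedLine c (L.stableManifold (0, q, ν • q)) ∧ c 0 = (0, q, ν • q) ∧
      deriv c 0 = v := by
  set ζ : Amb n := (0, q, ν • q) with hζ
  obtain ⟨f, f', f1, f2, f3, f4, f5, f6, f7⟩ := H.exists_branch hmag h hν (σ := 1) (by simp)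
  obtain ⟨g, g', g1, g2, g3, g4, g5, g6, g7⟩ := H.exists_branch hmag h hν (σ := -1) (by simp)
  simp only [one_smul, neg_smul, one_mul, neg_mul, neg_pos] at f5 f7 g5 g7
  set c : ℝ → Amb n := fun x => if 0 < x then f x else if x < 0 then g (-x) else ζ with hc
  have hc0 : c 0 = ζ := by simp [hc]
  have hcf : ∀ x > 0, c x = f x := fun x hx => by simp [hc, hx]
  have hcg : ∀ x > 0, c (-x) = g x := fun x hx => by simp [hc, hx, not_lt.2 hx.le]
  have hfW : ∀ x > 0, f x ∈ L.stableManifold ζ ∧ 0 < (f x).1 := fun x hx =>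
    f5.subset (mem_image_of_mem f hx)
  have hgW : ∀ x > 0, g x ∈ L.stableManifold ζ ∧ (g x).1 < 0 := fun x hx =>
    g5.subset (mem_image_of_mem g hx)
  have hζW : ζ ∈ L.stableManifold ζ := by
    refine ⟨fun _ => ζ, fun t _ => ?_, rfl, tendsto_const_nhds⟩
    refine ⟨bdry_subset_extendedManifold ⟨rfl, h.norm_eq⟩, ?_⟩
    rw [h.field_eq_zero hmag]
    exact hasDerivWithinAt_const _ _ _
  have hcpos : ∀ x > 0, 0 < (c x).1 := fun x hx => by
    rw [hcf x hx]
    exact (hfW x hx).2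
  have hcneg : ∀ x < 0, (c x).1 < 0 := fun x hx => by
    have := hcg (-x) (by linarith)
    rw [_root_.neg_neg] at this
    rw [this]
    exact (hgW (-x) (by linarith)).2
  have hc00 : (c 0).1 = 0 := by rw [hc0]
  obtain ⟨d1, d2, d3, d4⟩ := contDiff_one_of_branches f1 g1 f2 g2 f6 g6 f7 g7 hc0 hcf hcg
  refine ⟨c, ⟨d1, ?_, ?_, ?_⟩, hc0, d2⟩
  · intro x y hxy
    rcases lt_trichotomy x 0 with hx | rfl | hx <;> rcases lt_trichotomy y 0 with hy | rfl | hy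
    · obtain ⟨x, rfl⟩ : ∃ u, x = -u := ⟨-x, by simp⟩
      obtain ⟨y, rfl⟩ : ∃ u, y = -u := ⟨-y, by simp⟩
      have hx' : 0 < x := by linarith
      have hy' : 0 < y := by linarith
      rw [hcg x hx', hcg y hy'] at hxy
      rw [g4 hx' hy' hxy]
    · linarith [hcneg x hx, congrArg Prod.fst hxy]
    · linarith [hcneg x hx, hcpos y hy, congrArg Prod.fst hxy]
    · linarith [hcneg y hy, congrArg Prod.fst hxy]
    · rfl
    · linarith [hcpos y hy, congrArg Prod.fst hxy]
    · linarith [hcpos x hx, hcneg y hy, congrArg Prod.fst hxy]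
    · linarith [hcpos x hx, congrArg Prod.fst hxy]
    · rw [hcf x hx, hcf y hy] at hxy
      exact f4 hx hy hxy
  · intro x
    rcases lt_trichotomy x 0 with hx | rfl | hx
    · obtain ⟨x, rfl⟩ : ∃ u, x = -u := ⟨-x, by simp⟩
      rw [d4 x (by linarith)]
      exact neg_ne_zero.2 (g3 x (by linarith))
    · rw [d2]
      intro h0
      have h1 := H.1
      rw [h0] at h1
      exact zero_ne_one h1
    · rw [d3 x hx]
      exact f3 x hx
  · refine Subset.antisymm (range_subset_iff.2 fun x => ?_) fun w hw => ?_
    · rcases lt_trichotomy x 0 with hx | rfl | hx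
      · obtain ⟨x, rfl⟩ : ∃ u, x = -u := ⟨-x, by simp⟩
        rw [hcg x (by linarith)]
        exact (hgW x (by linarith)).1
      · rwa [hc0]
      · rw [hcf x hx]
        exact (hfW x hx).1
    · rcases lt_trichotomy w.1 0 with h1 | h1 | h1
      · obtain ⟨x, hx, rfl⟩ := g5.superset ⟨hw, h1⟩
        exact ⟨-x, hcg x hx⟩
      · exact ⟨0, hc0.trans (H.eq_of_fst_eq_zero hmag h hw h1).symm⟩
      · obtain ⟨x, hx, rfl⟩ := f5.superset ⟨hw, h1⟩
        exact ⟨x, hcf x hx⟩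

/-! ### Transversality -/

/-- The eigenvector that is tangent to the stable curve is tangent to the extended manifold. -/
theorem IsLocalStableCurve.inner_eq_zero (hmag : L.WeakMagnetism) (hF : L.IsFixed q ν)
    (H : L.IsLocalStableCurve (0, q, ν • q) ν v) : (inner ℝ q v.2.1 : ℝ) = 0 := by
  have h1 := congrArg (fun z : Amb n => (inner ℝ q z.2.1 : ℝ)) H.2.1
  rw [hF.fderiv_field_apply hmag] at h1
  simp only [Prod.smul_fst, Prod.smul_snd, inner_sub_right, inner_smul_right,
    real_inner_self_eq_norm_sq, hF.norm_eq] at h1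
  have h2 : ν * (inner ℝ q v.2.1 : ℝ) = 0 := by linarith
  exact (mul_eq_zero.1 h2).resolve_left hF.ne_zero

theorem tangentBdry_sup_span {ζ v : Amb n} (hv : v.1 = 1) (hqv : (inner ℝ ζ.2.1 v.2.1 : ℝ) = 0) :
    L.tangentBdry ζ ⊔ Submodule.span ℝ {v} = L.tangentExtended ζ := by
  have hv1 : v.2.1 ∈ sphereTangent ζ.2.1 := Submodule.mem_orthogonal_singleton_iff_inner_right.2 hqv
  refine le_antisymm (sup_le ?_ ?_) fun w hw => ?_
  · exact Submodule.prod_mono bot_le le_rfl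
  · rw [Submodule.span_singleton_le_iff_mem]
    exact ⟨trivial, hv1, trivial⟩
  · refine Submodule.mem_sup.2 ⟨w - w.1 • v, ⟨?_, ?_, trivial⟩, w.1 • v,
      Submodule.smul_mem _ _ (Submodule.mem_span_singleton_self v), sub_add_cancel _ _⟩
    · simp [hv]
    · exact Submodule.sub_mem _ hw.2.1 (Submodule.smul_mem _ _ hv1)

theorem IsFixed.exists_stable_line (hmag : L.WeakMagnetism) (h : L.IsFixed q ν)
    (hker : LinearMap.ker (sphereHess L.Ul q) = ⊥) (hν : ν < 0)
    (hmin : IsLocalMinOn L.Ul (Metric.sphere 0 1) q) :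
    ∃ c : ℝ → Amb n, IsImmersedLine c (L.stableManifold (0, q, ν • q)) ∧ c 0 = (0, q, ν • q) ∧
      (deriv c 0).1 = 1 ∧ (inner ℝ q (deriv c 0).2.1 : ℝ) = 0 := by
  obtain ⟨v, H⟩ := h.exists_isLocalStableCurve hmag hker hν hmin
  obtain ⟨c, h1, h2, rfl⟩ := h.exists_isImmersedLine_stableManifold hmag hν H
  exact ⟨c, h1, h2, H.1, H.inner_eq_zero hmag h⟩

theorem IsFixed.exists_unstable_line (hmag : L.WeakMagnetism) (h : L.IsFixed q ν)
    (hker : LinearMap.ker (sphereHess L.Ul q) = ⊥) (hν : 0 < ν)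
    (hmin : IsLocalMinOn L.Ul (Metric.sphere 0 1) q) :
    ∃ c : ℝ → Amb n, IsImmersedLine c (L.unstableManifold (0, q, ν • q)) ∧ c 0 = (0, q, ν • q) ∧
      (deriv c 0).1 = 1 ∧ (inner ℝ q (deriv c 0).2.1 : ℝ) = 0 := by
  obtain ⟨c, ⟨h1, h2, h3, h4⟩, h5, h6, h7⟩ :=
    h.neg.exists_stable_line (neg_weakMagnetism hmag) hker (by linarith) hmin
  have hz : reversal n (0, q, ν • q) = (0, q, (-ν) • q) := by simp [reversal_apply]
  have hd : ∀ x, deriv (fun x => reversal n (c x)) x = reversal n (deriv c x) := fun x =>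
    ((reversal n).hasFDerivAt.comp_hasDerivAt x
      (h1.differentiable one_ne_zero x).hasDerivAt).deriv
  refine ⟨fun x => reversal n (c x), ⟨(reversal n).contDiff.comp h1,
    (reversal n).injective.comp h2, fun x => ?_, ?_⟩, ?_, ?_, ?_⟩
  · rw [hd]
    exact (reversal n).map_ne_zero_iff.2 (h3 x)
  · rw [unstableManifold_eq, hz, ← h4]
    ext w
    refine ⟨?_, ?_⟩
    · rintro ⟨x, rfl⟩
      exact ⟨x, (reversal_reversal _).symm⟩
    · rintro ⟨x, hx⟩
      exact ⟨x, by simp only [hx, reversal_reversal]⟩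
  · simp only [h5, ← hz, reversal_reversal]
  · rw [hd, reversal_apply]
    exact h6
  · rw [hd, reversal_apply]
    exact h7

end LagrangianSystem
end McGehee

theorem mainTheorem9 {n : ℕ} (L : McGehee.LagrangianSystem n) (hmag : L.WeakMagnetism)
    (hMorse : McGehee.IsSphereMorse L.Ul) (hreg : McGehee.IsSphereRegularValue L.Ul 0) :
    -- the critical and subcritical boundary is a manifold with boundary
    McGehee.IsSubmanifoldWithBoundary (2 * n - 1) L.bdryLE L.bdryZero ∧
    -- its fixed points form a finite set of hyperbolic fixed points of the extended manifold
    L.fixedPoints L.bdryLE = L.fixedPoints L.bdryZero ∧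
    (L.fixedPoints L.bdryZero).Finite ∧
    (∀ ζ ∈ L.fixedPoints L.bdryZero, ∃ (q : McGehee.Vec n) (ν : ℝ),
      ζ = (0, q, ν • q) ∧ ν ≠ 0 ∧ McGehee.IsSphereCritical L.Ul q ∧
      ∃ T : L.tangentExtended ζ →ₗ[ℝ] L.tangentExtended ζ,
        L.IsLinearization ζ T ∧ McGehee.IsHyperbolic T ∧
        T.charpoly.map (algebraMap ℝ ℂ) =
          (Polynomial.X - Polynomial.C (ν : ℂ)) *
          (Polynomial.X - Polynomial.C (-(L.l : ℂ) * ν)) *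
          ((McGehee.sphereHess L.Ul q).charpoly.roots.map fun lam =>
            (Polynomial.X - Polynomial.C (McGehee.boundaryEigenvalue L.l ν lam 1)) *
            (Polynomial.X - Polynomial.C (McGehee.boundaryEigenvalue L.l ν lam (-1)))).prod) ∧
    -- interior orbits of zero energy converging to the fixed points
    (∀ (q : McGehee.Vec n) (ν : ℝ), (0, q, ν • q) ∈ L.fixedPoints L.bdryZero →
      (ν < 0 → ∃ z ∈ L.stableManifold (0, q, ν • q),
        L.orbit z ⊆ L.interiorM ∧ ∀ w ∈ L.orbit z, L.rescaledEnergy w = 0) ∧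
      (0 < ν → ∃ z ∈ L.unstableManifold (0, q, ν • q),
        L.orbit z ⊆ L.interiorM ∧ ∀ w ∈ L.orbit z, L.rescaledEnergy w = 0)) ∧
    -- invariant manifolds at the local minima
    (∀ (q : McGehee.Vec n) (ν : ℝ), (0, q, ν • q) ∈ L.fixedPoints L.bdryZero →
      IsLocalMinOn L.Ul (Metric.sphere 0 1) q →
      (ν < 0 →
        McGehee.IsOpenSubsetOf (L.unstableManifold (0, q, ν • q)) L.bdry ∧
        McGehee.IsOpenSubsetOf (L.unstableManifold (0, q, ν • q) ∩ L.bdryLE) L.bdryLE ∧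
        ∃ c : ℝ → McGehee.Amb n,
          McGehee.IsImmersedLine c (L.stableManifold (0, q, ν • q)) ∧ c 0 = (0, q, ν • q) ∧
          L.tangentBdry (0, q, ν • q) ⊔ Submodule.span ℝ {deriv c 0} =
            L.tangentExtended (0, q, ν • q)) ∧
      (0 < ν →
        McGehee.IsOpenSubsetOf (L.stableManifold (0, q, ν • q)) L.bdry ∧
        McGehee.IsOpenSubsetOf (L.stableManifold (0, q, ν • q) ∩ L.bdryLE) L.bdryLE ∧
        ∃ c : ℝ → McGehee.Amb n,
          McGehee.IsImmersedLine c (L.unstableManifold (0, q, ν • q)) ∧ c 0 = (0, q, ν • q) ∧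
          L.tangentBdry (0, q, ν • q) ⊔ Submodule.span ℝ {deriv c 0} =
            L.tangentExtended (0, q, ν • q))) := by
  have hfix : ∀ {q ν}, (0, q, ν • q) ∈ L.fixedPoints L.bdryZero →
      L.IsFixed q ν ∧ LinearMap.ker (McGehee.sphereHess L.Ul q) = ⊥ := fun h =>
    have hF := McGehee.LagrangianSystem.isFixed_of_mem_fixedPoints hmag hreg h
    ⟨hF, hMorse _ hF.isSphereCritical⟩
  refine ⟨L.isSubmanifoldWithBoundary_bdryLE hreg, L.fixedPoints_bdryLE hmag hreg,
    L.finite_fixedPoints hmag hMorse hreg, fun ζ hζ => ?_, fun q ν h => ?_, fun q ν h hmin => ?_⟩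
  · obtain ⟨h1, hF⟩ := McGehee.LagrangianSystem.isFixed_of_field_eq_zero hmag hreg hζ.1.1 hζ.2
    refine ⟨_, _, h1, hF.ne_zero, hF.isSphereCritical, ?_⟩
    have h2 := hF.exists_linearization hmag (hMorse _ hF.isSphereCritical)
    rwa [← h1] at h2
  · obtain ⟨hF, hker⟩ := hfix h
    exact ⟨hF.exists_stable_orbit hmag hker, hF.exists_unstable_orbit hmag hker⟩
  · obtain ⟨hF, hker⟩ := hfix h
    have hsub : L.bdryLE ⊆ L.bdry := fun ζ hζ => hζ.1
    refine ⟨fun hν => ?_, fun hν => ?_⟩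
    · have hO := hF.isOpenSubsetOf_unstableManifold hmag hker hν hmin
      obtain ⟨c, h1, h2, h3, h4⟩ := hF.exists_stable_line hmag hker hν hmin
      exact ⟨hO, McGehee.LagrangianSystem.isOpenSubsetOf_inter hO hsub, c, h1, h2,
        McGehee.LagrangianSystem.tangentBdry_sup_span h3 h4⟩
    · have hO := hF.isOpenSubsetOf_stableManifold hmag hker hν hmin
      obtain ⟨c, h1, h2, h3, h4⟩ := hF.exists_unstable_line hmag hker hν hmin
      exact ⟨hO, McGehee.LagrangianSystem.isOpenSubsetOf_inter hO hsub, c, h1, h2,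
        McGehee.LagrangianSystem.tangentBdry_sup_span h3 h4⟩
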